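/- **Theorem.** Let $\eta<1/4$ be a constant. There are a probabilistic polynomial-time algorithm $A$ and a sample size $n(d)=O(d\log d)$ (as $d\to\infty$) such that the following holds. Let $P$ be a real polynomial of degree at most $d$, let $0<\Delta<1$, $\delta>0$ and $m\ge 1$ be real numbers, and let $D=\{(x_i,y_i)\}_{i=1}^N$ be a set of $N\ge n(d)$ random data points such that * each $2x_i/\Delta-1$ has the Chebyshev distribution on $[-1,1]$, i.e. the density $\frac{1}{\pi\sqrt{1-t^2}}$ (so $x_i\in[0,\Delta]$ almost surely); * each point satisfies $\Pr[\,|y_i-P(x_i)|\ge\delta \mid x_i\,]\le\eta$ almost surely; * the pairs ($x_i$, the event $|y_i-P(x_i)|\ge\delta$), $i=1,\dots,N$, are independent (apart from this, the values $y_i$ are arbitrary and may depend on each other and on all the data). Then $A$, given $d,m,\Delta$ and $D$ (but not $P$ or $\delta$), returns a number $p_m$ such that, with probability at least $2/3$ over the data and the independent fair coin flips of $A$, $$|p_m-P(m)|\le\frac{9\delta}{4}\,\frac{(8m)^d}{\Delta^d}=\delta'\exp(-d\log\Delta'),\qquad \Delta'=\frac{\Delta}{8m},\quad \delta'=\frac{9\delta}{4}.$$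 Here $A$ is a finite program for a random access machine with index registers (natural numbers, with addition and truncated subtraction), memory cells holding real numbers, the operations $+,-,\times,/$ and comparison on cells, rational constants, and coin flips. "Polynomial time" means: on all real inputs and for all coin flips, $A$ halts within a number of steps bounded by a fixed polynomial in $d+N$; and on all rational inputs and for all coin flips, the number of steps plus the total bit length of all numbers written to memory cells is bounded by a fixed polynomial in $d$, $N$ and the bit length of the input (so that $A$ runs in polynomial time on a probabilistic Turing machine). -/

import Mathlib

open MeasureTheory ProbabilityTheory Filter Asymptotics
open scoped Polynomial

/-! ### Probabilistic real random access machines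

The machine has index registers `R 0, R 1, ...` holding natural numbers, memory cells
`M 0, M 1, ...` holding real numbers, addressed through the index registers, and an infinite
supply of coin flips.  It performs exact rational arithmetic and comparisons on the cells; its
only built-in real constants are rational, and there is no rounding operation and no conversion
of cell contents to indices.  Programs are finite. -/

namespace RealRAM

/-- A memory state: index registers, real memory cells, and the coin flips not used so far. -/
structure State where
  R : ℕ → ℕ
  M : ℕ → ℝ
  coins : ℕ → Bool

/-- The arithmetic operations. -/
inductive ArithOp
  | add | sub | mul | div

/-- The value of an arithmetic operation (division by zero returns zero; a program can test
for it). -/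
noncomputable def ArithOp.eval : ArithOp → ℝ → ℝ → ℝ
  | .add, a, b => a + b
  | .sub, a, b => a - b
  | .mul, a, b => a * b
  | .div, a, b => a / b

/-- The instructions. -/
inductive Instr
  /-- `R r := k` -/
  | setIdx (r k : ℕ)
  /-- `R r := R a + R b` -/
  | addIdx (r a b : ℕ)
  /-- `R r := R a - R b`, truncated at zero -/
  | subIdx (r a b : ℕ)
  /-- `R r := 0` or `R r := 1`, according to the next coin flip -/
  | flip (r : ℕ)
  /-- `M (R r) := q` -/
  | const (r : ℕ) (q : ℚ)
  /-- `M (R r) := M (R a) op M (R b)` -/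
  | arith (op : ArithOp) (r a b : ℕ)

/-- The effect of an instruction. -/
noncomputable def Instr.exec (s : State) : Instr → State
  | .setIdx r k => { s with R := Function.update s.R r k }
  | .addIdx r a b => { s with R := Function.update s.R r (s.R a + s.R b) }
  | .subIdx r a b => { s with R := Function.update s.R r (s.R a - s.R b) }
  | .flip r =>
      { s with
        R := Function.update s.R r (if s.coins 0 then 1 else 0)
        coins := fun i => s.coins (i + 1) }
  | .const r q => { s with M := Function.update s.M (s.R r) (q : ℝ) }
  | .arith op r a b =>
      { s with M := Function.update s.M (s.R r) (op.eval (s.M (s.R a)) (s.M (s.R b))) }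

/-- The cost of an instruction executed in state `s`, where writing a real number `v` to the
memory costs `κ v`, and an operation on index registers costs `1`. -/
noncomputable def Instr.cost (κ : ℝ → ℕ) (s : State) : Instr → ℕ
  | .setIdx _ _ => 1
  | .addIdx _ _ _ => 1
  | .subIdx _ _ _ => 1
  | .flip _ => 1
  | .const _ q => κ (q : ℝ)
  | .arith op _ a b => κ (op.eval (s.M (s.R a)) (s.M (s.R b)))

/-- The tests that control branching and loops. -/
inductive Test
  /-- `R a < R b` -/
  | idxLt (a b : ℕ)
  /-- `M (R a) < M (R b)` -/
  | cellLt (a b : ℕ)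

/-- The truth of a test in a state. -/
def Test.holds (s : State) : Test → Prop
  | .idxLt a b => s.R a < s.R b
  | .cellLt a b => s.M (s.R a) < s.M (s.R b)

/-- Programs. -/
inductive Prog
  | skip
  | instr (i : Instr)
  | seq (p q : Prog)
  | ite (t : Test) (p q : Prog)
  | while (t : Test) (p : Prog)

/-- `Run κ p s s' c`: started in state `s`, the program `p` halts in state `s'`, at total cost
`c`.  Every evaluation of a test costs `1`. -/
inductive Run (κ : ℝ → ℕ) : Prog → State → State → ℕ → Prop
  | skip (s : State) : Run κ .skip s s 0
  | instr (i : Instr) (s : State) : Run κ (.instr i) s (i.exec s) (i.cost κ s)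
  | seq {p q : Prog} {s s₁ s₂ : State} {c₁ c₂ : ℕ} :
      Run κ p s s₁ c₁ → Run κ q s₁ s₂ c₂ → Run κ (.seq p q) s s₂ (c₁ + c₂)
  | iteTrue {t : Test} {p q : Prog} {s s₁ : State} {c : ℕ} :
      t.holds s → Run κ p s s₁ c → Run κ (.ite t p q) s s₁ (1 + c)
  | iteFalse {t : Test} {p q : Prog} {s s₁ : State} {c : ℕ} :
      ¬ t.holds s → Run κ q s s₁ c → Run κ (.ite t p q) s s₁ (1 + c)
  | whileTrue {t : Test} {p : Prog} {s s₁ s₂ : State} {c₁ c₂ : ℕ} :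
      t.holds s → Run κ p s s₁ c₁ → Run κ (.while t p) s₁ s₂ c₂ →
      Run κ (.while t p) s s₂ (1 + c₁ + c₂)
  | whileFalse {t : Test} {p : Prog} {s : State} :
      ¬ t.holds s → Run κ (.while t p) s s 1

/-- Unit cost: the total cost is the number of steps. -/
def unitCost : ℝ → ℕ := fun _ => 1

/-- The number of bits of the numerator and the denominator of a rational number. -/
def ratBits (q : ℚ) : ℕ := q.num.natAbs.size + q.den.size

open Classical in
/-- Bit cost: writing a rational number costs one plus its bit length.  (It is used only for
computations in which all cells hold rational numbers.  As every number that is read is an input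
or has been paid for when it was written, polynomial total bit cost means polynomial time on a
probabilistic Turing machine.) -/
noncomputable def bitCost (v : ℝ) : ℕ :=
  if h : ∃ q : ℚ, (q : ℝ) = v then 1 + ratBits h.choose else 1

/-- The initial state for the interpolation problem: `R 0` holds the degree `d`, `R 1` holds the
number `N` of data points, `M 0` the evaluation point `m`, `M 1` the interval length `Δ`, and
`M (2 + 2 i)`, `M (3 + 2 i)` the `i`-th data point. -/
noncomputable def input (d : ℕ) {N : ℕ} (m Δ : ℝ) (D : Fin N → ℝ × ℝ) (coins : ℕ → Bool) :
    State where
  R := fun r => if r = 0 then d else if r = 1 then N else 0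
  M := fun k =>
    if k = 0 then m else if k = 1 then Δ
    else if h : (k - 2) / 2 < N then
      (if k % 2 = 0 then (D ⟨(k - 2) / 2, h⟩).1 else (D ⟨(k - 2) / 2, h⟩).2)
    else 0
  coins := coins

/-- `A` returns the number `v`, in the memory cell `M 0`, on the given input and coin flips. -/
def Returns (A : Prog) (d : ℕ) {N : ℕ} (m Δ : ℝ) (D : Fin N → ℝ × ℝ) (coins : ℕ → Bool)
    (v : ℝ) : Prop :=
  ∃ (s : State) (c : ℕ), Run unitCost A (input d m Δ D coins) s c ∧ s.M 0 = v

/-- `A` runs in polynomial time: on every real input and for all coin flips it halts within a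
number of steps that is polynomial in the degree and the number of data points, and on rational
inputs its bit cost is polynomial in these and the bit length of the input. -/
def PolyTime (A : Prog) : Prop :=
  ∃ T : Polynomial ℕ,
    (∀ (d N : ℕ) (m Δ : ℝ) (D : Fin N → ℝ × ℝ) (coins : ℕ → Bool),
      ∃ (s : State) (c : ℕ), Run unitCost A (input d m Δ D coins) s c ∧ c ≤ T.eval (d + N)) ∧
    (∀ (d N : ℕ) (m Δ : ℚ) (D : Fin N → ℚ × ℚ) (coins : ℕ → Bool),
      ∃ (s : State) (c : ℕ),
        Run bitCost A
          (input d (m : ℝ) (Δ : ℝ) (fun i => (((D i).1 : ℝ), ((D i).2 : ℝ))) coins) s c ∧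
        c ≤ T.eval (d + N + ratBits m + ratBits Δ +
          ∑ i, (ratBits (D i).1 + ratBits (D i).2)))

/-- The law of an infinite sequence of independent fair coin flips. -/
noncomputable def coinMeasure : Measure (ℕ → Bool) :=
  Measure.infinitePi fun _ => (PMF.uniformOfFintype Bool).toMeasure

end RealRAM

/-! ### Random data with outliers -/

/-- The Chebyshev distribution on `[-1, 1]`, with density `1 / (π √(1 - x ^ 2))`. -/
noncomputable def chebyshevDistribution : Measure ℝ :=
  (ENNReal.ofReal Real.pi)⁻¹ • Polynomial.Chebyshev.measureT

/-- Random data points `(x i, y i)`, `i < N`: the points `2 (x i) / Δ - 1` are Chebyshev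
distributed, and, given `x i`, the value `y i` is an outlier, `|y i - P (x i)| ≥ δ`, with
probability at most `η`.  Location and outlier status are independent from point to point;
otherwise the values `y i` are arbitrary, and may depend on all the data. -/
structure IsNoisySample {Ω : Type*} [MeasurableSpace Ω] (μ : Measure Ω) {N : ℕ}
    (x y : Fin N → Ω → ℝ) (P : ℝ[X]) (Δ δ η : ℝ) : Prop where
  measurable_x : ∀ i, Measurable (x i)
  measurable_y : ∀ i, Measurable (y i)
  law : ∀ i, μ.map (fun ω => 2 * x i ω / Δ - 1) = chebyshevDistribution
  indep : iIndepFun (fun i ω => (x i ω, δ ≤ |y i ω - P.eval (x i ω)|)) μ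
  outlier : ∀ i, ∀ᵐ ω ∂μ,
    (μ⟦{ω' | δ ≤ |y i ω' - P.eval (x i ω')|} | MeasurableSpace.comap (x i) inferInstance⟧) ω ≤ η

/-! Write x = Δ(1 + cos θ)/2, so that the angle θ is uniformly distributed on [0, π]. Bin j consists
of the angles very close to the j-th zero of the Chebyshev polynomial T_{d+1}, those with
|cos((d+1)θ)| ≤ 1/1000. The algorithm keeps one data point per bin, interpolates these by a
polynomial Q, and replaces the point of each bin by one with median residual y - Q(x).

Contraction. In the variable θ, the difference P - Q is a cosine polynomial g of degree at most d.
Gauss–Chebyshev quadrature turns the sum of g² over the d + 1 zeros into d + 1 times its mean square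
(`sum_trig_zeroAngle_sq`). Bernstein's inequality in L² and Cauchy–Schwarz bound the ℓ² norm of the
oscillations of g inside the bins by a tenth of the ℓ² norm of g at the zeros (`l2_osc_le`). If
fewer than half of the points of every bin are outliers, a median residual lies between residuals of
inliers, so the new error |y - P(x)| is at most δ plus an oscillation. Hence the ℓ² norm E of the
errors of the selected points changes to at most √(d+1) δ + E/9 (`IsGoodData.step`).

Number of steps. The initial error is not bounded in terms of d and N, so geometric decrease alone
gives no polynomial bound. But the selected errors always belong to a fixed list of N numbers, and
above the level 3√(d+1) δ their maximum drops strictly within N steps; by pigeonhole N² steps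
suffice (`l2_le_of_contraction`). Selecting data points, instead of computing corrected values, also
keeps the bit length bounded: every interpolation starts from input numbers.

Extrapolation. Cauchy–Schwarz for the Chebyshev coefficients and T_k(t) ≤ (2t)^k for t ≥ 1 carry the
mean square bound to the point m (`sq_eval_le`).

Probability. A bin has mass at least a constant over d + 1, of which outliers take at most the
fraction η < 1/4. An exponential moment bound for each bin and a union bound over the bins give O(d
log d) samples.

Machine. Bins are found by rational arithmetic: the quotients U_{k+1}/U_k at cos θ have product
sin((d+1)θ)/sin θ, and ⌊(d+1)θ/π⌋ of them are negative (`binOf_cos`). The algorithm flips no coins.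
Its running time is analysed once for an abstract notion of size (`SizeModel`), which covers both
unit cost and bit cost. -/

/-! ### An expression language for the machine -/

namespace RealRAM

/-- The accumulation steps of bounded loops. -/
inductive FoldOp
  | sum | prod | cfrac | last

/-- One accumulation step, from the accumulator `a` and the current value `v`. -/
noncomputable def FoldOp.step : FoldOp → ℝ → ℝ → ℝ
  | .sum, a, v => a + v
  | .prod, a, v => a * v
  | .cfrac, a, v => v - 1 / a
  | .last, _, v => v

/-- Expressions with bounded folds.  Index variables are natural numbers; `inp c v` reads the
input cell `2 * v + c`, `read a v` reads entry `v` of the work array `a`, and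
`fold o b v e₁ e₂ e₀ e` starts with `e₀` and, for `v = 0, …, b - 1`, applies the step `o` with the
value `e` if `e₁ < e₂`. -/
inductive Expr
  | inp (c v : ℕ)
  | const (q : ℚ)
  | read (a : Fin 7) (v : ℕ)
  | op (o : ArithOp) (e₁ e₂ : Expr)
  | iteLt (e₁ e₂ e₃ e₄ : Expr)
  | fold (o : FoldOp) (b v : ℕ) (e₁ e₂ e₀ e : Expr)

/-- The value of an expression, given the number `S` of input cells, their contents `I`, and the
contents `A` of the work arrays. -/
noncomputable def Expr.eval (S : ℕ) (I : ℕ → ℝ) (A : Fin 7 → ℕ → ℝ) : Expr → (ℕ → ℕ) → ℝ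
  | .inp c v, x => if 2 * x v + c < S then I (2 * x v + c) else 0
  | .const q, _ => q
  | .read a v, x => A a (x v)
  | .op o e₁ e₂, x => o.eval (e₁.eval S I A x) (e₂.eval S I A x)
  | .iteLt e₁ e₂ e₃ e₄, x =>
      open Classical in
      if e₁.eval S I A x < e₂.eval S I A x then e₃.eval S I A x else e₄.eval S I A x
  | .fold o b v e₁ e₂ e₀ e, x =>
      open Classical in
      Nat.rec (e₀.eval S I A x) (fun i a =>
        if e₁.eval S I A (Function.update x v i) < e₂.eval S I A (Function.update x v i) then
          o.step a (e.eval S I A (Function.update x v i)) else a) (x b)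

/-- A notion of size of numbers that is compatible with the arithmetic operations and with a cost
function. -/
structure SizeModel (κ : ℝ → ℕ) (Sz : ℝ → ℕ → Prop) : Prop where
  mono : ∀ {v h h'}, Sz v h → h ≤ h' → Sz v h'
  ofRat : ∀ q : ℚ, Sz (q : ℝ) (ratBits q)
  arith : ∀ (o : ArithOp) {a b h k}, Sz a h → Sz b k → Sz (o.eval a b) (h + k + 1)
  cost_le : ∀ {v h}, Sz v h → κ v ≤ 2 * h + 3

/-- A bound for the size of the value of an expression, when the loop bounds are at most `B`, the
inputs have size at most `H` and the entries of array `a` have size at most `h a`. -/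
def Expr.size (B H : ℕ) (h : Fin 7 → ℕ) : Expr → ℕ
  | .inp _ _ => 1 + H
  | .const q => ratBits q
  | .read a _ => h a
  | .op _ e₁ e₂ => e₁.size B H h + e₂.size B H h + 1
  | .iteLt _ _ e₃ e₄ => e₃.size B H h + e₄.size B H h
  | .fold .last _ _ _ _ e₀ e => e₀.size B H h + e.size B H h
  | .fold _ _ _ _ _ e₀ e => e₀.size B H h + B * (e.size B H h + 4)

/-- A bound for the cost of the evaluation of an expression. -/
def Expr.cost (B H : ℕ) (h : Fin 7 → ℕ) : Expr → ℕ
  | .inp _ _ => 20 + 4 * H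
  | .const q => 10 + 2 * ratBits q
  | .read a _ => 30 + 4 * h a
  | .op o e₁ e₂ => e₁.cost B H h + e₂.cost B H h + 10 + 2 * (Expr.op o e₁ e₂).size B H h
  | .iteLt e₁ e₂ e₃ e₄ =>
      e₁.cost B H h + e₂.cost B H h + 10 + e₃.cost B H h + e₄.cost B H h
  | .fold o b v e₁ e₂ e₀ e =>
      e₀.cost B H h + 10 + B * (e₁.cost B H h + e₂.cost B H h + e.cost B H h + 60 +
        4 * (Expr.fold o b v e₁ e₂ e₀ e).size B H h + 4 * e.size B H h)

theorem ratBits_zero : ratBits 0 = 1 := by decide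

theorem ratBits_one : ratBits 1 = 2 := by decide

theorem SizeModel.zero {κ Sz} (hS : SizeModel κ Sz) : Sz 0 1 := by
  simpa [ratBits_zero] using hS.ofRat 0

theorem SizeModel.one {κ Sz} (hS : SizeModel κ Sz) : Sz 1 2 := by
  simpa [ratBits_one] using hS.ofRat 1

/-- The partial values of a fold. -/
noncomputable def Expr.partialFold (S : ℕ) (I : ℕ → ℝ) (A : Fin 7 → ℕ → ℝ) (o : FoldOp) (v : ℕ)
    (e₁ e₂ e₀ e : Expr) (x : ℕ → ℕ) (n : ℕ) : ℝ :=
  open Classical in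
  Nat.rec (e₀.eval S I A x) (fun i a =>
    if e₁.eval S I A (Function.update x v i) < e₂.eval S I A (Function.update x v i) then
      o.step a (e.eval S I A (Function.update x v i)) else a) n

section Size

variable {κ : ℝ → ℕ} {Sz : ℝ → ℕ → Prop} {S B H : ℕ} {I : ℕ → ℝ} {A : Fin 7 → ℕ → ℝ}
  {h : Fin 7 → ℕ}

/-- The sizes of inputs and array entries are bounded by `H` and `h`. -/
structure SizeBound (Sz : ℝ → ℕ → Prop) (S : ℕ) (I : ℕ → ℝ) (A : Fin 7 → ℕ → ℝ) (H : ℕ)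
    (h : Fin 7 → ℕ) : Prop where
  inp : ∀ k < S, Sz (I k) H
  arr : ∀ a i, Sz (A a i) (h a)

/-- A `last` step discards the accumulator, so the size does not grow with the number of rounds. The
other steps add the size of the value and at most 4: for `cfrac`, the size 2 of the constant 1 and
one for each of two operations. -/
theorem Expr.partialFold_size (hS : SizeModel κ Sz) {o : FoldOp} {v : ℕ} {e₁ e₂ e₀ e : Expr}
    {x : ℕ → ℕ} (h0 : Sz (e₀.eval S I A x) (e₀.size B H h)) {n : ℕ} (hn : n ≤ B)
    (he : ∀ i < n, Sz (e.eval S I A (Function.update x v i)) (e.size B H h)) (b : ℕ) :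
    Sz (Expr.partialFold S I A o v e₁ e₂ e₀ e x n)
      ((Expr.fold o b v e₁ e₂ e₀ e).size B H h) := by
  by_cases ho : o = .last
  · subst ho
    induction n with
    | zero => exact hS.mono h0 (by simp [Expr.size])
    | succ n ih =>
      have := ih (by omega) (fun i hi => he i (by omega))
      simp only [partialFold] at this ⊢
      split_ifs
      · exact hS.mono (he n (by omega)) (by simp [Expr.size])
      · exact this
  · have key : Sz (Expr.partialFold S I A o v e₁ e₂ e₀ e x n)
        (e₀.size B H h + n * (e.size B H h + 4)) := by
      clear hn
      induction n with
      | zero => exact hS.mono h0 (by simp)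
      | succ n ih =>
        have ih := ih (fun i hi => he i (by omega))
        have he := he n (by omega)
        simp only [partialFold] at ih ⊢
        split_ifs
        · cases o with
          | sum => exact hS.mono (hS.arith .add ih he) (by ring_nf; omega)
          | prod => exact hS.mono (hS.arith .mul ih he) (by ring_nf; omega)
          | cfrac =>
            exact hS.mono (hS.arith .sub he (hS.arith .div hS.one ih)) (by ring_nf; omega)
          | last => exact absurd rfl ho
        · exact hS.mono ih (by ring_nf; omega)
    refine hS.mono key ?_
    have : n * (e.size B H h + 4) ≤ B * (e.size B H h + 4) := Nat.mul_le_mul_right _ hn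
    cases o <;> simp_all [Expr.size]

theorem Expr.eval_size (hS : SizeModel κ Sz) (hb : SizeBound Sz S I A H h) (e : Expr) :
    ∀ x : ℕ → ℕ, (∀ v, x v ≤ B) → Sz (e.eval S I A x) (e.size B H h) := by
  induction e with
  | inp c v =>
    intro x hx
    simp only [eval, size]
    split_ifs with hc
    · exact hS.mono (hb.inp _ hc) (by omega)
    · exact hS.mono hS.zero (by omega)
  | const q => intro x hx; exact hS.ofRat q
  | read a v => intro x hx; exact hb.arr _ _
  | op o e₁ e₂ h₁ h₂ => intro x hx; exact hS.arith o (h₁ x hx) (h₂ x hx)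
  | iteLt e₁ e₂ e₃ e₄ h₁ h₂ h₃ h₄ =>
    intro x hx
    simp only [eval, size]
    split_ifs
    · exact hS.mono (h₃ x hx) (by omega)
    · exact hS.mono (h₄ x hx) (by omega)
  | fold o b v e₁ e₂ e₀ e h₁ h₂ h₀ h =>
    intro x hx
    refine Expr.partialFold_size hS (h₀ x hx) (hx b) (fun i hi => h _ fun w => ?_) b
    have := hx b
    by_cases hw : w = v
    · subst hw; simp; omega
    · simp [hw, hx w]

end Size

/-! ### Compilation of expressions -/

/-- Straight-line code. -/
def block : List Instr → Prog
  | [] => .skip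
  | i :: l => .seq (.instr i) (block l)

/-- The state after straight-line code. -/
noncomputable def execs (s : State) : List Instr → State
  | [] => s
  | i :: l => execs (i.exec s) l

/-- The cost of straight-line code. -/
noncomputable def costs (κ : ℝ → ℕ) (s : State) : List Instr → ℕ
  | [] => 0
  | i :: l => i.cost κ s + costs κ (i.exec s) l

theorem run_block (κ : ℝ → ℕ) (l : List Instr) :
    ∀ s, Run κ (block l) s (execs s l) (costs κ s l) := by
  induction l with
  | nil => exact fun s => .skip s
  | cons i l ih => exact fun s => .seq (.instr i s) (ih _)

/-- `p` halts in a state with property `Q`, at cost at most `C`. -/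
def Ends (κ : ℝ → ℕ) (p : Prog) (s : State) (C : ℕ) (Q : State → Prop) : Prop :=
  ∃ s' c, Run κ p s s' c ∧ c ≤ C ∧ Q s'

section Ends

variable {κ : ℝ → ℕ} {p q : Prog} {s : State} {C C' : ℕ} {Q Q' : State → Prop}

theorem Ends.mono (h : Ends κ p s C Q) (hC : C ≤ C') (hQ : ∀ s', Q s' → Q' s') :
    Ends κ p s C' Q' := by
  obtain ⟨s', c, h1, h2, h3⟩ := h
  exact ⟨s', c, h1, h2.trans hC, hQ _ h3⟩

theorem Ends.seq (h : Ends κ p s C Q) (h' : ∀ s', Q s' → Ends κ q s' C' Q') :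
    Ends κ (.seq p q) s (C + C') Q' := by
  obtain ⟨s₁, c₁, h1, h2, h3⟩ := h
  obtain ⟨s₂, c₂, h4, h5, h6⟩ := h' _ h3
  exact ⟨s₂, c₁ + c₂, .seq h1 h4, by omega, h6⟩

theorem Ends.block (l : List Instr) (hC : costs κ s l ≤ C) (hQ : Q (execs s l)) :
    Ends κ (block l) s C Q :=
  ⟨_, _, run_block κ l s, hC, hQ⟩

theorem Ends.skip (hQ : Q s) : Ends κ .skip s 0 Q := ⟨_, _, .skip s, le_rfl, hQ⟩

theorem Ends.ite {t : Test} (h : t.holds s → Ends κ p s C Q) (h' : ¬ t.holds s → Ends κ q s C Q) :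
    Ends κ (.ite t p q) s (1 + C) Q := by
  by_cases ht : t.holds s
  · obtain ⟨s', c, h1, h2, h3⟩ := h ht
    exact ⟨s', 1 + c, .iteTrue ht h1, by omega, h3⟩
  · obtain ⟨s', c, h1, h2, h3⟩ := h' ht
    exact ⟨s', 1 + c, .iteFalse ht h1, by omega, h3⟩

/-- The invariant fixes the counter register, so termination is a count of rounds. Each round pays
for its test and its body, and the last, failing test costs 1. -/
theorem Ends.loop {r b n : ℕ} (Inv : ℕ → State → Prop)
    (hr : ∀ i s, Inv i s → s.R r = i ∧ s.R b = n)
    (hstep : ∀ i < n, ∀ s, Inv i s → Ends κ p s C (Inv (i + 1))) (h0 : Inv 0 s) :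
    Ends κ (.while (.idxLt r b) p) s (n * (1 + C) + 1) (Inv n) := by
  suffices ∀ k i s, i + k = n → Inv i s →
      Ends κ (.while (.idxLt r b) p) s (k * (1 + C) + 1) (Inv n) from this n 0 s (by omega) h0
  intro k
  induction k with
  | zero =>
    intro i s hi hs
    obtain rfl : i = n := by omega
    refine ⟨s, 1, .whileFalse ?_, by omega, hs⟩
    simp [Test.holds, hr i s hs]
  | succ k ih =>
    intro i s hi hs
    obtain ⟨s₁, c₁, h1, h2, h3⟩ := hstep i (by omega) s hs
    obtain ⟨s₂, c₂, h4, h5, h6⟩ := ih (i + 1) s₁ (by omega) h3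
    refine ⟨s₂, 1 + c₁ + c₂, .whileTrue ?_ h1 h4, ?_, h6⟩
    · simp only [Test.holds, hr i s hs]; omega
    · ring_nf at h5 ⊢; omega

end Ends

/-- Code that sets `R r` to the address of the temporary cell `k`. -/
def addrTmp (r k : ℕ) : List Instr := [.setIdx r (8 * k + 7), .addIdx r r 3]

/-- Code that sets `R r` to the address of entry `R j` of the work array `a`. -/
def addrArr (r : ℕ) (a : Fin 7) (j : ℕ) : List Instr :=
  [.addIdx r j j, .addIdx r r r, .addIdx r r r, .addIdx r r 3, .setIdx 8 a, .addIdx r r 8]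

/-- The code of an accumulation step, with the accumulator in the temporary cell `k` and the
value in the temporary cell `k + 1`. -/
def FoldOp.code (k : ℕ) : FoldOp → List Instr
  | .sum => [.arith .add 5 5 6]
  | .prod => [.arith .mul 5 5 6]
  | .cfrac => addrTmp 7 (k + 2) ++ [.const 7 1, .arith .div 5 7 5, .arith .sub 5 6 5]
  | .last => [.const 5 0, .arith .add 5 5 6]

/-- The code of an expression: the variable `v` is in the register `10 + ρ v`, the registers from
`10 + l` on and the temporary cells from `k` on may be used, and the value is written to the
temporary cell `k`. -/
def Expr.code : Expr → (ℕ → ℕ) → ℕ → ℕ → Prog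
  | .inp c v, ρ, _, k =>
      .seq (block (addrTmp 5 k ++ [.const 5 0, .addIdx 6 (10 + ρ v) (10 + ρ v), .setIdx 7 c,
        .addIdx 6 6 7])) (.ite (.idxLt 6 3) (block [.arith .add 5 5 6]) .skip)
  | .const q, _, _, k => block (addrTmp 5 k ++ [.const 5 q])
  | .read a v, ρ, _, k =>
      block (addrTmp 5 k ++ [.const 5 0] ++ addrArr 6 a (10 + ρ v) ++ [.arith .add 5 5 6])
  | .op o e₁ e₂, ρ, l, k =>
      .seq (e₁.code ρ l k) (.seq (e₂.code ρ l (k + 1))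
        (block (addrTmp 5 k ++ addrTmp 6 (k + 1) ++ [.arith o 5 5 6])))
  | .iteLt e₁ e₂ e₃ e₄, ρ, l, k =>
      .seq (e₁.code ρ l k) (.seq (e₂.code ρ l (k + 1))
        (.seq (block (addrTmp 5 k ++ addrTmp 6 (k + 1)))
          (.ite (.cellLt 5 6) (e₃.code ρ l k) (e₄.code ρ l k))))
  | .fold o b v e₁ e₂ e₀ e, ρ, l, k =>
      .seq (e₀.code ρ l k) (.seq (block [.setIdx (10 + l) 0])
        (.while (.idxLt (10 + l) (10 + ρ b))
          (.seq (e₁.code (Function.update ρ v l) (l + 1) (k + 1))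
            (.seq (e₂.code (Function.update ρ v l) (l + 1) (k + 2))
              (.seq (block (addrTmp 5 (k + 1) ++ addrTmp 6 (k + 2)))
                (.seq (.ite (.cellLt 5 6)
                  (.seq (e.code (Function.update ρ v l) (l + 1) (k + 1))
                    (block (addrTmp 5 k ++ addrTmp 6 (k + 1) ++ o.code k))) .skip)
                  (block [.addIdx (10 + l) (10 + l) 4])))))))

/-- `s` represents the input `I`, the arrays `A` and the values `x` of the variables. -/
structure Rep (S : ℕ) (I : ℕ → ℝ) (A : Fin 7 → ℕ → ℝ) (ρ : ℕ → ℕ) (l : ℕ) (x : ℕ → ℕ)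
    (s : State) : Prop where
  base : s.R 3 = S
  one : s.R 4 = 1
  slot : ∀ v, ρ v < l
  var : ∀ v, s.R (10 + ρ v) = x v
  inp : ∀ k < S, s.M k = I k
  arr : ∀ (a : Fin 7) i, s.M (S + 8 * i + a) = A a i

/-- `s'` differs from `s` only in scratch registers, the registers from `10 + l` on, and the
temporary cells from `k` on. -/
structure Keeps (S l k : ℕ) (s s' : State) : Prop where
  reg : ∀ r, r < 5 ∨ (10 ≤ r ∧ r < 10 + l) → s'.R r = s.R r
  cell : ∀ c, (∀ j, k ≤ j → c ≠ S + 8 * j + 7) → s'.M c = s.M c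

theorem Keeps.refl {S l k s} : Keeps S l k s s := ⟨fun _ _ => rfl, fun _ _ => rfl⟩

theorem Keeps.trans {S l k s s' s''} (h : Keeps S l k s s') (h' : Keeps S l k s' s'') :
    Keeps S l k s s'' :=
  ⟨fun r hr => (h'.reg r hr).trans (h.reg r hr), fun c hc => (h'.cell c hc).trans (h.cell c hc)⟩

theorem Keeps.weaken {S l l' k k' s s'} (h : Keeps S l k s s') (hl : l' ≤ l) (hk : k' ≤ k) :
    Keeps S l' k' s s' :=
  ⟨fun r hr => h.reg r (by omega), fun c hc => h.cell c fun j hj => hc j (by omega)⟩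

theorem Keeps.tmp {S l k s s'} (h : Keeps S l k s s') {j : ℕ} (hj : j < k) :
    s'.M (S + 8 * j + 7) = s.M (S + 8 * j + 7) :=
  h.cell _ fun i hi => by omega

/-- Beyond the `S` input cells the memory consists of blocks of eight: offsets 0 to 6 belong to the
work arrays and offset 7 to the temporary cells, so temporary results never overwrite an array. -/
theorem Rep.of_keeps {S I A ρ l x s s' k} (h : Rep S I A ρ l x s) (hk : Keeps S l k s s') :
    Rep S I A ρ l x s' where
  base := (hk.reg 3 (by omega)).trans h.base
  one := (hk.reg 4 (by omega)).trans h.one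
  slot := h.slot
  var v := (hk.reg _ (by have := h.slot v; omega)).trans (h.var v)
  inp c hc := (hk.cell c fun j _ => by omega).trans (h.inp c hc)
  arr a i := (hk.cell _ fun j _ => by have := a.2; omega).trans (h.arr a i)

/-- Binding a loop variable only redirects the environment to the loop counter. Raising the level
protects this register from the code of the loop body. -/
theorem Rep.update {S I A ρ l x s} (h : Rep S I A ρ l x s) (v : ℕ) {i : ℕ}
    (hi : s.R (10 + l) = i) :
    Rep S I A (Function.update ρ v l) (l + 1) (Function.update x v i) s where
  base := h.base
  one := h.one
  slot w := by
    have := h.slot w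
    by_cases hw : w = v
    · subst hw; simp
    · simp [hw]; omega
  var w := by
    by_cases hw : w = v
    · subst hw; simpa using hi
    · simpa [hw] using h.var w
  inp := h.inp
  arr := h.arr

end RealRAM

/-! ### Correctness and cost of compiled expressions -/

namespace RealRAM

section CodeCorrect

variable {κ : ℝ → ℕ} {Sz : ℝ → ℕ → Prop} {S B H : ℕ} {I : ℕ → ℝ} {A : Fin 7 → ℕ → ℝ}
  {h : Fin 7 → ℕ}

theorem execs_append (s : State) (l₁ l₂ : List Instr) :
    execs s (l₁ ++ l₂) = execs (execs s l₁) l₂ := by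
  induction l₁ generalizing s with
  | nil => rfl
  | cons i l ih => exact ih _

theorem costs_append (κ : ℝ → ℕ) (s : State) (l₁ l₂ : List Instr) :
    costs κ s (l₁ ++ l₂) = costs κ s l₁ + costs κ (execs s l₁) l₂ := by
  induction l₁ generalizing s with
  | nil => simp [costs, execs]
  | cons i l ih => simp [costs, execs, ih]; omega

theorem execs_addrTmp {s : State} (hs : s.R 3 = S) {r : ℕ} (hr : r ≠ 3) (k : ℕ) :
    execs s (addrTmp r k) = { s with R := Function.update s.R r (S + 8 * k + 7) } := by
  have : 8 * k + 7 + S = S + 8 * k + 7 := by omega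
  simp [addrTmp, execs, Instr.exec, hs, hr.symm, this]

theorem costs_addrTmp (κ : ℝ → ℕ) (s : State) (r k : ℕ) : costs κ s (addrTmp r k) = 2 := by
  simp [addrTmp, costs, Instr.cost]

theorem execs_addrArr {s : State} (hs : s.R 3 = S) {r : ℕ} (hr : r ≠ 3) (hr8 : r ≠ 8) (a : Fin 7)
    (j : ℕ) :
    execs s (addrArr r a j) = { s with
      R := Function.update (Function.update s.R 8 a) r (S + 8 * s.R j + a) } := by
  have : s.R j + s.R j + (s.R j + s.R j) + (s.R j + s.R j + (s.R j + s.R j)) + S + (a : ℕ) =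
      S + 8 * s.R j + a := by omega
  simp [addrArr, execs, Instr.exec, hs, hr.symm, hr8, Function.update_comm hr8.symm, this]

theorem costs_addrArr (κ : ℝ → ℕ) (s : State) (r : ℕ) (a : Fin 7) (j : ℕ) :
    costs κ s (addrArr r a j) = 6 := by
  simp [addrArr, costs, Instr.cost]

theorem Ends.block_append {s : State} {C C' : ℕ} {Q : State → Prop} (l₁ l₂ : List Instr)
    (hC : costs κ s l₁ ≤ C) (h : Ends κ (RealRAM.block l₂) (execs s l₁) C' Q) :
    Ends κ (RealRAM.block (l₁ ++ l₂)) s (C + C') Q := by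
  induction l₁ generalizing s C with
  | nil => exact h.mono (by omega) fun _ h => h
  | cons i l ih =>
    simp only [costs] at hC
    obtain ⟨s', c, h1, h2, h3⟩ := ih (s := i.exec s) le_rfl h
    exact ⟨s', i.cost κ s + c, .seq (.instr i s) h1, by omega, h3⟩

theorem Keeps.update_reg {l k : ℕ} {s s' : State} (hs : Keeps S l k s s') {r : ℕ}
    (hr : 5 ≤ r ∧ (r < 10 ∨ 10 + l ≤ r)) (i : ℕ) :
    Keeps S l k s { s' with R := Function.update s'.R r i } :=
  ⟨fun r' hr' => by
    rw [← hs.reg r' hr']; exact Function.update_of_ne (by omega) _ _, hs.cell⟩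

theorem Keeps.update_tmp {l k : ℕ} {s s' : State} (hs : Keeps S l k s s') {j : ℕ} (hj : k ≤ j)
    (v : ℝ) : Keeps S l k s { s' with M := Function.update s'.M (S + 8 * j + 7) v } :=
  ⟨hs.reg, fun c hc => by
    rw [← hs.cell c hc]; exact Function.update_of_ne (hc j hj) _ _⟩

/-- The bound `m'` for the old accumulator is needed for `cfrac`, where the reciprocal of the
accumulator is written to memory and has to be paid for. -/
theorem FoldOp.code_ends (hS : SizeModel κ Sz) (o : FoldOp) {s : State} {l k : ℕ}
    (hs : s.R 3 = S) (h5 : s.R 5 = S + 8 * k + 7) (h6 : s.R 6 = S + 8 * (k + 1) + 7) {m m' : ℕ}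
    (hm : Sz (o.step (s.M (S + 8 * k + 7)) (s.M (S + 8 * (k + 1) + 7))) m)
    (hm' : Sz (s.M (S + 8 * k + 7)) m') :
    Ends κ (block (o.code k)) s (2 * m + 2 * m' + 30) (fun s' => Keeps S l k s s' ∧
      s'.M (S + 8 * k + 7) = o.step (s.M (S + 8 * k + 7)) (s.M (S + 8 * (k + 1) + 7))) := by
  have h57 : (5 : ℕ) ≠ 7 := by decide
  have hc := hS.cost_le hm
  have h0 := hS.cost_le hS.zero
  have h1 := hS.cost_le hS.one
  have hi := hS.cost_le (hS.arith .div hS.one hm')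
  have e1 : ArithOp.eval .add = fun a b => a + b := rfl
  have e2 : ArithOp.eval .sub = fun a b => a - b := rfl
  have e3 : ArithOp.eval .mul = fun a b => a * b := rfl
  have e4 : ArithOp.eval .div = fun a b => a / b := rfl
  cases o with
  | sum =>
    refine Ends.block _ ?_ ⟨?_, ?_⟩
    · simp only [FoldOp.code, costs, Instr.cost, h5, h6]
      simp only [e1, FoldOp.step] at *
      omega
    · simp only [FoldOp.code, execs, Instr.exec, h5]
      exact Keeps.refl.update_tmp le_rfl _
    · simp [FoldOp.code, execs, Instr.exec, h5, h6, FoldOp.step, e1]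
  | prod =>
    refine Ends.block _ ?_ ⟨?_, ?_⟩
    · simp only [FoldOp.code, costs, Instr.cost, h5, h6]
      simp only [e3, FoldOp.step] at *
      omega
    · simp only [FoldOp.code, execs, Instr.exec, h5]
      exact Keeps.refl.update_tmp le_rfl _
    · simp [FoldOp.code, execs, Instr.exec, h5, h6, FoldOp.step, e3]
  | last =>
    refine Ends.block _ ?_ ⟨?_, ?_⟩
    · simp only [FoldOp.code, costs, Instr.cost, Instr.exec, h5, h6]
      simp [e1, FoldOp.step] at *
      omega
    · simp only [FoldOp.code, execs, Instr.exec, h5]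
      exact (Keeps.refl.update_tmp le_rfl _).update_tmp le_rfl _
    · simp [FoldOp.code, execs, Instr.exec, h5, h6, FoldOp.step, e1]
  | cfrac =>
    have ea := execs_addrTmp hs (r := 7) (by omega) (k + 2)
    refine Ends.block _ ?_ ⟨?_, ?_⟩
    · simp only [FoldOp.code, costs_append, costs_addrTmp, ea]
      simp [costs, Instr.cost, Instr.exec, h5, h6, e2, e4, FoldOp.step] at *
      omega
    · simp only [FoldOp.code, execs_append, ea]
      simp only [execs, Instr.exec, Function.update_self, Function.update_of_ne h57, h5]
      exact ((((Keeps.refl.update_reg (by omega) _).update_tmp (by omega) _).update_tmp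
        le_rfl _).update_tmp le_rfl _)
    · simp only [FoldOp.code, execs_append, ea]
      simp [execs, Instr.exec, h5, h6, FoldOp.step, e2, e4]

/-- Operands are evaluated into successive temporary cells. The code for a later operand touches
only cells from its own onwards, so the earlier results survive. -/
theorem Expr.code_ends (hS : SizeModel κ Sz) (hb : SizeBound Sz S I A H h) (e : Expr) :
    ∀ (ρ : ℕ → ℕ) (l k : ℕ) (x : ℕ → ℕ) (s : State), Rep S I A ρ l x s → (∀ v, x v ≤ B) →
      Ends κ (e.code ρ l k) s (e.cost B H h)
        (fun s' => Keeps S l k s s' ∧ s'.M (S + 8 * k + 7) = e.eval S I A x) := by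
  have h56 : (5 : ℕ) ≠ 6 := by decide
  have h57 : (5 : ℕ) ≠ 7 := by decide
  have h58 : (5 : ℕ) ≠ 8 := by decide
  have hc0 := hS.cost_le hS.zero
  have e1 : ArithOp.eval .add = fun a b => a + b := rfl
  induction e with
  | inp c v =>
    intro ρ l k x s hs hx
    have ea := execs_addrTmp hs.base (r := 5) (by omega) k
    have hv := hs.var v
    refine ((Ends.block (C := 12)
      (Q := fun s' => Keeps S l k s s' ∧ s'.R 5 = S + 8 * k + 7 ∧ s'.R 6 = 2 * x v + c ∧
        s'.R 3 = S ∧ s'.M (S + 8 * k + 7) = 0) _ ?_ ?_).seq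
      fun s' hs' => Ends.ite (C := 2 * H + 5)
        (Q := fun s' => Keeps S l k s s' ∧ s'.M (S + 8 * k + 7) = (Expr.inp c v).eval S I A x)
        ?_ ?_).mono ?_ fun _ h => h
    · simp only [costs_append, costs_addrTmp, ea]
      simp [costs, Instr.cost]
      omega
    · simp only [execs_append, ea]
      simp only [execs, Instr.exec]
      refine ⟨?_, ?_⟩
      · exact ((((Keeps.refl.update_reg (by omega) _).update_tmp (by omega) _).update_reg
          (by omega) _).update_reg (by omega) _).update_reg (by omega) _
      · simp [hs.base]
        have : 10 + ρ v ≠ 5 := by omega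
        simp [this, hv]
        omega
    · obtain ⟨hk, h5, h6, h3, h0⟩ := hs'
      intro ht
      simp only [Test.holds, h6, h3] at ht
      have hI : s'.M (2 * x v + c) = I (2 * x v + c) := (hs.of_keeps hk).inp _ ht
      refine Ends.block _ ?_ ?_
      · simp [costs, Instr.cost, h5, h6, h0, e1, hI]
        have := hS.cost_le (hb.inp _ ht)
        omega
      · simp only [execs, Instr.exec, h5, h6, h0, e1]
        refine ⟨hk.update_tmp le_rfl _, ?_⟩
        simp [Expr.eval, ht, hI]
    · obtain ⟨hk, h5, h6, h3, h0⟩ := hs'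
      intro ht
      simp only [Test.holds, h6, h3] at ht
      exact (Ends.skip ⟨hk, by simp [Expr.eval, ht, h0]⟩).mono (by omega) fun _ h => h
    · simp [Expr.cost]; omega
  | const q =>
    intro ρ l k x s hs hx
    have ea := execs_addrTmp hs.base (r := 5) (by omega) k
    have := hS.cost_le (hS.ofRat q)
    refine Ends.block _ ?_ ⟨?_, ?_⟩
    · simp only [costs_append, costs_addrTmp, ea]
      simp [costs, Instr.cost, Expr.cost]
      omega
    · simp only [execs_append, ea]
      simp only [execs, Instr.exec, Function.update_self]
      exact (Keeps.refl.update_reg (by omega) _).update_tmp (by omega) _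
    · simp only [execs_append, ea]
      simp [execs, Instr.exec, Expr.eval]
  | read a v =>
    intro ρ l k x s hs hx
    have ea := execs_addrTmp hs.base (r := 5) (by omega) k
    have hv := hs.var v
    have hA := hs.arr a (x v)
    have := hS.cost_le (hb.arr a (x v))
    have ha := a.2
    have hl := hs.slot v
    have n5 : 10 + ρ v ≠ 5 := by omega
    have n6 : 10 + ρ v ≠ 6 := by omega
    -- Array cells have offset at most 6 in their block, so clearing the target does not destroy the
    -- source.
    have n7 : S + 8 * x v + (a : ℕ) ≠ S + 8 * k + 7 := by omega
    have eb : execs s (addrTmp 5 k ++ [.const 5 0]) = { s with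
        R := Function.update s.R 5 (S + 8 * k + 7)
        M := Function.update s.M (S + 8 * k + 7) 0 } := by
      simp only [execs_append, ea]
      simp [execs, Instr.exec]
    have ec : execs s (addrTmp 5 k ++ [.const 5 0] ++ addrArr 6 a (10 + ρ v)) = { s with
        R := Function.update (Function.update (Function.update s.R 5 (S + 8 * k + 7)) 8 a) 6
          (S + 8 * x v + a)
        M := Function.update s.M (S + 8 * k + 7) 0 } := by
      rw [execs_append, eb, execs_addrArr (S := S) (by simp [hs.base]) (by omega) (by omega)]
      simp [n5, hv]
    refine (Ends.block_append (C := 13) (C' := 2 * h a + 3) _ _ ?_ (Ends.block _ ?_ ⟨?_, ?_⟩)).mono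
      ?_ fun _ h => h
    · simp only [costs_append, costs_addrTmp, ea, costs_addrArr]
      simp [costs, Instr.cost]
      omega
    · rw [ec]
      simpa [costs, Instr.cost, n7, hA, e1] using this
    · simp [Expr.cost]; omega
    · rw [ec]
      simp only [execs, Instr.exec, Function.update_self, Function.update_of_ne h56,
        Function.update_of_ne h58]
      exact ((((Keeps.refl.update_reg (by omega) _).update_tmp (by omega) _).update_reg (by omega)
        _).update_reg (by omega) _).update_tmp (by omega) _
    · rw [ec]
      simp [execs, Instr.exec, Expr.eval, n7, hA, e1]
  | op o e₁ e₂ h₁ h₂ =>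
    intro ρ l k x s hs hx
    have hz := hS.cost_le ((Expr.op o e₁ e₂).eval_size hS hb x hx)
    refine ((h₁ ρ l k x s hs hx).seq fun s₁ hs₁ =>
      (h₂ ρ l (k + 1) x s₁ (hs.of_keeps hs₁.1) hx).seq fun s₂ hs₂ =>
      Ends.block (C := 4 + (2 * (Expr.op o e₁ e₂).size B H h + 3)) (Q := fun s' =>
        Keeps S l k s s' ∧ s'.M (S + 8 * k + 7) = (Expr.op o e₁ e₂).eval S I A x) _ ?_ ?_).mono
        ?_ fun _ h => h
    · obtain ⟨hk1, hv1⟩ := hs₁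
      obtain ⟨hk2, hv2⟩ := hs₂
      have hr := (hs.of_keeps hk1).of_keeps hk2
      have ea := execs_addrTmp hr.base (r := 5) (by omega) k
      have eb := execs_addrTmp (s := execs s₂ (addrTmp 5 k)) (S := S) (r := 6)
        (by rw [ea]; simp [hr.base]) (by omega) (k + 1)
      rw [hk2.tmp (by omega) |>.symm] at hv1
      simp only [costs_append, execs_append, costs_addrTmp, eb]
      simp only [costs, Instr.cost, Function.update_self, ea]
      simp [hv1, hv2]
      exact hz
    · obtain ⟨hk1, hv1⟩ := hs₁
      obtain ⟨hk2, hv2⟩ := hs₂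
      have hr := (hs.of_keeps hk1).of_keeps hk2
      have ea := execs_addrTmp hr.base (r := 5) (by omega) k
      have eb := execs_addrTmp (s := execs s₂ (addrTmp 5 k)) (S := S) (r := 6)
        (by rw [ea]; simp [hr.base]) (by omega) (k + 1)
      rw [hk2.tmp (by omega) |>.symm] at hv1
      simp only [execs_append, eb]
      simp only [execs, Instr.exec, ea, Function.update_self, Function.update_of_ne h56]
      refine ⟨(((hk1.trans (hk2.weaken le_rfl (by omega))).update_reg (by omega) _).update_reg
        (by omega) _).update_tmp le_rfl _, ?_⟩
      simp [hv1, hv2, Expr.eval]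
    · simp [Expr.cost]; omega
  | iteLt e₁ e₂ e₃ e₄ h₁ h₂ h₃ h₄ =>
    intro ρ l k x s hs hx
    refine ((h₁ ρ l k x s hs hx).seq fun s₁ hs₁ =>
      (h₂ ρ l (k + 1) x s₁ (hs.of_keeps hs₁.1) hx).seq fun s₂ hs₂ =>
      (Ends.block (C := 4) (Q := fun s' => Keeps S l k s s' ∧ s'.R 5 = S + 8 * k + 7 ∧
        s'.R 6 = S + 8 * (k + 1) + 7 ∧ s'.M (S + 8 * k + 7) = e₁.eval S I A x ∧
        s'.M (S + 8 * (k + 1) + 7) = e₂.eval S I A x) _ ?_ ?_).seq fun s₃ hs₃ =>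
      Ends.ite (C := e₃.cost B H h + e₄.cost B H h) (Q := fun s' => Keeps S l k s s' ∧
        s'.M (S + 8 * k + 7) = (Expr.iteLt e₁ e₂ e₃ e₄).eval S I A x) ?_ ?_).mono
        ?_ fun _ h => h
    · simp only [costs_append, costs_addrTmp]
      omega
    · obtain ⟨hk1, hv1⟩ := hs₁
      obtain ⟨hk2, hv2⟩ := hs₂
      have hr := (hs.of_keeps hk1).of_keeps hk2
      have ea := execs_addrTmp hr.base (r := 5) (by omega) k
      have eb := execs_addrTmp (s := execs s₂ (addrTmp 5 k)) (S := S) (r := 6)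
        (by rw [ea]; simp [hr.base]) (by omega) (k + 1)
      rw [hk2.tmp (by omega) |>.symm] at hv1
      simp only [execs_append, eb]
      simp only [ea]
      refine ⟨((hk1.trans (hk2.weaken le_rfl (by omega))).update_reg (by omega) _).update_reg
        (by omega) _, ?_⟩
      simp [hv1, hv2]
    · obtain ⟨hk, h5, h6, hv1, hv2⟩ := hs₃
      intro ht
      simp only [Test.holds, h5, h6, hv1, hv2] at ht
      refine (h₃ ρ l k x s₃ (hs.of_keeps hk) hx).mono (by omega) fun s' hs' =>
        ⟨hk.trans hs'.1, ?_⟩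
      simp [hs'.2, Expr.eval, ht]
    · obtain ⟨hk, h5, h6, hv1, hv2⟩ := hs₃
      intro ht
      simp only [Test.holds, h5, h6, hv1, hv2] at ht
      refine (h₄ ρ l k x s₃ (hs.of_keeps hk) hx).mono (by omega) fun s' hs' =>
        ⟨hk.trans hs'.1, ?_⟩
      simp [hs'.2, Expr.eval, ht]
    · simp [Expr.cost]; omega
  | fold o b v e₁ e₂ e₀ e h₁ h₂ h₀ h' =>
    intro ρ l k x s hs hx
    have hpf : ∀ i ≤ x b, Sz (Expr.partialFold S I A o v e₁ e₂ e₀ e x i)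
        ((Expr.fold o b v e₁ e₂ e₀ e).size B H h) := fun i hi =>
      Expr.partialFold_size hS (e₀.eval_size hS hb x hx) (hi.trans (hx b)) (fun j hj =>
        e.eval_size hS hb _ fun w => by
          have := hx b
          by_cases hw : w = v
          · subst hw; simp; omega
          · simp [hw, hx w]) b
    set m := (Expr.fold o b v e₁ e₂ e₀ e).size B H h with hm
    refine ((h₀ ρ l k x s hs hx).seq fun s₀ hs₀ =>
      (Ends.block (C := 1) (Q := fun s' => Keeps S l k s s' ∧ s'.R (10 + l) = 0 ∧
        s'.M (S + 8 * k + 7) = e₀.eval S I A x) _ ?_ ?_).seq fun s₁ hs₁ =>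
      (Ends.loop (n := x b) (C := e₁.cost B H h + e₂.cost B H h + e.cost B H h + 50 + 4 * m +
        4 * e.size B H h)
        (fun i s' => Keeps S l k s s' ∧ s'.R (10 + l) = i ∧
          s'.M (S + 8 * k + 7) = Expr.partialFold S I A o v e₁ e₂ e₀ e x i) ?_ ?_ ?_)).mono
        ?_ ?_
    · simp [costs, Instr.cost]
    · obtain ⟨hk, hv⟩ := hs₀
      simp only [execs, Instr.exec]
      exact ⟨hk.update_reg (by omega) _, by simp, hv⟩
    · rintro i s' ⟨hk, hi, -⟩
      exact ⟨hi, (hs.of_keeps hk).var b⟩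
    · rintro i hi s₂ ⟨hk, hri, hacc⟩
      have hr₂ := (hs.of_keeps hk).update v hri
      have hx' : ∀ w, Function.update x v i w ≤ B := fun w => by
        have := hx b
        by_cases hw : w = v
        · subst hw; simp; omega
        · simp [hw, hx w]
      refine ((h₁ _ (l + 1) (k + 1) _ s₂ hr₂ hx').seq fun s₃ hs₃ =>
        (h₂ _ (l + 1) (k + 2) _ s₃ (hr₂.of_keeps hs₃.1) hx').seq fun s₄ hs₄ =>
        (Ends.block (C := 4) (Q := fun s' => Keeps S (l + 1) (k + 1) s₂ s' ∧
          s'.R 5 = S + 8 * (k + 1) + 7 ∧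
          s'.R 6 = S + 8 * (k + 2) + 7 ∧
          s'.M (S + 8 * (k + 1) + 7) = e₁.eval S I A (Function.update x v i) ∧
          s'.M (S + 8 * (k + 2) + 7) = e₂.eval S I A (Function.update x v i)) _ ?_ ?_).seq
            fun s₅ hs₅ =>
        (Ends.ite (C := e.cost B H h + 4 + (2 * m + 2 * m + 30))
          (Q := fun s' => Keeps S (l + 1) k s₂ s' ∧ s'.M (S + 8 * k + 7) =
            Expr.partialFold S I A o v e₁ e₂ e₀ e x (i + 1)) ?_ ?_).seq fun s₆ hs₆ =>
        Ends.block (C := 1) (Q := fun s' => Keeps S l k s s' ∧ s'.R (10 + l) = i + 1 ∧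
          s'.M (S + 8 * k + 7) = Expr.partialFold S I A o v e₁ e₂ e₀ e x (i + 1)) _ ?_ ?_).mono
          ?_ fun _ h => h
      · simp only [costs_append, costs_addrTmp]
        omega
      · obtain ⟨hk1, hv1⟩ := hs₃
        obtain ⟨hk2, hv2⟩ := hs₄
        have hr := (hr₂.of_keeps hk1).of_keeps hk2
        have ea := execs_addrTmp hr.base (r := 5) (by omega) (k + 1)
        have eb := execs_addrTmp (s := execs s₄ (addrTmp 5 (k + 1))) (S := S) (r := 6)
          (by rw [ea]; simp [hr.base]) (by omega) (k + 2)
        rw [hk2.tmp (by omega) |>.symm] at hv1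
        simp only [execs_append, eb]
        simp only [ea]
        refine ⟨((hk1.trans (hk2.weaken le_rfl (by omega))).update_reg (by omega) _).update_reg
          (by omega) _, ?_⟩
        simp [hv1, hv2]
      · obtain ⟨hk5, h5, h6, hv1, hv2⟩ := hs₅
        intro ht
        simp only [Test.holds, h5, h6, hv1, hv2] at ht
        have hr₅ := hr₂.of_keeps hk5
        have hstep : Expr.partialFold S I A o v e₁ e₂ e₀ e x (i + 1) =
            o.step (Expr.partialFold S I A o v e₁ e₂ e₀ e x i)
              (e.eval S I A (Function.update x v i)) := by
          simp [Expr.partialFold, ht]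
        refine (Ends.seq (C' := 4 + (2 * m + 2 * m + 30)) (h' _ (l + 1) (k + 1) _ s₅ hr₅ hx')
          fun s₆ hs₆ => ?_).mono (by omega) fun _ h => h
        obtain ⟨hk6, hv6⟩ := hs₆
        have hr := hr₅.of_keeps hk6
        have ea := execs_addrTmp hr.base (r := 5) (by omega) k
        have eb := execs_addrTmp (s := execs s₆ (addrTmp 5 k)) (S := S) (r := 6)
          (by rw [ea]; simp [hr.base]) (by omega) (k + 1)
        -- The test and the value are computed in cells from `k + 1` on, which leaves the
        -- accumulator in cell `k` intact.
        have hacc6 : s₆.M (S + 8 * k + 7) = Expr.partialFold S I A o v e₁ e₂ e₀ e x i := by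
          rw [hk6.tmp (by omega), hk5.tmp (by omega), hacc]
        have hk7 : Keeps S (l + 1) k s₂ (execs s₆ (addrTmp 5 k ++ addrTmp 6 (k + 1))) := by
          rw [execs_append, eb, ea]
          exact ((hk5.trans hk6).weaken le_rfl (by omega)).update_reg (by omega) _ |>.update_reg
            (by omega) _
        have he7 : execs s₆ (addrTmp 5 k ++ addrTmp 6 (k + 1)) = { s₆ with
            R := Function.update (Function.update s₆.R 5 (S + 8 * k + 7)) 6
              (S + 8 * (k + 1) + 7) } := by
          rw [execs_append, eb, ea]
        obtain ⟨s₈, c₈, hrun, hc8, hk8, hv8⟩ := FoldOp.code_ends (S := S) hS o (l := l + 1) (k := k)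
          (s := execs s₆ (addrTmp 5 k ++ addrTmp 6 (k + 1))) (m := m) (m' := m)
          (by rw [he7]; simp [hr.base]) (by rw [he7]; simp) (by rw [he7]; simp)
          (by rw [he7]; simp only [hacc6, hv6, ← hstep]; exact hpf (i + 1) hi)
          (by rw [he7]; simp only [hacc6]; exact hpf i hi.le)
        have hv8' : s₈.M (S + 8 * k + 7) =
            Expr.partialFold S I A o v e₁ e₂ e₀ e x (i + 1) := by
          rw [hv8, he7]; simp only [hacc6, hv6, hstep]
        refine Ends.block_append (C := 4) _ _ ?_ ⟨s₈, c₈, hrun, hc8, hk7.trans hk8, hv8'⟩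
        simp only [costs_append, costs_addrTmp]
        omega
      · obtain ⟨hk5, h5, h6, hv1, hv2⟩ := hs₅
        intro ht
        simp only [Test.holds, h5, h6, hv1, hv2] at ht
        refine (Ends.skip ⟨hk5.weaken le_rfl (by omega), ?_⟩).mono (by omega) fun _ h => h
        rw [hk5.tmp (by omega), hacc]
        simp [Expr.partialFold, ht]
      · simp [costs, Instr.cost]
      · obtain ⟨hk6, hv6⟩ := hs₆
        simp only [execs, Instr.exec]
        refine ⟨(hk.trans (hk6.weaken (by omega) le_rfl)).update_reg (by omega) _, ?_, hv6⟩
        simp [hk6.reg (10 + l) (by omega), hri, hk6.reg 4 (by omega), (hs.of_keeps hk).one]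
      · omega
    · exact ⟨hs₁.1, hs₁.2.1, hs₁.2.2⟩
    · have := Nat.mul_le_mul_right (1 + (e₁.cost B H h + e₂.cost B H h + e.cost B H h + 50 + 4 * m +
        4 * e.size B H h)) (hx b)
      have h3 : B * (1 + (e₁.cost B H h + e₂.cost B H h + e.cost B H h + 50 + 4 * m +
        4 * e.size B H h)) ≤ B * (e₁.cost B H h + e₂.cost B H h + e.cost B H h + 60 + 4 * m +
        4 * e.size B H h) := Nat.mul_le_mul_left _ (by omega)
      simp only [Expr.cost, ← hm]
      omega
    · rintro s' ⟨hk, -, hv⟩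
      exact ⟨hk, hv⟩

end CodeCorrect

end RealRAM

/-! ### Array statements and their compilation -/

namespace RealRAM

/-- Statements: `fill a b v e` sets entry `v` of the array `a` to `e`, for `v = 0, …, b - 1`, and
`rep b p` repeats `p`, `b` times. -/
inductive Stmt
  | fill (a : Fin 7) (b v : ℕ) (e : Expr)
  | seq (p q : Stmt)
  | rep (b : ℕ) (p : Stmt)

/-- The expression does not read the array `a`. -/
def Expr.NoRead (a : Fin 7) : Expr → Prop
  | .inp _ _ => True
  | .const _ => True
  | .read a' _ => a' ≠ a
  | .op _ e₁ e₂ => e₁.NoRead a ∧ e₂.NoRead a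
  | .iteLt e₁ e₂ e₃ e₄ => e₁.NoRead a ∧ e₂.NoRead a ∧ e₃.NoRead a ∧ e₄.NoRead a
  | .fold _ _ _ e₁ e₂ e₀ e => e₁.NoRead a ∧ e₂.NoRead a ∧ e₀.NoRead a ∧ e.NoRead a

/-- This permits filling an array in place: the entries already written cannot influence the later
ones. -/
theorem Expr.eval_update {a : Fin 7} {S : ℕ} {I : ℕ → ℝ} {A : Fin 7 → ℕ → ℝ} {f : ℕ → ℝ} :
    ∀ {e : Expr}, e.NoRead a → ∀ x, e.eval S I (Function.update A a f) x = e.eval S I A x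
  | .inp _ _, _, _ => rfl
  | .const _, _, _ => rfl
  | .read a' _, h, _ => by
    simp only [NoRead] at h
    simp [eval, h]
  | .op _ e₁ e₂, h, x => by simp [eval, eval_update h.1, eval_update h.2]
  | .iteLt e₁ e₂ e₃ e₄, h, x => by
    simp [eval, eval_update h.1, eval_update h.2.1, eval_update h.2.2.1, eval_update h.2.2.2]
  | .fold _ _ _ e₁ e₂ e₀ e, h, x => by
    simp [eval, eval_update h.1, eval_update h.2.1, eval_update h.2.2.1, eval_update h.2.2.2]

/-- The arrays after the execution of a statement. -/
noncomputable def Stmt.exec (S : ℕ) (I : ℕ → ℝ) (x : ℕ → ℕ) :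
    Stmt → (Fin 7 → ℕ → ℝ) → Fin 7 → ℕ → ℝ
  | .fill a b v e, A =>
      Function.update A a fun i => if i < x b then e.eval S I A (Function.update x v i) else A a i
  | .seq p q, A => q.exec S I x (p.exec S I x A)
  | .rep b p, A => (p.exec S I x)^[x b] A

/-- The code of a statement. -/
def Stmt.code : Stmt → (ℕ → ℕ) → ℕ → Prog
  | .fill a b v e, ρ, l =>
      .seq (block [.setIdx (10 + l) 0])
        (.while (.idxLt (10 + l) (10 + ρ b))
          (.seq (e.code (Function.update ρ v l) (l + 1) 0)
            (block (addrTmp 6 0 ++ addrArr 5 a (10 + l) ++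
              [.const 5 0, .arith .add 5 5 6, .addIdx (10 + l) (10 + l) 4]))))
  | .seq p q, ρ, l => .seq (p.code ρ l) (q.code ρ l)
  | .rep b p, ρ, l =>
      .seq (block [.setIdx (10 + l) 0])
        (.while (.idxLt (10 + l) (10 + ρ b))
          (.seq (p.code ρ (l + 1)) (block [.addIdx (10 + l) (10 + l) 4])))

/-- A bound for the cost of a statement. -/
def Stmt.cost (B H : ℕ) (h : Fin 7 → ℕ) : Stmt → ℕ
  | .fill _ _ _ e => B * (e.cost B H h + 30 + 2 * e.size B H h) + 10
  | .seq p q => p.cost B H h + q.cost B H h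
  | .rep _ p => B * (p.cost B H h + 10) + 10

/-- The statement respects the size bounds of the arrays, and does not read an array while filling
it. -/
def Stmt.Good (B H : ℕ) (h : Fin 7 → ℕ) : Stmt → Prop
  | .fill a _ _ e => e.size B H h ≤ h a ∧ e.NoRead a
  | .seq p q => p.Good B H h ∧ q.Good B H h
  | .rep _ p => p.Good B H h

section StmtCorrect

variable {κ : ℝ → ℕ} {Sz : ℝ → ℕ → Prop} {S B H : ℕ} {I : ℕ → ℝ} {h : Fin 7 → ℕ}

/-- The bounds `h` are fixed in advance and invariant under each statement, hence under any number
of repetitions. This is what excludes an exponential growth of bit lengths in the iteration. -/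
theorem SizeBound.exec (hS : SizeModel κ Sz) (st : Stmt) (hst : st.Good B H h) {x : ℕ → ℕ}
    (hx : ∀ v, x v ≤ B) : ∀ {A}, SizeBound Sz S I A H h → SizeBound Sz S I (st.exec S I x A) H h := by
  induction st with
  | fill a b v e =>
    intro A hb
    refine ⟨hb.inp, fun a' i => ?_⟩
    by_cases ha : a' = a
    · subst ha
      simp only [Stmt.exec, Function.update_self]
      split_ifs with hi
      · refine hS.mono (e.eval_size hS hb _ fun w => ?_) hst.1
        have := hx b
        by_cases hw : w = v
        · subst hw; simp; omega
        · simp [hw, hx w]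
      · exact hb.arr _ _
    · simp only [Stmt.exec, Function.update_of_ne ha]
      exact hb.arr _ _
  | seq p q hp hq => exact fun hb => hq hst.2 (hp hst.1 hb)
  | rep b p hp =>
    intro A hb
    simp only [Stmt.exec]
    induction x b with
    | zero => exact hb
    | succ n ih => rw [Function.iterate_succ_apply']; exact hp hst ih

theorem Rep.update_reg {A ρ l x s} (hs : Rep S I A ρ l x s) {r : ℕ}
    (hr : 5 ≤ r ∧ (r < 10 ∨ 10 + l ≤ r)) (i : ℕ) :
    Rep S I A ρ l x { s with R := Function.update s.R r i } :=
  hs.of_keeps (Keeps.refl (k := 0) |>.update_reg hr i)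

theorem Rep.slot_mono {A ρ l x s} (hs : Rep S I A ρ l x s) : Rep S I A ρ (l + 1) x s :=
  ⟨hs.base, hs.one, fun v => (hs.slot v).trans (by omega), hs.var, hs.inp, hs.arr⟩

/-- The partial result of filling an array. -/
noncomputable def fillUpto (A : Fin 7 → ℕ → ℝ) (a : Fin 7) (f : ℕ → ℝ) (n : ℕ) :
    Fin 7 → ℕ → ℝ :=
  Function.update A a fun i => if i < n then f i else A a i

/-- The registers that hold the parameters and the variables below level `l` agree. -/
def SameRegs (l : ℕ) (s s' : State) : Prop :=
  ∀ r, r < 5 ∨ (10 ≤ r ∧ r < 10 + l) → s'.R r = s.R r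

theorem Stmt.code_ends (hS : SizeModel κ Sz) (st : Stmt) (hst : st.Good B H h) {x : ℕ → ℕ}
    (hx : ∀ v, x v ≤ B) : ∀ {A ρ l s}, SizeBound Sz S I A H h → Rep S I A ρ l x s →
      Ends κ (st.code ρ l) s (st.cost B H h)
        (fun s' => SameRegs l s s' ∧ Rep S I (st.exec S I x A) ρ l x s') := by
  have h56 : (5 : ℕ) ≠ 6 := by decide
  have e1 : ArithOp.eval .add = fun a b => a + b := rfl
  induction st with
  | fill a b v e =>
    intro A ρ l s hb hs
    set f : ℕ → ℝ := fun i => e.eval S I A (Function.update x v i) with hf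
    refine ((Ends.block (C := 1) (Q := fun s' => SameRegs l s s' ∧ s'.R (10 + l) = 0 ∧
        Rep S I A ρ l x s') _ ?_ ?_).seq fun s₁ hs₁ =>
      (Ends.loop (n := x b) (C := e.cost B H h + 20 + 2 * e.size B H h)
        (fun i s' => SameRegs l s s' ∧ s'.R (10 + l) = i ∧ Rep S I (fillUpto A a f i) ρ l x s')
          ?_ ?_ ?_)).mono ?_ ?_
    · simp [costs, Instr.cost]
    · simp only [execs, Instr.exec]
      exact ⟨fun r hr => Function.update_of_ne (by omega) _ _, by simp,
        hs.update_reg (by omega) _⟩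
    · rintro i s' ⟨-, hi, hr⟩
      exact ⟨hi, hr.var b⟩
    · rintro i hi s₂ ⟨hk, hri, hr⟩
      have hx' : ∀ w, Function.update x v i w ≤ B := fun w => by
        have := hx b
        by_cases hw : w = v
        · subst hw; simp; omega
        · simp [hw, hx w]
      have hfe : e.eval S I (fillUpto A a f i) (Function.update x v i) = f i :=
        Expr.eval_update hst.2 _
      have hbi : SizeBound Sz S I (fillUpto A a f i) H h := by
        refine ⟨hb.inp, fun a' j => ?_⟩
        by_cases ha : a' = a
        · subst ha
          simp only [fillUpto, Function.update_self]
          split_ifs with hj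
          · refine hS.mono (e.eval_size hS hb _ fun w => ?_) hst.1
            have := hx b
            by_cases hw : w = v
            · subst hw; simp; omega
            · simp [hw, hx w]
          · exact hb.arr _ _
        · simp only [fillUpto, Function.update_of_ne ha]
          exact hb.arr _ _
      have hz := hS.cost_le (e.eval_size hS hbi _ hx')
      refine ((e.code_ends hS hbi _ (l + 1) 0 _ s₂ (hr.update v hri) hx').seq fun s₃ hs₃ => ?_
        : Ends κ _ _ (_ + (8 + (5 + (2 * e.size B H h + 3) + 1))) _).mono (by omega)
        fun _ h => h
      obtain ⟨hk3, hv3⟩ := hs₃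
      have hr3 := hr.of_keeps (hk3.weaken (by omega) le_rfl)
      have hri3 : s₃.R (10 + l) = i := (hk3.reg _ (by omega)).trans hri
      have ha := a.2
      have ea := execs_addrTmp hr3.base (r := 6) (by omega) 0
      have eb : execs s₃ (addrTmp 6 0 ++ addrArr 5 a (10 + l)) = { s₃ with
          R := Function.update (Function.update (Function.update s₃.R 6 (S + 7)) 8 a) 5
            (S + 8 * i + a) } := by
        have n6 : 10 + l ≠ 6 := by omega
        rw [execs_append, ea, execs_addrArr (S := S) (by simp [hr3.base]) (by omega) (by omega)]
        simp [hri3, n6]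
      rw [hfe] at hv3 hz
      simp only [Nat.mul_zero, Nat.add_zero] at hv3
      have n1 : S + 7 ≠ S + 8 * i + a := by omega
      refine Ends.block_append _ _ ?_ (Ends.block _ ?_ ⟨?_, ?_, ?_⟩)
      · simp only [costs_append, costs_addrTmp, costs_addrArr]; omega
      · rw [eb]
        simp only [costs, Instr.cost, Instr.exec]
        have := hS.cost_le hS.zero
        simp [e1, n1, hv3]
        omega
      · rw [eb]
        simp only [execs, Instr.exec]
        intro r hr'
        rw [← hk r hr', ← hk3.reg r (by omega)]
        simp only [Function.update_of_ne (show r ≠ 10 + l by omega),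
          Function.update_of_ne (show r ≠ 5 by omega), Function.update_of_ne (show r ≠ 6 by omega),
          Function.update_of_ne (show r ≠ 8 by omega)]
      · rw [eb]
        have n5 : 10 + l ≠ 5 := by omega
        have n6 : 10 + l ≠ 6 := by omega
        have n8 : 10 + l ≠ 8 := by omega
        simp [execs, Instr.exec, hri3, hr3.one, n5, n6, n8]
      · rw [eb]
        simp only [execs, Instr.exec, Function.update_self, e1,
          Function.update_of_ne h56.symm, Function.update_of_ne (show (6 : ℕ) ≠ 8 by decide),
          Function.update_of_ne n1, hv3, Rat.cast_zero, zero_add, Function.update_idem]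
        refine ⟨?_, ?_, hr.slot, ?_, ?_, ?_⟩
        · simp [hr3.base, Function.update_of_ne (show 3 ≠ 10 + l by omega)]
        · simp [hr3.one, Function.update_of_ne (show 4 ≠ 10 + l by omega)]
        · intro w
          have := hr.slot w
          simp only [Function.update_of_ne (show 10 + ρ w ≠ 10 + l by omega),
            Function.update_of_ne (show 10 + ρ w ≠ 5 by omega),
            Function.update_of_ne (show 10 + ρ w ≠ 6 by omega),
            Function.update_of_ne (show 10 + ρ w ≠ 8 by omega)]
          exact hr3.var w
        · intro k hk
          simp only [Function.update_of_ne (show k ≠ S + 8 * i + a by omega)]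
          exact hr3.inp k hk
        · intro a' j
          by_cases haj : a' = a ∧ j = i
          · obtain ⟨rfl, rfl⟩ := haj
            simp [fillUpto]
          · have hne : S + 8 * j + (a' : ℕ) ≠ S + 8 * i + a := by
              intro heq
              have := a'.2
              exact haj ⟨Fin.ext (by omega), by omega⟩
            simp only [Function.update_of_ne hne]
            rw [hr3.arr a' j]
            by_cases ha' : a' = a
            · subst ha'
              have hji : j ≠ i := fun h => haj ⟨rfl, h⟩
              have : j < i + 1 ↔ j < i := by omega
              simp only [fillUpto, Function.update_self, this]
            · simp [fillUpto, ha']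
    · refine ⟨hs₁.1, hs₁.2.1, ?_⟩
      have : fillUpto A a f 0 = A := by simp [fillUpto]
      rw [this]; exact hs₁.2.2
    · have := Nat.mul_le_mul_right (1 + (e.cost B H h + 20 + 2 * e.size B H h)) (hx b)
      have h3 : B * (1 + (e.cost B H h + 20 + 2 * e.size B H h)) ≤
        B * (e.cost B H h + 30 + 2 * e.size B H h) := Nat.mul_le_mul_left _ (by omega)
      simp only [Stmt.cost]
      omega
    · rintro s' ⟨hk, -, hr⟩
      exact ⟨hk, hr⟩
  | seq p q hp hq =>
    intro A ρ l s hb hs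
    exact (hp hst.1 hb hs).seq fun s₁ hs₁ =>
      (hq hst.2 (hb.exec hS p hst.1 hx) hs₁.2).mono le_rfl fun s₂ hs₂ =>
        ⟨fun r hr => (hs₂.1 r hr).trans (hs₁.1 r hr), hs₂.2⟩
  | rep b p hp =>
    intro A ρ l s hb hs
    refine ((Ends.block (C := 1) (Q := fun s' => SameRegs l s s' ∧ s'.R (10 + l) = 0 ∧
        Rep S I A ρ l x s') _ ?_ ?_).seq fun s₁ hs₁ =>
      (Ends.loop (n := x b) (C := p.cost B H h + 1)
        (fun i s' => SameRegs l s s' ∧ s'.R (10 + l) = i ∧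
          Rep S I ((p.exec S I x)^[i] A) ρ l x s') ?_ ?_ ?_)).mono ?_ ?_
    · simp [costs, Instr.cost]
    · simp only [execs, Instr.exec]
      exact ⟨fun r hr => Function.update_of_ne (by omega) _ _, by simp,
        hs.update_reg (by omega) _⟩
    · rintro i s' ⟨-, hi, hr⟩
      exact ⟨hi, hr.var b⟩
    · rintro i hi s₂ ⟨hk, hri, hr⟩
      have hbi : SizeBound Sz S I ((p.exec S I x)^[i] A) H h := by
        clear hr hri hi
        induction i with
        | zero => exact hb
        | succ n ih => rw [Function.iterate_succ_apply']; exact ih.exec hS p hst hx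
      refine (hp hst hbi hr.slot_mono).seq fun s₃ hs₃ => Ends.block _ ?_ ⟨?_, ?_, ?_⟩
      · simp [costs, Instr.cost]
      · intro r hr'
        simp only [execs, Instr.exec]
        rw [Function.update_of_ne (by omega), hs₃.1 r (by omega), hk r hr']
      · have h4 := hs₃.1 4 (by omega)
        simp [execs, Instr.exec, hs₃.1 (10 + l) (by omega), hri, h4, hr.one]
      · simp only [execs, Instr.exec]
        rw [Function.iterate_succ_apply']
        have hr3 := hs₃.2
        refine Rep.update_reg ⟨hr3.base, hr3.one, hr.slot, hr3.var, hr3.inp, hr3.arr⟩ (by omega) _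
    · exact ⟨hs₁.1, hs₁.2.1, hs₁.2.2⟩
    · have := Nat.mul_le_mul_right (1 + (p.cost B H h + 1)) (hx b)
      have h3 : B * (1 + (p.cost B H h + 1)) ≤ B * (p.cost B H h + 10) :=
        Nat.mul_le_mul_left _ (by omega)
      simp only [Stmt.cost]
      omega
    · rintro s' ⟨hk, -, hr⟩
      exact ⟨hk, hr⟩

end StmtCorrect

end RealRAM

namespace RealRAM

/-! ### Size models -/

/-- Every number has every size, so all size conditions are vacuous and the cost bounds count steps
on arbitrary real inputs. -/
theorem sizeModel_unit : SizeModel unitCost (fun _ _ => True) where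
  mono _ _ := trivial
  ofRat _ := trivial
  arith _ _ _ _ _ _ _ := trivial
  cost_le {_ h} _ := by simp [unitCost]

/-- `v` is a fraction of integers with fewer than `h` bits. -/
def FracSize (v : ℝ) (h : ℕ) : Prop :=
  ∃ (z : ℤ) (w : ℕ), 0 < w ∧ z.natAbs < 2 ^ h ∧ w < 2 ^ h ∧ v = z / w

theorem FracSize.ofRat (q : ℚ) : FracSize (q : ℝ) (ratBits q) := by
  refine ⟨q.num, q.den, q.den_pos, ?_, ?_, Rat.cast_def q⟩
  · exact (Nat.lt_size_self _).trans_le (Nat.pow_le_pow_right (by norm_num) (by simp [ratBits]))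
  · exact (Nat.lt_size_self _).trans_le (Nat.pow_le_pow_right (by norm_num) (by simp [ratBits]))

/-- Since fractions need not be reduced, the numerator and denominator of the result are sums of at
most two products of entries below 2^h and 2^k; no common divisors have to be tracked. -/
theorem FracSize.arith (o : ArithOp) {a b : ℝ} {h k : ℕ} (ha : FracSize a h) (hb : FracSize b k) :
    FracSize (o.eval a b) (h + k + 1) := by
  obtain ⟨z, w, hw, hz1, hw1, rfl⟩ := ha
  obtain ⟨z', w', hw', hz2, hw2, rfl⟩ := hb
  have hp : (2 : ℕ) ^ (h + k + 1) = 2 ^ h * 2 ^ k + 2 ^ h * 2 ^ k := by ring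
  have h1 : w * w' < 2 ^ h * 2 ^ k := Nat.mul_lt_mul'' hw1 hw2
  have h2 : z.natAbs * w' < 2 ^ h * 2 ^ k := Nat.mul_lt_mul'' hz1 hw2
  have h3 : z'.natAbs * w < 2 ^ h * 2 ^ k := by
    rw [mul_comm]; exact Nat.mul_lt_mul'' hw1 hz2
  have h4 : z.natAbs * z'.natAbs < 2 ^ h * 2 ^ k := Nat.mul_lt_mul'' hz1 hz2
  have hwr : (w : ℝ) ≠ 0 := by positivity
  have hwr' : (w' : ℝ) ≠ 0 := by positivity
  cases o with
  | add =>
    refine ⟨z * w' + z' * w, w * w', by positivity, ?_, by omega, ?_⟩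
    · have := Int.natAbs_add_le (z * w') (z' * w)
      simp only [Int.natAbs_mul, Int.natAbs_natCast] at this
      omega
    · simp only [ArithOp.eval]; push_cast; field_simp
  | sub =>
    refine ⟨z * w' - z' * w, w * w', by positivity, ?_, by omega, ?_⟩
    · have := Int.natAbs_sub_le (z * w') (z' * w)
      simp only [Int.natAbs_mul, Int.natAbs_natCast] at this
      omega
    · simp only [ArithOp.eval]; push_cast; field_simp
  | mul =>
    refine ⟨z * z', w * w', by positivity, ?_, by omega, ?_⟩
    · simp only [Int.natAbs_mul]
      omega
    · simp only [ArithOp.eval]; push_cast; field_simp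
  | div =>
    rcases eq_or_ne z' 0 with rfl | hz'
    -- Division by zero returns 0 = 0/1.
    · exact ⟨0, 1, one_pos, by simp, Nat.one_lt_two_pow (by omega), by simp [ArithOp.eval]⟩
    -- The sign of the divisor moves to the numerator, to keep the denominator positive.
    · refine ⟨z * w' * z'.sign, w * z'.natAbs, ?_, ?_, ?_, ?_⟩
      · have := Int.natAbs_pos.2 hz'; positivity
      · simp only [Int.natAbs_mul, Int.natAbs_natCast, Int.natAbs_sign_of_ne_zero hz', mul_one]
        omega
      · rw [mul_comm]; omega
      · have hs : (z' : ℝ) = z'.sign * z'.natAbs := by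
          have h := congrArg (fun t : ℤ => (t : ℝ)) (Int.sign_mul_natAbs z')
          simpa only [Int.cast_mul, Int.cast_natCast] using h.symm
        have hs1 : (z'.sign : ℝ) * z'.sign = 1 := by
          rcases lt_or_gt_of_ne hz' with h | h
          · simp [Int.sign_eq_neg_one_of_neg h]
          · simp [Int.sign_eq_one_of_pos h]
        have hn : ((z'.natAbs : ℕ) : ℝ) ≠ 0 := by exact_mod_cast Int.natAbs_ne_zero.2 hz'
        have hs0 : (z'.sign : ℝ) ≠ 0 := by
          intro h0; rw [h0] at hs1; simp at hs1
        simp only [ArithOp.eval]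
        rw [hs]
        simp only [Int.cast_mul, Int.cast_natCast, Nat.cast_mul]
        rw [div_div_div_eq, div_eq_div_iff (by positivity) (by positivity)]
        linear_combination (-(z : ℝ) * w' * w * z'.natAbs) * hs1

/-- Passing to lowest terms can only decrease numerator and denominator. -/
theorem bitCost_le {v : ℝ} {h : ℕ} (hv : FracSize v h) : bitCost v ≤ 2 * h + 3 := by
  obtain ⟨z, w, hw, hz1, hw1, rfl⟩ := hv
  have hex : ∃ q : ℚ, (q : ℝ) = z / w := ⟨(z : ℚ) / (w : ℤ), by push_cast; rfl⟩
  rw [bitCost, dif_pos hex]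
  have hq : hex.choose = (z : ℚ) / ((w : ℤ) : ℚ) := by
    have := hex.choose_spec
    have h2 : ((hex.choose : ℚ) : ℝ) = (((z : ℚ) / ((w : ℤ) : ℚ) : ℚ) : ℝ) := by
      rw [this]; push_cast; rfl
    exact_mod_cast h2
  rw [hq]
  have hnum : ((z : ℚ) / ((w : ℤ) : ℚ)).num.natAbs ≤ z.natAbs := by
    rcases eq_or_ne z 0 with rfl | hz
    · simp
    · have := Rat.num_dvd z (b := (w : ℤ)) (by exact_mod_cast hw.ne')
      rw [Rat.divInt_eq_div] at this
      exact Int.natAbs_le_of_dvd_ne_zero this hz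
  have hden : ((z : ℚ) / ((w : ℤ) : ℚ)).den ≤ w := by
    have := Rat.den_dvd z (w : ℤ)
    rw [Rat.divInt_eq_div] at this
    exact Nat.le_of_dvd hw (by exact_mod_cast this)
  have h1 : ((z : ℚ) / ((w : ℤ) : ℚ)).num.natAbs.size ≤ h := Nat.size_le.2 (by omega)
  have h2 : ((z : ℚ) / ((w : ℤ) : ℚ)).den.size ≤ h := Nat.size_le.2 (by omega)
  simp only [ratBits]
  omega

theorem FracSize.mono {v : ℝ} {h h' : ℕ} (hv : FracSize v h) (hh : h ≤ h') : FracSize v h' := by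
  obtain ⟨z, w, hw, hz1, hw1, rfl⟩ := hv
  have := Nat.pow_le_pow_right (show 0 < 2 by norm_num) hh
  exact ⟨z, w, hw, by omega, by omega, rfl⟩

theorem sizeModel_bit : SizeModel bitCost FracSize where
  mono := FracSize.mono
  ofRat := FracSize.ofRat
  arith := FracSize.arith
  cost_le := bitCost_le

/-! ### Polynomial bounds -/

/-- The function is bounded by a polynomial. -/
def PolyBdd (f : ℕ → ℕ) : Prop := ∃ p : Polynomial ℕ, ∀ L, f L ≤ p.eval L

theorem PolyBdd.const (c : ℕ) : PolyBdd fun _ => c := ⟨Polynomial.C c, fun L => by simp⟩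

theorem PolyBdd.id : PolyBdd fun L => L := ⟨Polynomial.X, fun L => by simp⟩

theorem PolyBdd.add {f g : ℕ → ℕ} (hf : PolyBdd f) (hg : PolyBdd g) :
    PolyBdd fun L => f L + g L := by
  obtain ⟨p, hp⟩ := hf
  obtain ⟨q, hq⟩ := hg
  exact ⟨p + q, fun L => by simpa using add_le_add (hp L) (hq L)⟩

theorem PolyBdd.mul {f g : ℕ → ℕ} (hf : PolyBdd f) (hg : PolyBdd g) :
    PolyBdd fun L => f L * g L := by
  obtain ⟨p, hp⟩ := hf
  obtain ⟨q, hq⟩ := hg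
  exact ⟨p * q, fun L => by simpa using Nat.mul_le_mul (hp L) (hq L)⟩

section

variable {h : ℕ → Fin 7 → ℕ} {B H : ℕ → ℕ}

theorem Expr.size_polyBdd (hB : PolyBdd B) (hH : PolyBdd H) (hh : ∀ a, PolyBdd fun L => h L a)
    (e : Expr) : PolyBdd fun L => e.size (B L) (H L) (h L) := by
  induction e with
  | inp c v => exact (PolyBdd.const 1).add hH
  | const q => exact PolyBdd.const _
  | read a v => exact hh a
  | op o e₁ e₂ h₁ h₂ => exact (h₁.add h₂).add (PolyBdd.const 1)
  | iteLt e₁ e₂ e₃ e₄ h₁ h₂ h₃ h₄ => exact h₃.add h₄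
  | fold o b v e₁ e₂ e₀ e h₁ h₂ h₀ h =>
    have := h₀.add (hB.mul (h.add (PolyBdd.const 4)))
    cases o with
    | last => exact h₀.add h
    | sum => exact this
    | prod => exact this
    | cfrac => exact this

theorem Expr.cost_polyBdd (hB : PolyBdd B) (hH : PolyBdd H) (hh : ∀ a, PolyBdd fun L => h L a)
    (e : Expr) : PolyBdd fun L => e.cost (B L) (H L) (h L) := by
  have hs := fun e : Expr => e.size_polyBdd hB hH hh
  induction e with
  | inp c v => exact (PolyBdd.const 20).add ((PolyBdd.const 4).mul hH)
  | const q => exact PolyBdd.const _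
  | read a v => exact (PolyBdd.const 30).add ((PolyBdd.const 4).mul (hh a))
  | op o e₁ e₂ h₁ h₂ =>
    exact ((h₁.add h₂).add (PolyBdd.const 10)).add ((PolyBdd.const 2).mul (hs _))
  | iteLt e₁ e₂ e₃ e₄ h₁ h₂ h₃ h₄ =>
    exact (((h₁.add h₂).add (PolyBdd.const 10)).add h₃).add h₄
  | fold o b v e₁ e₂ e₀ e h₁ h₂ h₀ h =>
    exact (h₀.add (PolyBdd.const 10)).add (hB.mul (((((h₁.add h₂).add h).add
      (PolyBdd.const 60)).add ((PolyBdd.const 4).mul (hs _))).add ((PolyBdd.const 4).mul (hs _))))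

theorem Stmt.cost_polyBdd (hB : PolyBdd B) (hH : PolyBdd H) (hh : ∀ a, PolyBdd fun L => h L a)
    (st : Stmt) : PolyBdd fun L => st.cost (B L) (H L) (h L) := by
  induction st with
  | fill a b v e =>
    exact (hB.mul (((e.cost_polyBdd hB hH hh).add (PolyBdd.const 30)).add
      ((PolyBdd.const 2).mul (e.size_polyBdd hB hH hh)))).add (PolyBdd.const 10)
  | seq p q hp hq => exact hp.add hq
  | rep b p hp => exact (hB.mul (hp.add (PolyBdd.const 10))).add (PolyBdd.const 10)

end

/-! ### Complete programs -/

/-- The registers of the variables `0` (zero), `1` (the degree), `2` (the degree plus one) and `3`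
(the number of data points). -/
def initSlot (v : ℕ) : ℕ := if v < 4 then v else 0

/-- The values of the initial variables. -/
def initVar (d N v : ℕ) : ℕ :=
  if v = 1 then d else if v = 2 then d + 1 else if v = 3 then N else 0

/-- The program that executes `st` and returns the value of `out`. -/
def program (st : Stmt) (out : Expr) : Prog :=
  .seq (block [.setIdx 4 1, .addIdx 3 1 1, .addIdx 3 3 4, .addIdx 3 3 4, .setIdx 10 0,
    .addIdx 11 0 10, .addIdx 12 0 4, .addIdx 13 1 10])
    (.seq (st.code initSlot 4) (.seq (out.code initSlot 4 0)
      (block (addrTmp 6 0 ++ [.setIdx 5 0, .const 5 0, .arith .add 5 5 6]))))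

theorem program_ends {κ : ℝ → ℕ} {Sz : ℝ → ℕ → Prop} (hS : SizeModel κ Sz) {B H : ℕ}
    {h : Fin 7 → ℕ} {st : Stmt} (hst : st.Good B H h) (out : Expr) {d N : ℕ} (hd : d + 1 ≤ B)
    (hN : N ≤ B) (m Δ : ℝ) (D : Fin N → ℝ × ℝ) (coins : ℕ → Bool)
    (hb : SizeBound Sz (2 * N + 2) (input d m Δ D coins).M 0 H h) :
    Ends κ (program st out) (input d m Δ D coins)
      (st.cost B H h + out.cost B H h + 2 * out.size B H h + 50)
      (fun s => s.M 0 = out.eval (2 * N + 2) (input d m Δ D coins).M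
        (st.exec (2 * N + 2) (input d m Δ D coins).M (initVar d N) 0) (initVar d N)) := by
  set I := (input d m Δ D coins).M with hI
  have e1 : ArithOp.eval .add = fun a b => a + b := rfl
  have hx : ∀ v, initVar d N v ≤ B := fun v => by
    unfold initVar; split_ifs <;> omega
  have hbe := hb.exec hS st hst hx
  refine ((Ends.block (C := 8)
    (Q := fun s => Rep (2 * N + 2) I 0 initSlot 4 (initVar d N) s) _ ?_ ?_).seq fun s₁ hs₁ =>
    (st.code_ends hS hst hx hb hs₁).seq fun s₂ hs₂ =>
    (out.code_ends hS hbe _ _ 0 _ s₂ hs₂.2 hx).seq fun s₃ hs₃ =>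
      Ends.block_append (C := 2) _ _ ?_ (Ends.block (C := 2 * out.size B H h + 3 + 6) _ ?_ ?_)).mono
      (by omega) fun _ h => h
  · simp [costs, Instr.cost]
  · refine ⟨?_, ?_, ?_, ?_, ?_, ?_⟩
    · simp [execs, Instr.exec, input]; omega
    · simp [execs, Instr.exec, input]
    · intro v; unfold initSlot; split_ifs <;> omega
    · intro v
      by_cases hv : v < 4
      · interval_cases v <;> simp [execs, Instr.exec, input, initSlot, initVar]
      -- Variables from 4 on share the register of the constant zero, so they have a value even
      -- before a loop binds them.
      · have h1 : v ≠ 1 := by omega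
        have h2 : v ≠ 2 := by omega
        have h3 : v ≠ 3 := by omega
        simp [execs, Instr.exec, input, initSlot, initVar, hv, h1, h2, h3]
    · intro k hk; simp [execs, Instr.exec, hI]
    · intro a i
      -- All cells beyond the input are zero at the start, so every work array begins as the zero
      -- array.
      have h0 : 2 * N + 2 + 8 * i + (a : ℕ) ≠ 0 := by omega
      have h1 : 2 * N + 2 + 8 * i + (a : ℕ) ≠ 1 := by omega
      have h2 : ¬ (2 * N + 2 + 8 * i + (a : ℕ) - 2) / 2 < N := by omega
      simp only [execs, Instr.exec, input, h0, h1, h2, if_false, dif_neg, not_false_eq_true]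
      rfl
  · simp only [costs_addrTmp]; omega
  all_goals
    have hr := hs₂.2.of_keeps hs₃.1
    have ea := execs_addrTmp hr.base (r := 6) (by omega) 0
    have hv := hs₃.2
    rw [ea]
    have hz := hS.cost_le hS.zero
    have hz2 := hS.cost_le (out.eval_size hS hbe _ hx)
    simp only [Nat.mul_zero, Nat.add_zero] at hv
  · simp [costs, Instr.cost, Instr.exec, e1, hv]
    omega
  · simp [execs, Instr.exec, e1, hv]

theorem input_eq_zero_or {d N : ℕ} (m Δ : ℝ) (D : Fin N → ℝ × ℝ) (coins : ℕ → Bool) (k : ℕ) :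
    (input d m Δ D coins).M k = 0 ∨ (input d m Δ D coins).M k = m ∨
      (input d m Δ D coins).M k = Δ ∨ ∃ i, (input d m Δ D coins).M k = (D i).1 ∨
        (input d m Δ D coins).M k = (D i).2 := by
  simp only [input]
  split_ifs with h1 h2 h3 h4
  · simp
  · simp
  · exact .inr (.inr (.inr ⟨_, .inl rfl⟩))
  · exact .inr (.inr (.inr ⟨_, .inr rfl⟩))
  · simp

theorem returns_program {st : Stmt} {B H : ℕ} {h : Fin 7 → ℕ} (hst : st.Good B H h) (out : Expr)
    {d N : ℕ} (hd : d + 1 ≤ B) (hN : N ≤ B) (m Δ : ℝ) (D : Fin N → ℝ × ℝ) (coins : ℕ → Bool) :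
    Returns (program st out) d m Δ D coins (out.eval (2 * N + 2) (input d m Δ D coins).M
        (st.exec (2 * N + 2) (input d m Δ D coins).M (initVar d N) 0) (initVar d N)) := by
  obtain ⟨s, c, h1, -, h2⟩ := program_ends sizeModel_unit hst out hd hN m Δ D coins
    ⟨fun _ _ => trivial, fun _ _ => trivial⟩
  exact ⟨s, c, h1, h2⟩

/-- Here `L` is the argument of the polynomial in `PolyTime`; it bounds the parameters and the bit
lengths of the inputs at the same time. The condition `hpos` is needed because the arrays start at
0, which has size 1. -/
theorem polyTime_program (st : Stmt) (out : Expr) (h : ℕ → Fin 7 → ℕ)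
    (hpoly : ∀ a, PolyBdd fun L => h L a) (hpos : ∀ L a, 1 ≤ h L a)
    (hgood : ∀ L, st.Good (L + 1) (L + 1) (h L)) : PolyTime (program st out) := by
  have hL : PolyBdd fun L => L + 1 := PolyBdd.id.add (PolyBdd.const 1)
  obtain ⟨T, hT⟩ := (((st.cost_polyBdd hL hL hpoly).add (out.cost_polyBdd hL hL hpoly)).add
    ((PolyBdd.const 2).mul (out.size_polyBdd hL hL hpoly))).add (PolyBdd.const 50)
  refine ⟨T, fun d N m Δ D coins => ?_, fun d N m Δ D coins => ?_⟩
  · obtain ⟨s, c, h1, h2, -⟩ := program_ends sizeModel_unit (hgood (d + N)) out (d := d) (N := N)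
      (by omega) (by omega) m Δ D coins ⟨fun _ _ => trivial, fun _ _ => trivial⟩
    exact ⟨s, c, h1, h2.trans (hT _)⟩
  · set L := d + N + ratBits m + ratBits Δ + ∑ i, (ratBits (D i).1 + ratBits (D i).2)
    have hb : SizeBound FracSize (2 * N + 2) (input d (m : ℝ) (Δ : ℝ)
        (fun i => (((D i).1 : ℝ), ((D i).2 : ℝ))) coins).M 0 (L + 1) (h L) := by
      refine ⟨fun k _ => ?_, fun a i => sizeModel_bit.mono sizeModel_bit.zero (hpos L a)⟩
      have hD : ∀ i, ratBits (D i).1 + ratBits (D i).2 ≤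
          ∑ i, (ratBits (D i).1 + ratBits (D i).2) := fun i =>
        Finset.single_le_sum (f := fun i => ratBits (D i).1 + ratBits (D i).2)
          (fun _ _ => Nat.zero_le _) (Finset.mem_univ i)
      rcases input_eq_zero_or (d := d) (m : ℝ) (Δ : ℝ)
        (fun i => (((D i).1 : ℝ), ((D i).2 : ℝ))) coins k with h | h | h | ⟨i, h | h⟩ <;> rw [h]
      · exact (sizeModel_bit.zero).mono (by omega)
      · exact (FracSize.ofRat _).mono (by omega)
      · exact (FracSize.ofRat _).mono (by omega)
      · exact (FracSize.ofRat _).mono (by have := hD i; omega)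
      · exact (FracSize.ofRat _).mono (by have := hD i; omega)
    obtain ⟨s, c, h1, h2, -⟩ := program_ends sizeModel_bit (hgood L) out (d := d) (N := N)
      (by omega) (by omega) (m : ℝ) (Δ : ℝ) (fun i => (((D i).1 : ℝ), ((D i).2 : ℝ))) coins hb
    exact ⟨s, c, h1, h2.trans (hT _)⟩

end RealRAM

/-! ### The algorithm -/

/-- The quotients `U (k + 1) / U k` of Chebyshev polynomials of the second kind at `t`, computed as
a continued fraction. -/
noncomputable def chebQuot (t : ℝ) : ℕ → ℝ
  | 0 => 2 * t
  | k + 1 => 2 * t - 1 / chebQuot t k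

open Classical in
/-- The number of the bin of the point `t`, or `-1`. -/
noncomputable def binOf (d : ℕ) (t : ℝ) : ℝ :=
  if (1 - t * t) * ((∏ k ∈ Finset.range d, chebQuot t k) *
      (∏ k ∈ Finset.range d, chebQuot t k)) < ((999999 / 1000000 : ℚ) : ℝ) then -1
  else ∑ k ∈ Finset.range d, if chebQuot t k < 0 then 1 else 0

open Classical in
/-- The value at `x` of the interpolation polynomial with `n` nodes `X j` and values `Y j`. -/
noncomputable def lagrangeEval (n : ℕ) (X Y : ℕ → ℝ) (x : ℝ) : ℝ :=
  ∑ j ∈ Finset.range n, Y j * ∏ i ∈ Finset.range n,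
    if 0 < (X i - X j) * (X i - X j) then (x - X i) / (X j - X i) else 1

open Classical in
/-- In each bin, `X'` and `Y'` give a data point with median residual with respect to the
interpolation polynomial of `X` and `Y`. -/
def IsMedianStep (n N : ℕ) (x y bin X Y X' Y' : ℕ → ℝ) : Prop :=
  ∀ j < n, ∃ i < N, bin i = j ∧ X' j = x i ∧ Y' j = y i ∧
    2 * {k ∈ Finset.range N |
      y k - lagrangeEval n X Y (x k) < y i - lagrangeEval n X Y (x i) ∧ bin k = j}.card ≤
        {k ∈ Finset.range N | bin k = j}.card ∧
    2 * {k ∈ Finset.range N |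
      y i - lagrangeEval n X Y (x i) < y k - lagrangeEval n X Y (x k) ∧ bin k = j}.card ≤
        {k ∈ Finset.range N | bin k = j}.card

/-- Take the least value that has at least half of the elements at or below it. If there are
elements strictly below, the largest of them fails this condition, so they are fewer than half. -/
theorem exists_median {ι : Type*} (s : Finset ι) (hs : s.Nonempty) (f : ι → ℝ) :
    ∃ i ∈ s, 2 * {k ∈ s | f k < f i}.card ≤ s.card ∧ 2 * {k ∈ s | f i < f k}.card ≤ s.card := by
  classical
  set S := {i ∈ s | s.card ≤ 2 * {k ∈ s | f k ≤ f i}.card} with hS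
  have hSne : S.Nonempty := by
    obtain ⟨i, hi, hmax⟩ := s.exists_max_image f hs
    refine ⟨i, Finset.mem_filter.2 ⟨hi, ?_⟩⟩
    rw [Finset.filter_true_of_mem fun k hk => hmax k hk]
    omega
  obtain ⟨i, hi, hmin⟩ := S.exists_min_image f hSne
  obtain ⟨his, hi2⟩ := Finset.mem_filter.1 hi
  refine ⟨i, his, ?_, ?_⟩
  · rcases ({k ∈ s | f k < f i}).eq_empty_or_nonempty with h | h
    · simp [h]
    · obtain ⟨k, hk, hmax⟩ := Finset.exists_max_image _ f h
      obtain ⟨hks, hki⟩ := Finset.mem_filter.1 hk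
      have heq : {l ∈ s | f l < f i} ⊆ {l ∈ s | f l ≤ f k} := fun l hl =>
        Finset.mem_filter.2 ⟨(Finset.mem_filter.1 hl).1, hmax l hl⟩
      have hkS : k ∉ S := fun hk' => absurd (hmin k hk') (not_le.2 hki)
      have : ¬ s.card ≤ 2 * {l ∈ s | f l ≤ f k}.card := fun h' =>
        hkS (Finset.mem_filter.2 ⟨hks, h'⟩)
      have := Finset.card_le_card heq
      omega
  · have h1 := Finset.card_filter_add_card_filter_not (s := s) (fun k => f k ≤ f i)
    have h2 : {k ∈ s | f i < f k} = {k ∈ s | ¬ f k ≤ f i} := by simp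
    rw [h2]
    omega

/-! ### The algorithm as a program -/

namespace RealRAM

namespace Expr

/-- The sum of `e` over `v < b`. -/
def sum (b v : ℕ) (e : Expr) : Expr := .fold .sum b v (.const 0) (.const 1) (.const 0) e

/-- The difference of two expressions. -/
def sub (e₁ e₂ : Expr) : Expr := .op .sub e₁ e₂

/-- The product of two expressions. -/
def mul (e₁ e₂ : Expr) : Expr := .op .mul e₁ e₂

/-- The quotient of two expressions. -/
def div (e₁ e₂ : Expr) : Expr := .op .div e₁ e₂

/-- The position `2 x / Δ - 1` of the data point `4`. -/
def position : Expr := sub (div (mul (.const 2) (.inp 2 4)) (.inp 1 0)) (.const 1)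

/-- The quotient with the index given by the variable `6`. -/
def quot : Expr := .fold .cfrac 6 7 (.const 0) (.const 1)
  (mul (.const 2) position) (mul (.const 2) position)

/-- The bin of the data point `4`. -/
def bin : Expr :=
  .iteLt (mul (sub (.const 1) (mul position position))
      (mul (.fold .prod 1 6 (.const 0) (.const 1) (.const 1) quot)
        (.fold .prod 1 6 (.const 0) (.const 1) (.const 1) quot)))
    (.const (999999 / 1000000)) (.const (-1))
    (.fold .sum 1 6 quot (.const 0) (.const 0) (.const 1))

/-- The value of the interpolation polynomial of the nodes `2` and values `3` at `e`. -/
def lagrange (e : Expr) : Expr :=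
  sum 2 5 (mul (.read 3 5)
    (.fold .prod 2 6 (.const 0) (mul (sub (.read 2 6) (.read 2 5)) (sub (.read 2 6) (.read 2 5)))
      (.const 1) (div (sub e (.read 2 6)) (sub (.read 2 5) (.read 2 6)))))

/-- The residual of the data point `4`. -/
def residual : Expr := sub (.inp 3 4) (lagrange (.inp 2 4))

/-- `e₃` if `e₁ = e₂`, and zero otherwise. -/
def ifEq (e₁ e₂ e₃ : Expr) : Expr := .iteLt e₁ e₂ (.const 0) (.iteLt e₂ e₁ (.const 0) e₃)

/-- One if the data point `4` lies in the bin `5` and has median residual there, and zero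
otherwise. -/
def isMedian : Expr :=
  ifEq (.read 0 4) (sum 5 6 (.const 1))
    (.iteLt (sum 3 7 (ifEq (.read 0 7) (.read 0 4) (.const 1)))
      (mul (.const 2) (.fold .sum 3 7 (.read 1 7) (.read 1 4) (.const 0)
        (ifEq (.read 0 7) (.read 0 4) (.const 1)))) (.const 0)
      (.iteLt (sum 3 7 (ifEq (.read 0 7) (.read 0 4) (.const 1)))
        (mul (.const 2) (.fold .sum 3 7 (.read 1 4) (.read 1 7) (.const 0)
          (ifEq (.read 0 7) (.read 0 4) (.const 1)))) (.const 0) (.const 1)))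

/-- The input entry `c` of a data point in bin `5` with median residual. -/
def node (c : ℕ) : Expr := .fold .last 3 4 (.const 0) isMedian (.const 0) (.inp c 4)

end Expr

/-- One step of the iteration. -/
def Stmt.medianStep : Stmt :=
  .seq (.fill 1 3 4 .residual) (.seq (.fill 2 2 5 (.node 2)) (.fill 3 2 5 (.node 3)))

/-- The main part of the algorithm. -/
def Stmt.main : Stmt :=
  .seq (.fill 0 3 4 .bin) (.seq .medianStep (.seq (.rep 3 (.rep 3 .medianStep)) .medianStep))

/-- The algorithm for robust extrapolation. -/
def extrapolation : Prog := program .main (.lagrange (.inp 0 0))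

/-- Size bounds for the work arrays. -/
def arrSize (L : ℕ) (a : Fin 7) : ℕ :=
  if a = 0 then Expr.bin.size (L + 1) (L + 1) (fun _ => 0) + 1
  else if a = 1 then Expr.residual.size (L + 1) (L + 1) (fun _ => L + 3) + 1
  else L + 3

theorem arrSize_polyBdd (a : Fin 7) : PolyBdd fun L => arrSize L a := by
  have hL : PolyBdd fun L => L + 1 := PolyBdd.id.add (PolyBdd.const 1)
  unfold arrSize
  by_cases h0 : a = 0
  · simp only [h0, if_true]
    exact (Expr.size_polyBdd hL hL (fun _ => PolyBdd.const 0) _).add (PolyBdd.const 1)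
  · by_cases h1 : a = 1
    · subst h1
      simp only [h0, if_true, if_false]
      exact (Expr.size_polyBdd hL hL (fun _ => PolyBdd.id.add (PolyBdd.const 3)) _).add
        (PolyBdd.const 1)
    · simp only [h0, h1, if_false]
      exact PolyBdd.id.add (PolyBdd.const 3)

/-- Nodes and values are copies of input entries, made by a `last` fold starting from 0, so they
have size 1 + (1 + (L + 1)) = L + 3 in every round. Residuals are recomputed from them, which makes
their size independent of the round as well. -/
theorem main_good (L : ℕ) : Stmt.main.Good (L + 1) (L + 1) (arrSize L) := by
  have hstep : Stmt.medianStep.Good (L + 1) (L + 1) (arrSize L) := by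
    refine ⟨⟨?_, ?_⟩, ⟨?_, ?_⟩, ⟨?_, ?_⟩⟩
    · simp [arrSize, Expr.residual, Expr.lagrange, Expr.size, Expr.sub, Expr.mul, Expr.div,
        Expr.sum]
    · simp [Expr.residual, Expr.lagrange, Expr.NoRead, Expr.sub, Expr.mul, Expr.div, Expr.sum]
    · simp [Expr.node, Expr.size, arrSize, ratBits_zero]; omega
    · simp [Expr.node, Expr.isMedian, Expr.ifEq, Expr.NoRead, Expr.mul, Expr.sum]
    · simp [Expr.node, Expr.size, arrSize, ratBits_zero]; omega
    · simp [Expr.node, Expr.isMedian, Expr.ifEq, Expr.NoRead, Expr.mul, Expr.sum]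
  refine ⟨⟨?_, ?_⟩, hstep, hstep, hstep⟩
  · simp [arrSize, Expr.bin, Expr.size]
  · simp [Expr.bin, Expr.quot, Expr.position, Expr.NoRead, Expr.sub, Expr.mul, Expr.div]

theorem polyTime_extrapolation : PolyTime extrapolation :=
  polyTime_program _ _ arrSize arrSize_polyBdd (fun L a => by unfold arrSize; split_ifs <;> omega)
    main_good

/-! ### The meaning of the algorithm -/

section Semantics

variable {S : ℕ} {I : ℕ → ℝ} {A : Fin 7 → ℕ → ℝ} {x : ℕ → ℕ}

theorem Expr.eval_inp (c v : ℕ) : (Expr.inp c v).eval S I A x =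
    if 2 * x v + c < S then I (2 * x v + c) else 0 := rfl

theorem Expr.eval_const (q : ℚ) : (Expr.const q).eval S I A x = q := rfl

theorem Expr.eval_read (a : Fin 7) (v : ℕ) : (Expr.read a v).eval S I A x = A a (x v) := rfl

theorem Expr.eval_op (o : ArithOp) (e₁ e₂ : Expr) : (Expr.op o e₁ e₂).eval S I A x =
    o.eval (e₁.eval S I A x) (e₂.eval S I A x) := rfl

open Classical in
theorem Expr.eval_iteLt (e₁ e₂ e₃ e₄ : Expr) : (Expr.iteLt e₁ e₂ e₃ e₄).eval S I A x =
    if e₁.eval S I A x < e₂.eval S I A x then e₃.eval S I A x else e₄.eval S I A x := rfl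

open Classical in
theorem Expr.eval_foldSum (b v : ℕ) (e₁ e₂ e₀ e : Expr) :
    (Expr.fold .sum b v e₁ e₂ e₀ e).eval S I A x = e₀.eval S I A x +
      ∑ i ∈ Finset.range (x b), if e₁.eval S I A (Function.update x v i) <
        e₂.eval S I A (Function.update x v i) then e.eval S I A (Function.update x v i) else 0 := by
  simp only [eval]
  induction x b with
  | zero => simp
  | succ n ih =>
    rw [Finset.sum_range_succ, ← add_assoc, ← ih]
    simp only [FoldOp.step]
    split_ifs <;> simp

open Classical in
theorem Expr.eval_foldProd (b v : ℕ) (e₁ e₂ e₀ e : Expr) :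
    (Expr.fold .prod b v e₁ e₂ e₀ e).eval S I A x = e₀.eval S I A x *
      ∏ i ∈ Finset.range (x b), if e₁.eval S I A (Function.update x v i) <
        e₂.eval S I A (Function.update x v i) then e.eval S I A (Function.update x v i) else 1 := by
  simp only [eval]
  induction x b with
  | zero => simp
  | succ n ih =>
    rw [Finset.prod_range_succ, ← mul_assoc, ← ih]
    simp only [FoldOp.step]
    split_ifs <;> simp

theorem Expr.eval_sum (b v : ℕ) (e : Expr) : (Expr.sum b v e).eval S I A x =
    ∑ i ∈ Finset.range (x b), e.eval S I A (Function.update x v i) := by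
  rw [Expr.sum, eval_foldSum]
  simp [eval]

open Classical in
/-- The last number below `n` with property `p`. -/
noncomputable def lastIdx (p : ℕ → Prop) (n : ℕ) : ℕ :=
  Nat.rec 0 (fun i a => if p i then i else a) n

theorem lastIdx_spec {p : ℕ → Prop} {n : ℕ} (h : ∃ i < n, p i) :
    lastIdx p n < n ∧ p (lastIdx p n) := by
  induction n with
  | zero => simp at h
  | succ n ih =>
    by_cases hn : p n
    · simp [lastIdx, hn]
    · obtain ⟨i, hi, hp⟩ := h
      have : i ≠ n := fun h => hn (h ▸ hp)
      obtain ⟨h1, h2⟩ := ih ⟨i, by omega, hp⟩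
      simp only [lastIdx, hn, if_false] at h1 h2 ⊢
      exact ⟨by omega, h2⟩

theorem Expr.eval_foldLast (b v : ℕ) (e₁ e₂ e₀ e : Expr)
    (h : ∃ i < x b, e₁.eval S I A (Function.update x v i) <
      e₂.eval S I A (Function.update x v i)) :
    (Expr.fold .last b v e₁ e₂ e₀ e).eval S I A x = e.eval S I A (Function.update x v
      (lastIdx (fun i => e₁.eval S I A (Function.update x v i) <
        e₂.eval S I A (Function.update x v i)) (x b))) := by
  simp only [eval]
  revert h
  induction x b with
  | zero => intro h; simp at h
  | succ n ih =>
    intro h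
    by_cases hn : e₁.eval S I A (Function.update x v n) < e₂.eval S I A (Function.update x v n)
    · simp [lastIdx, hn, FoldOp.step]
    · obtain ⟨i, hi, hp⟩ := h
      have : i ≠ n := fun h => hn (h ▸ hp)
      have := ih ⟨i, by omega, hp⟩
      simp only [lastIdx, hn, if_false] at this ⊢
      exact this

theorem Expr.eval_ifEq (e₁ e₂ e₃ : Expr) : open Classical in (ifEq e₁ e₂ e₃).eval S I A x =
    if e₁.eval S I A x = e₂.eval S I A x then e₃.eval S I A x else 0 := by
  simp only [ifEq, eval_iteLt, eval_const, Rat.cast_zero]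
  rcases lt_trichotomy (e₁.eval S I A x) (e₂.eval S I A x) with h | h | h
  · simp [h, h.ne]
  · simp [h]
  · simp [h, h.ne']

theorem ArithOp.eval_sub (a b : ℝ) : ArithOp.sub.eval a b = a - b := rfl
theorem ArithOp.eval_mul (a b : ℝ) : ArithOp.mul.eval a b = a * b := rfl
theorem ArithOp.eval_div (a b : ℝ) : ArithOp.div.eval a b = a / b := rfl

theorem Expr.eval_quot :
    quot.eval S I A x = chebQuot (position.eval S I A x) (x 6) := by
  have hp : ∀ i, position.eval S I A (Function.update x 7 i) = position.eval S I A x := fun i => by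
    simp [position, eval, sub, mul, div]
  simp only [quot, eval, mul, ArithOp.eval_mul, hp]
  induction x 6 with
  | zero => simp [chebQuot]
  | succ n ih =>
    simp only [ih]
    simp [chebQuot, FoldOp.step]

theorem Expr.eval_bin : bin.eval S I A x = binOf (x 1) (position.eval S I A x) := by
  have hp : ∀ i, position.eval S I A (Function.update x 6 i) = position.eval S I A x := fun i => by
    simp [position, eval, sub, mul, div]
  simp only [bin, eval_foldSum, eval_foldProd, eval_const, eval_op, eval_iteLt, mul, sub,
    ArithOp.eval_mul, ArithOp.eval_sub,
    eval_quot, hp, binOf]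
  simp

/-- The hypothesis rules out variable capture: `e` is evaluated inside the loops over the variables
5 and 6. -/
theorem Expr.eval_lagrange (e : Expr) (z : ℝ)
    (he : ∀ i j, e.eval S I A (Function.update (Function.update x 5 j) 6 i) = z) :
    (lagrange e).eval S I A x = lagrangeEval (x 2) (A 2) (A 3) z := by
  simp only [lagrange, eval_sum, eval_foldProd, eval_const, eval_read, eval_op,
    mul, sub, div, ArithOp.eval_mul,
    ArithOp.eval_sub, ArithOp.eval_div, he, lagrangeEval]
  simp

open Classical in
-- Indices cannot be moved to memory cells directly; the bin number `x 5` enters as a sum of `x 5`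
-- ones.
theorem Expr.eval_isMedian : 0 < isMedian.eval S I A x ↔ A 0 (x 4) = x 5 ∧
    2 * {k ∈ Finset.range (x 3) | A 1 k < A 1 (x 4) ∧ A 0 k = x 5}.card ≤
      {k ∈ Finset.range (x 3) | A 0 k = x 5}.card ∧
    2 * {k ∈ Finset.range (x 3) | A 1 (x 4) < A 1 k ∧ A 0 k = x 5}.card ≤
      {k ∈ Finset.range (x 3) | A 0 k = x 5}.card := by
  simp only [isMedian, eval_ifEq, eval_sum, eval_foldSum, eval_const, eval_read, eval_op, eval_iteLt,
    mul, ArithOp.eval_mul]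
  by_cases h : A 0 (x 4) = x 5
  · simp [h, ← ite_and]
    norm_cast
    split_ifs with h1 h2
    · simp [h1]
    · simp [h2]
    · simp [not_lt.1 h1, not_lt.1 h2]
  · simp [h]

/-- Nodes and values are chosen in two separate passes. Both use the same test, which reads only the
bins and the stored residuals and not the nodes just overwritten, so both pick the same data point.
-/
theorem medianStep_spec {d N : ℕ} (I : ℕ → ℝ) (A : Fin 7 → ℕ → ℝ)
    (h : ∀ j < d + 1, ∃ i < N, A 0 i = j) :
    IsMedianStep (d + 1) N (fun i => I (2 * i + 2)) (fun i => I (2 * i + 3)) (A 0) (A 2) (A 3)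
      (Stmt.medianStep.exec (2 * N + 2) I (initVar d N) A 2)
      (Stmt.medianStep.exec (2 * N + 2) I (initVar d N) A 3) := by
  classical
  intro j hj
  set x₀ := initVar d N with hx₀
  have hx2 : x₀ 2 = d + 1 := rfl
  have hx3 : x₀ 3 = N := rfl
  set A₁ := (Stmt.fill 1 3 4 .residual).exec (2 * N + 2) I x₀ A with hA₁
  set A₂ := (Stmt.fill 2 2 5 (.node 2)).exec (2 * N + 2) I x₀ A₁ with hA₂
  have h0 : A₁ 0 = A 0 := by simp [hA₁, Stmt.exec]
  set r : ℕ → ℝ := fun i => I (2 * i + 3) - lagrangeEval (d + 1) (A 2) (A 3) (I (2 * i + 2))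
    with hr
  have h1 : ∀ i < N, A₁ 1 i = r i := fun i hi => by
    have h3 : 2 * i + 3 < 2 * N + 2 := by omega
    have h2 : 2 * i + 2 < 2 * N + 2 := by omega
    simp only [hA₁, Stmt.exec, Function.update_self, hx3, hi, if_true, Expr.residual, Expr.sub,
      Expr.eval_op, ArithOp.eval_sub]
    rw [Expr.eval_lagrange _ (I (2 * i + 2)) fun i' j' => by simp [Expr.eval, hi]]
    simp [Expr.eval, h3, hr, hx2]
  have hcard : ∀ p : ℝ → Prop, {k ∈ Finset.range N | p (A₁ 1 k) ∧ A 0 k = j} =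
      {k ∈ Finset.range N | p (r k) ∧ A 0 k = j} := fun p =>
    Finset.filter_congr fun k hk => by rw [h1 k (Finset.mem_range.1 hk)]
  set P : ℕ → Prop := fun i => Expr.eval (2 * N + 2) I A₁ (.const 0)
      (Function.update (Function.update x₀ 5 j) 4 i) <
    Expr.eval (2 * N + 2) I A₁ .isMedian (Function.update (Function.update x₀ 5 j) 4 i) with hP
  have hPiff : ∀ i < N, P i ↔ A 0 i = j ∧
      2 * {k ∈ Finset.range N | r k < r i ∧ A 0 k = j}.card ≤
        {k ∈ Finset.range N | A 0 k = j}.card ∧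
      2 * {k ∈ Finset.range N | r i < r k ∧ A 0 k = j}.card ≤
        {k ∈ Finset.range N | A 0 k = j}.card := fun i hi => by
    have := Expr.eval_isMedian (S := 2 * N + 2) (I := I) (A := A₁)
      (x := Function.update (Function.update x₀ 5 j) 4 i)
    simp only [hP, Expr.eval_const, Rat.cast_zero, this, h0]
    simp only [Function.update_self, ne_eq, not_false_eq_true,
      Function.update_of_ne, show x₀ 3 = N from rfl, h1 i hi, hcard (fun z => z < r i),
      hcard (fun z => r i < z), show ¬ (3 : ℕ) = 4 by decide, show ¬ (3 : ℕ) = 5 by decide,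
      show ¬ (5 : ℕ) = 4 by decide]
  -- Without a point passing the test, the fold would return its default 0; a nonempty bin has a
  -- median.
  have hex : ∃ i < N, P i := by
    obtain ⟨i₀, hi₀, hb⟩ := h j hj
    obtain ⟨i, hi, hm1, hm2⟩ := exists_median {k ∈ Finset.range N | A 0 k = j}
      ⟨i₀, Finset.mem_filter.2 ⟨Finset.mem_range.2 hi₀, hb⟩⟩ r
    obtain ⟨hiN, hij⟩ := Finset.mem_filter.1 hi
    refine ⟨i, Finset.mem_range.1 hiN, (hPiff i (Finset.mem_range.1 hiN)).2 ⟨hij, ?_, ?_⟩⟩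
    · rw [Finset.filter_filter] at hm1; simpa only [and_comm] using hm1
    · rw [Finset.filter_filter] at hm2; simpa only [and_comm] using hm2
  obtain ⟨hlt, hPl⟩ := lastIdx_spec hex
  have hnode : ∀ c, c < 4 → (Expr.node c).eval (2 * N + 2) I A₁ (Function.update x₀ 5 j) =
      I (2 * lastIdx P N + c) := fun c hc => by
    have hlen : Function.update x₀ 5 j 3 = N := by simp [hx3]
    rw [Expr.node, Expr.eval_foldLast _ _ _ _ _ _ (by rw [hlen]; exact hex), hlen,
      Expr.eval_inp]
    rw [if_pos (by simp only [Function.update_self]; simp only [hP] at hlt; omega)]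
    simp only [Function.update_self]
    rfl
  refine ⟨lastIdx P N, hlt, ((hPiff _ hlt).1 hPl).1, ?_, ?_, ((hPiff _ hlt).1 hPl).2⟩
  · have : Stmt.medianStep.exec (2 * N + 2) I x₀ A 2 = A₂ 2 := by
      simp [Stmt.medianStep, Stmt.exec, hA₂, hA₁]
    rw [this]
    simp only [hA₂, Stmt.exec, Function.update_self, hx2, hj, if_true]
    exact hnode 2 (by omega)
  · have : Stmt.medianStep.exec (2 * N + 2) I x₀ A 3 =
        (Stmt.fill 3 2 5 (.node 3)).exec (2 * N + 2) I x₀ A₂ 3 := by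
      simp [Stmt.medianStep, Stmt.exec, hA₂, hA₁]
    rw [this]
    simp only [Stmt.exec, Function.update_self, hx2, hj, if_true]
    rw [hA₂, Stmt.exec, Expr.eval_update (by
      simp [Expr.node, Expr.isMedian, Expr.ifEq, Expr.NoRead, Expr.mul, Expr.sum])]
    exact hnode 3 (by omega)

theorem medianStep_bin {d N : ℕ} (I : ℕ → ℝ) (A : Fin 7 → ℕ → ℝ) :
    Stmt.medianStep.exec (2 * N + 2) I (initVar d N) A 0 = A 0 := by
  simp [Stmt.medianStep, Stmt.exec]

end Semantics

/-- The algorithm returns the value at `m` of an interpolation polynomial obtained by `N * N + 2`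
median steps. -/
theorem returns_extrapolation {d N : ℕ} (m Δ : ℝ) (D : Fin N → ℝ × ℝ) (coins : ℕ → Bool)
    {x y bin : ℕ → ℝ} (hx : ∀ i : Fin N, x i = (D i).1) (hy : ∀ i : Fin N, y i = (D i).2)
    (hbin : ∀ i < N, bin i = binOf d (2 * x i / Δ - 1)) (h : ∀ j < d + 1, ∃ i < N, bin i = j) :
    ∃ X Y : ℕ → ℕ → ℝ,
      (∀ t < N * N + 2, IsMedianStep (d + 1) N x y bin (X t) (Y t) (X (t + 1)) (Y (t + 1))) ∧
      Returns extrapolation d m Δ D coins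
        (lagrangeEval (d + 1) (X (N * N + 2)) (Y (N * N + 2)) m) := by
  set I := (input d m Δ D coins).M with hI
  set x₀ := initVar d N with hx₀
  set A₀ := (Stmt.fill 0 3 4 .bin).exec (2 * N + 2) I x₀ 0 with hA₀
  set F := Stmt.medianStep.exec (2 * N + 2) I x₀ with hF
  have hIx : ∀ i < N, I (2 * i + 2) = x i := fun i hi => by
    have h1 : (2 * i + 2) % 2 = 0 := by omega
    have h2 : 2 * i + 2 ≠ 1 := by omega
    simp [hI, input, hi, h2, hx ⟨i, hi⟩]
  have hIy : ∀ i < N, I (2 * i + 3) = y i := fun i hi => by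
    have h1 : (2 * i + 3) % 2 = 1 := by omega
    have h2 : (2 * i + 1) / 2 = i := by omega
    simp [hI, input, hi, h1, h2, hy ⟨i, hi⟩]
  have hb0 : ∀ i < N, A₀ 0 i = bin i := fun i hi => by
    have h2 : 2 * i + 2 < 2 * N + 2 := by omega
    have hI1 : I 1 = Δ := by simp [hI, input]
    simp only [hA₀, Stmt.exec, Function.update_self, show x₀ 3 = N from rfl, hi, if_true,
      Expr.eval_bin, hbin i hi]
    congr 1
    simp [Expr.position, Expr.sub, Expr.div, Expr.mul, Expr.eval, ArithOp.eval_sub,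
      ArithOp.eval_div, ArithOp.eval_mul, hi, hI1, hIx i hi, hx₀, initVar]
  have hbt : ∀ t, (F^[t] A₀) 0 = A₀ 0 := fun t => by
    induction t with
    | zero => rfl
    | succ t ih => rw [Function.iterate_succ_apply', hF, medianStep_bin, ← hF, ih]
  refine ⟨fun t => (F^[t] A₀) 2, fun t => (F^[t] A₀) 3, fun t _ => ?_, ?_⟩
  · have := medianStep_spec I (F^[t] A₀) (d := d) (N := N) fun j hj => by
      obtain ⟨i, hi, hij⟩ := h j hj
      exact ⟨i, hi, by rw [hbt, hb0 i hi, hij]⟩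
    simp only [Function.iterate_succ_apply']
    intro j hj
    obtain ⟨i, hi, h1, h2, h3, h4, h5⟩ := this j hj
    refine ⟨i, hi, ?_, h2.trans (hIx i hi), h3.trans (hIy i hi), ?_⟩
    · rw [← hb0 i hi, ← hbt t]; exact h1
    · have e1 : ∀ k ∈ Finset.range N, (F^[t] A₀) 0 k = bin k := fun k hk => by
        rw [hbt t, hb0 k (Finset.mem_range.1 hk)]
      have e2 : {k ∈ Finset.range N | (F^[t] A₀) 0 k = j} = {k ∈ Finset.range N | bin k = j} :=
        Finset.filter_congr fun k hk => by rw [e1 k hk]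
      rw [e2] at h4 h5
      simp only [hIx i hi, hIy i hi] at h4 h5
      refine ⟨?_, ?_⟩
      · convert h4 using 3
        refine Finset.filter_congr fun k hk => ?_
        rw [e1 k hk, hIx k (Finset.mem_range.1 hk), hIy k (Finset.mem_range.1 hk)]
      · convert h5 using 3
        refine Finset.filter_congr fun k hk => ?_
        rw [e1 k hk, hIx k (Finset.mem_range.1 hk), hIy k (Finset.mem_range.1 hk)]
  · have := returns_program (main_good (d + N)) (.lagrange (.inp 0 0)) (d := d) (N := N)
      (by omega) (by omega) m Δ D coins
    rw [Expr.eval_lagrange _ m fun i j => by simp [Expr.eval, input, initVar]] at this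
    -- One initial step, N² steps from two nested loops of length N, and one final step.
    have hm : Stmt.main.exec (2 * N + 2) I x₀ 0 = F^[N * N + 2] A₀ := by
      rw [show N * N + 2 = 1 + (N * N + 1) by ring, Function.iterate_add_apply,
        Function.iterate_add_apply, Function.iterate_mul]
      rfl
    rw [← hI, ← hx₀, hm] at this
    exact this

end RealRAM

/-! ### Chebyshev expansions -/

namespace ChebyshevSum

open Polynomial.Chebyshev Finset Real

/-- The weight of the `k`-th squared coefficient in Parseval's identity. -/
noncomputable def wt (k : ℕ) : ℝ := if k = 0 then 1 else 2

theorem wt_pos (k : ℕ) : 0 < wt k := by unfold wt; split_ifs <;> norm_num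

/-- The squared norm of a Chebyshev expansion. -/
noncomputable def normSq (d : ℕ) (a : ℕ → ℝ) : ℝ := ∑ k ∈ range (d + 1), a k ^ 2 / wt k

theorem normSq_nonneg (d : ℕ) (a : ℕ → ℝ) : 0 ≤ normSq d a :=
  sum_nonneg fun k _ => div_nonneg (sq_nonneg _) (wt_pos k).le

theorem exists_expansion {d : ℕ} {f : ℝ[X]} (hf : f.natDegree ≤ d) :
    ∃ a : ℕ → ℝ, f = ∑ k ∈ range (d + 1), a k • T ℝ (k : ℤ) := by
  have hmem : f ∈ Polynomial.degreeLT ℝ (d + 1) :=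
    Polynomial.mem_degreeLT.2 (Polynomial.degree_le_natDegree.trans_lt (by
      exact_mod_cast Nat.lt_succ_of_le hf))
  rw [← Polynomial.Sequence.span_degreeLT (chebyshevTsequence ℝ) (by simp),
    show Set.Iio (d + 1) = Finset.range (d + 1) by simp,
    Submodule.mem_span_image_finset_iff_exists_fun'] at hmem
  obtain ⟨c, rfl⟩ := hmem
  exact ⟨c, rfl⟩

/-! ### Orthogonality, Parseval's identity and Bernstein's inequality in L² -/

theorem integral_cos_int_mul (k : ℤ) :
    ∫ θ in 0..π, cos (k * θ) = if k = 0 then π else 0 := by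
  have h : ∫ θ in 0..π, cos (k * θ) = ∫ x, (T ℝ k).eval x ∂measureT := by
    rw [integral_measureT_eq_integral_cos]
    simp_rw [T_real_cos]
  rw [h]
  split_ifs with hk
  · rw [hk, integral_eval_T_real_measureT_zero]
  · exact integral_eval_T_real_measureT_of_ne_zero hk

theorem integral_cos_mul_cos (j k : ℕ) :
    ∫ θ in 0..π, cos (j * θ) * cos (k * θ) = if j = k then π / wt k else 0 := by
  have h : ∀ θ : ℝ, cos (j * θ) * cos (k * θ) =
      (cos (((j - k : ℤ) : ℝ) * θ) + cos (((j + k : ℤ) : ℝ) * θ)) / 2 := fun θ => by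
    push_cast
    rw [sub_mul, add_mul, cos_sub, cos_add]; ring
  simp_rw [h]
  rw [intervalIntegral.integral_div, intervalIntegral.integral_add
    (by apply Continuous.intervalIntegrable; fun_prop)
    (by apply Continuous.intervalIntegrable; fun_prop), integral_cos_int_mul, integral_cos_int_mul]
  by_cases hjk : j = k
  · subst hjk
    by_cases hj : j = 0
    · simp [hj, wt]
    · have h1 : ¬ (j : ℤ) + j = 0 := by omega
      rw [if_pos (by omega), if_neg h1]
      simp [wt, hj]
  · have h1 : ¬ (j : ℤ) + k = 0 := by omega
    have h2 : ¬ (j : ℤ) - k = 0 := by omega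
    rw [if_neg h2, if_neg h1]
    simp [hjk]

theorem integral_sin_mul_sin (j k : ℕ) :
    ∫ θ in 0..π, (j * sin (j * θ)) * (k * sin (k * θ)) =
      if j = k then π * k ^ 2 / wt k else 0 := by
  have h : ∀ θ : ℝ, (j * sin (j * θ)) * (k * sin (k * θ)) =
      j * k / 2 * (cos (((j - k : ℤ) : ℝ) * θ) - cos (((j + k : ℤ) : ℝ) * θ)) := fun θ => by
    push_cast
    rw [sub_mul, add_mul, cos_sub, cos_add]; ring
  simp_rw [h]
  rw [intervalIntegral.integral_const_mul, intervalIntegral.integral_sub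
    (by apply Continuous.intervalIntegrable; fun_prop)
    (by apply Continuous.intervalIntegrable; fun_prop), integral_cos_int_mul, integral_cos_int_mul]
  by_cases hjk : j = k
  · subst hjk
    by_cases hj : j = 0
    · simp [hj]
    · have h1 : ¬ (j : ℤ) + j = 0 := by omega
      rw [if_pos (by omega), if_neg h1]
      simp [wt, hj]
      ring
  · have h1 : ¬ (j : ℤ) + k = 0 := by omega
    have h2 : ¬ (j : ℤ) - k = 0 := by omega
    rw [if_neg h2, if_neg h1]
    simp [hjk]

/-- Orthogonal expansions: the integral of the square of a sum. -/
theorem integral_sq_sum {φ : ℕ → ℝ → ℝ} (hφ : ∀ k, Continuous (φ k)) {c : ℕ → ℝ}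
    (horth : ∀ j k, ∫ θ in 0..π, φ j θ * φ k θ = if j = k then c k else 0) (a : ℕ → ℝ) (n : ℕ) :
    ∫ θ in 0..π, (∑ k ∈ range n, a k * φ k θ) ^ 2 = ∑ k ∈ range n, a k ^ 2 * c k := by
  have h : ∀ θ : ℝ, (∑ k ∈ range n, a k * φ k θ) ^ 2 =
      ∑ j ∈ range n, ∑ k ∈ range n, a j * a k * (φ j θ * φ k θ) := fun θ => by
    rw [sq, sum_mul_sum]
    exact sum_congr rfl fun j _ => sum_congr rfl fun k _ => by ring
  simp_rw [h]
  rw [intervalIntegral.integral_finsetSum fun j _ => by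
    apply Continuous.intervalIntegrable
    exact continuous_finsetSum _ fun k _ => ((hφ j).mul (hφ k)).const_mul _]
  refine sum_congr rfl fun j hj => ?_
  have hi : ∀ k ∈ range n, IntervalIntegrable (fun θ => a j * a k * (φ j θ * φ k θ)) volume 0 π :=
    fun k _ => (((hφ j).mul (hφ k)).const_mul _).intervalIntegrable _ _
  rw [intervalIntegral.integral_finsetSum hi]
  simp_rw [intervalIntegral.integral_const_mul, horth]
  rw [sum_eq_single j (fun k _ hk => by simp [hk.symm]) (fun h => absurd hj h)]
  simp [sq]

/-- The trigonometric polynomial of a Chebyshev expansion. -/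
noncomputable def trig (d : ℕ) (a : ℕ → ℝ) (θ : ℝ) : ℝ := ∑ k ∈ range (d + 1), a k * cos (k * θ)

/-- Minus the derivative of `trig d a`. -/
noncomputable def trigDeriv (d : ℕ) (a : ℕ → ℝ) (θ : ℝ) : ℝ :=
  ∑ k ∈ range (d + 1), a k * (k * sin (k * θ))

theorem continuous_trigDeriv (d : ℕ) (a : ℕ → ℝ) : Continuous (trigDeriv d a) := by
  unfold trigDeriv; fun_prop

theorem hasDerivAt_trig (d : ℕ) (a : ℕ → ℝ) (θ : ℝ) :
    HasDerivAt (trig d a) (-trigDeriv d a θ) θ := by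
  unfold trigDeriv
  rw [← sum_neg_distrib]
  refine HasDerivAt.fun_sum fun k _ => ?_
  have h : HasDerivAt (fun θ : ℝ => cos (k * θ)) (-sin (k * θ) * (k * 1)) θ :=
    ((hasDerivAt_id θ).const_mul (k : ℝ)).cos
  exact (h.const_mul (a k)).congr_deriv (by ring)

theorem integral_trig_sq (d : ℕ) (a : ℕ → ℝ) : ∫ θ in 0..π, trig d a θ ^ 2 = π * normSq d a := by
  unfold trig
  rw [integral_sq_sum (fun k => by fun_prop) integral_cos_mul_cos, normSq, mul_sum]
  exact sum_congr rfl fun k _ => by ring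

/-- Bernstein's inequality in L²: differentiation multiplies the k-th coefficient by k ≤ d, and the
sines are orthogonal like the cosines. -/
theorem integral_trigDeriv_sq_le (d : ℕ) (a : ℕ → ℝ) :
    ∫ θ in 0..π, trigDeriv d a θ ^ 2 ≤ π * d ^ 2 * normSq d a := by
  unfold trigDeriv
  rw [integral_sq_sum (fun k => by fun_prop) integral_sin_mul_sin, normSq, mul_sum]
  refine sum_le_sum fun k hk => ?_
  have hk' : (k : ℝ) ^ 2 ≤ d ^ 2 := by
    have : (k : ℝ) ≤ d := by exact_mod_cast Nat.lt_succ_iff.1 (mem_range.1 hk)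
    gcongr
  have h1 : 0 ≤ π * (a k ^ 2 / wt k) :=
    mul_nonneg pi_pos.le (div_nonneg (sq_nonneg _) (wt_pos k).le)
  calc a k ^ 2 * (π * k ^ 2 / wt k) = π * (a k ^ 2 / wt k) * k ^ 2 := by ring
    _ ≤ π * (a k ^ 2 / wt k) * d ^ 2 := by gcongr
    _ = _ := by ring

theorem eval_cos {d : ℕ} {a : ℕ → ℝ} (θ : ℝ) :
    (∑ k ∈ range (d + 1), a k • T ℝ (k : ℤ)).eval (cos θ) = trig d a θ := by
  simp [Polynomial.eval_finsetSum, trig, T_real_cos]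

/-! ### Quadrature at the Chebyshev zeros and oscillation near them -/

/-- The angles of the zeros of the Chebyshev polynomial of degree `n`. -/
noncomputable def zeroAngle (n j : ℕ) : ℝ := (2 * j + 1) / (2 * n) * π

/-- Gauss–Chebyshev quadrature with d + 1 nodes is exact in degrees below 2(d + 1), and the square
of the expansion has degree at most 2d. -/
theorem sum_trig_zeroAngle_sq (d : ℕ) (a : ℕ → ℝ) :
    ∑ j ∈ range (d + 1), trig d a (zeroAngle (d + 1) j) ^ 2 = (d + 1) * normSq d a := by
  set f : ℝ[X] := ∑ k ∈ range (d + 1), a k • T ℝ (k : ℤ) with hf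
  have hdeg : f.degree ≤ d := by
    refine (Polynomial.degree_sum_le _ _).trans (Finset.sup_le fun k hk => ?_)
    refine (Polynomial.degree_smul_le _ _).trans ?_
    rw [degree_T]
    exact_mod_cast Nat.lt_succ_iff.1 (mem_range.1 hk)
  have hdeg2 : (f ^ 2).degree < 2 * ((d + 1 : ℕ) : WithBot ℕ) := by
    refine (Polynomial.degree_pow_le f 2).trans_lt ?_
    refine (nsmul_le_nsmul_right hdeg 2).trans_lt ?_
    rw [nsmul_eq_mul]
    exact_mod_cast (by omega : 2 * d < 2 * (d + 1))
  have h := integral_eq_sumZeroes (Nat.succ_ne_zero d) hdeg2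
  rw [integral_measureT_eq_integral_cos, sumZeroes] at h
  simp only [Polynomial.eval_pow, hf, eval_cos] at h
  rw [integral_trig_sq] at h
  have hd : ((d.succ : ℕ) : ℝ) ≠ 0 := by positivity
  rw [div_mul_eq_mul_div, eq_div_iff hd, mul_assoc] at h
  have h := mul_left_cancel₀ pi_ne_zero h
  rw [mul_comm] at h
  simpa [zeroAngle] using h.symm

/-- Cauchy–Schwarz for the integral of g', obtained from ∫ (g' - c)² ≥ 0 with c the mean of g'. -/
theorem sq_sub_le_integral {g g' : ℝ → ℝ} (hg : ∀ x, HasDerivAt g (g' x) x) (hc : Continuous g')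
    {u v : ℝ} (huv : u ≤ v) : (g v - g u) ^ 2 ≤ (v - u) * ∫ x in u..v, g' x ^ 2 := by
  have hint : ∫ x in u..v, g' x = g v - g u :=
    intervalIntegral.integral_eq_sub_of_hasDerivAt (fun x _ => hg x) (hc.intervalIntegrable _ _)
  rcases huv.eq_or_lt with rfl | hlt
  · simp
  set c := (g v - g u) / (v - u) with hcdef
  have hpos : 0 < v - u := sub_pos.2 hlt
  have h0 : 0 ≤ ∫ x in u..v, (g' x - c) ^ 2 :=
    intervalIntegral.integral_nonneg huv fun x _ => sq_nonneg _
  have hexp : ∫ x in u..v, (g' x - c) ^ 2 =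
      (∫ x in u..v, g' x ^ 2) - 2 * c * (g v - g u) + c ^ 2 * (v - u) := by
    have : ∀ x, (g' x - c) ^ 2 = g' x ^ 2 - 2 * c * g' x + c ^ 2 := fun x => by ring
    simp_rw [this]
    rw [intervalIntegral.integral_add (by apply Continuous.intervalIntegrable; fun_prop)
        (by apply Continuous.intervalIntegrable; fun_prop),
      intervalIntegral.integral_sub (by apply Continuous.intervalIntegrable; fun_prop)
        (by apply Continuous.intervalIntegrable; fun_prop),
      intervalIntegral.integral_const_mul, hint]
    simp; ring
  have hcm : c * (v - u) = g v - g u := by rw [hcdef]; field_simp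
  rw [hexp, ← hcm] at h0
  rw [← hcm]
  nlinarith

/-- The small factor δ comes from the distance of the points, while the integral extends over a
whole arc, so that the bounds for different arcs add up to one integral. -/
theorem sq_sub_le_integral_of_subset {g g' : ℝ → ℝ} (hg : ∀ x, HasDerivAt g (g' x) x)
    (hc : Continuous g') {u v α β δ : ℝ} (hu : u ∈ Set.Icc α β) (hv : v ∈ Set.Icc α β)
    (hδ : |u - v| ≤ δ) : (g u - g v) ^ 2 ≤ δ * ∫ x in α..β, g' x ^ 2 := by
  wlog huv : u ≤ v generalizing u v
  · rw [← neg_sub, neg_sq]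
    exact this hv hu (by rwa [abs_sub_comm]) (not_le.1 huv).le
  have h1 := sq_sub_le_integral hg hc huv
  rw [← neg_sub, neg_sq]
  refine h1.trans ?_
  have h2 : ∫ x in u..v, g' x ^ 2 ≤ ∫ x in α..β, g' x ^ 2 :=
    intervalIntegral.integral_mono_interval hu.1 huv hv.2
      (Eventually.of_forall fun x => sq_nonneg _)
      (by apply Continuous.intervalIntegrable; fun_prop)
  have h3 : 0 ≤ ∫ x in u..v, g' x ^ 2 :=
    intervalIntegral.integral_nonneg huv fun x _ => sq_nonneg _
  have h4 : v - u ≤ δ := by rw [abs_sub_comm] at hδ; exact (le_abs_self _).trans hδ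
  have h5 : 0 ≤ v - u := sub_nonneg.2 huv
  exact mul_le_mul h4 h2 h3 (h5.trans h4)

/-- The oscillation of a trigonometric polynomial on short pieces of the arcs around the zeros of
the Chebyshev polynomial. -/
theorem sum_sq_sub_le {d : ℕ} (a : ℕ → ℝ) {u v : ℕ → ℝ} {δ : ℝ} (hδ : 0 ≤ δ)
    (hu : ∀ j < d + 1, u j ∈ Set.Icc (j * π / (d + 1)) ((j + 1) * π / (d + 1)))
    (hv : ∀ j < d + 1, v j ∈ Set.Icc (j * π / (d + 1)) ((j + 1) * π / (d + 1)))
    (huv : ∀ j < d + 1, |u j - v j| ≤ δ) :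
    ∑ j ∈ range (d + 1), (trig d a (u j) - trig d a (v j)) ^ 2 ≤
      δ * (π * d ^ 2 * normSq d a) := by
  have hd : (d : ℝ) + 1 ≠ 0 := by positivity
  calc ∑ j ∈ range (d + 1), (trig d a (u j) - trig d a (v j)) ^ 2
      ≤ ∑ j ∈ range (d + 1), δ * ∫ x in (j * π / (d + 1))..(((j + 1 : ℕ) : ℝ) * π / (d + 1)),
          trigDeriv d a x ^ 2 := by
        refine sum_le_sum fun j hj => ?_
        have hj := mem_range.1 hj
        have := sq_sub_le_integral_of_subset (hasDerivAt_trig d a)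
          (continuous_trigDeriv d a).neg (hu j hj) (hv j hj) (huv j hj)
        simpa only [neg_sq, Nat.cast_add, Nat.cast_one] using this
    _ = δ * ∫ x in 0..π, trigDeriv d a x ^ 2 := by
        -- The d + 1 arcs tile the interval [0, π].
        rw [← mul_sum, intervalIntegral.sum_integral_adjacent_intervals
          (a := fun j : ℕ => (j : ℝ) * π / (d + 1)) fun k _ => by
            have := continuous_trigDeriv d a
            apply Continuous.intervalIntegrable; fun_prop]
        congr 2
        · simp
        · push_cast; field_simp
    _ ≤ _ := mul_le_mul_of_nonneg_left (integral_trigDeriv_sq_le d a) hδ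

/-! ### Growth of Chebyshev expansions to the right of 1 -/

theorem abs_eval_T_le {t : ℝ} (ht : 1 ≤ t) (k : ℕ) :
    0 < (T ℝ (k : ℤ)).eval t ∧ (T ℝ (k : ℤ)).eval t ≤ (2 * t) ^ k := by
  have hpos : ∀ k : ℕ, 0 < (T ℝ (k : ℤ)).eval t := fun k =>
    zero_lt_one.trans_le (one_le_eval_T_real k ht)
  refine ⟨hpos k, ?_⟩
  induction k using Nat.twoStepInduction with
  | zero => simp
  | one => simp; linarith
  | more k _ ih =>
    have h := T_add_two ℝ (k : ℤ)
    have h1 := hpos k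
    push_cast at ih ⊢
    rw [h]
    simp only [Polynomial.eval_sub, Polynomial.eval_mul, Polynomial.eval_ofNat,
      Polynomial.eval_X]
    -- For t ≥ 1 the subtracted term of the recursion is positive and can be dropped.
    calc 2 * t * (T ℝ ((k : ℤ) + 1)).eval t - (T ℝ (k : ℤ)).eval t
        ≤ 2 * t * (T ℝ ((k : ℤ) + 1)).eval t := by linarith
      _ ≤ 2 * t * (2 * t) ^ (k + 1) := by gcongr
      _ = _ := by ring

/-- All values T_k(t) are at most (2t)^d, and Cauchy–Schwarz with the weights `wt k`, of sum 2d + 1,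
bounds the sum of the coefficients. -/
theorem sq_eval_le {d : ℕ} (a : ℕ → ℝ) {t : ℝ} (ht : 1 ≤ t) :
    (∑ k ∈ range (d + 1), a k • T ℝ (k : ℤ)).eval t ^ 2 ≤
      (2 * d + 1) * normSq d a * ((2 * t) ^ d) ^ 2 := by
  have h1 : |(∑ k ∈ range (d + 1), a k • T ℝ (k : ℤ)).eval t| ≤
      (∑ k ∈ range (d + 1), |a k|) * (2 * t) ^ d := by
    simp only [Polynomial.eval_finsetSum, Polynomial.eval_smul, smul_eq_mul]
    rw [sum_mul]
    refine (abs_sum_le_sum_abs _ _).trans (sum_le_sum fun k hk => ?_)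
    rw [abs_mul]
    have h2 := abs_eval_T_le ht k
    rw [abs_of_pos h2.1]
    have h3 : (2 * t) ^ k ≤ (2 * t) ^ d :=
      pow_le_pow_right₀ (by linarith) (Nat.lt_succ_iff.1 (mem_range.1 hk))
    exact mul_le_mul_of_nonneg_left (h2.2.trans h3) (abs_nonneg _)
  have h4 : (∑ k ∈ range (d + 1), |a k|) ^ 2 ≤ (∑ k ∈ range (d + 1), wt k) * normSq d a :=
    sum_sq_le_sum_mul_sum_of_sq_le_mul _ (fun k _ => (wt_pos k).le)
      (fun k _ => div_nonneg (sq_nonneg _) (wt_pos k).le) fun k _ => by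
        have := (wt_pos k).ne'
        rw [mul_div_cancel₀ _ this, sq_abs]
  have h5 : ∑ k ∈ range (d + 1), wt k = 2 * d + 1 := by
    rw [sum_range_succ']
    simp [wt]; ring
  rw [h5] at h4
  rw [← sq_abs]
  calc _ ≤ ((∑ k ∈ range (d + 1), |a k|) * (2 * t) ^ d) ^ 2 := by gcongr
    _ = (∑ k ∈ range (d + 1), |a k|) ^ 2 * ((2 * t) ^ d) ^ 2 := by ring
    _ ≤ _ := by gcongr

end ChebyshevSum

/-! ### The bins -/

section Bins

open Real Finset

/-- This is sin((k+2)θ) = 2 cos θ sin((k+1)θ) - sin(kθ), divided by sin((k+1)θ). The hypothesis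
keeps the recursion away from division by zero. -/
theorem chebQuot_cos {θ : ℝ} {n : ℕ} (h : ∀ k, 1 ≤ k → k ≤ n → sin (k * θ) ≠ 0) :
    ∀ k, k + 1 ≤ n →
      chebQuot (cos θ) k = sin (((k + 2 : ℕ) : ℝ) * θ) / sin (((k + 1 : ℕ) : ℝ) * θ) := by
  intro k
  induction k with
  | zero =>
    intro hk
    have h1 := h 1 le_rfl hk
    simp only [Nat.cast_one, one_mul] at h1
    simp only [chebQuot, zero_add, Nat.cast_ofNat, Nat.cast_one, one_mul, sin_two_mul]
    field_simp
  | succ k ih =>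
    intro hk
    have h1 := h (k + 1) (by omega) (by omega)
    have h2 := h (k + 2) (by omega) (by omega)
    rw [chebQuot, ih (by omega), one_div_div, eq_div_iff h2, sub_mul, div_mul_cancel₀ _ h2]
    have e1 : ((k + 1 + 2 : ℕ) : ℝ) * θ = ((k + 2 : ℕ) : ℝ) * θ + θ := by push_cast; ring
    have e2 : ((k + 1 : ℕ) : ℝ) * θ = ((k + 2 : ℕ) : ℝ) * θ - θ := by push_cast; ring
    have e3 : k + 1 + 1 = k + 2 := rfl
    rw [e1, e2, e3, sin_add, sin_sub]
    ring

theorem prod_chebQuot_cos {θ : ℝ} {n : ℕ} (h : ∀ k, 1 ≤ k → k ≤ n → sin (k * θ) ≠ 0) {m : ℕ}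
    (hm : m ≤ n) :
    (∏ k ∈ range m, chebQuot (cos θ) k) * sin θ = sin (((m + 1 : ℕ) : ℝ) * θ) := by
  induction m with
  | zero => simp
  | succ m ih =>
    have h1 := h (m + 1) (by omega) (by omega)
    rw [prod_range_succ, chebQuot_cos h m hm, mul_right_comm, ih (by omega),
      mul_div_cancel₀ _ h1]

theorem sin_eq_sign_mul (k : ℤ) (ψ : ℝ) : sin ψ = (-1) ^ k * sin (ψ - k * π) := by
  rw [sin_sub_int_mul_pi, ← mul_assoc, ← mul_zpow]
  simp

/-- Together with `sin_eq_sign_mul`, this says that the sign of sin ψ is the parity of ⌊ψ/π⌋. -/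
theorem sin_sub_floor_pos {ψ : ℝ} (h : sin ψ ≠ 0) : 0 < sin (ψ - ⌊ψ / π⌋ * π) := by
  have h1 := Int.floor_le (ψ / π)
  have h2 := Int.lt_floor_add_one (ψ / π)
  rw [le_div_iff₀ pi_pos] at h1
  rw [div_lt_iff₀ pi_pos] at h2
  have h3 : sin (ψ - ⌊ψ / π⌋ * π) ≠ 0 := fun h0 => h (by
    rw [sin_eq_sign_mul ⌊ψ / π⌋, h0, mul_zero])
  refine lt_of_le_of_ne (sin_nonneg_of_nonneg_of_le_pi (by linarith) (by linarith)) h3.symm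

theorem floor_add_sub_floor {z φ : ℝ} (h0 : 0 < φ) (h1 : φ < 1) :
    ⌊z + φ⌋ = ⌊z⌋ ∨ ⌊z + φ⌋ = ⌊z⌋ + 1 := by
  have h2 := Int.floor_le z
  have h3 := Int.lt_floor_add_one z
  by_cases h : z + φ < ⌊z⌋ + 1
  · left; rw [Int.floor_eq_iff]; constructor <;> linarith
  · right; rw [Int.floor_eq_iff]; push_cast; constructor <;> linarith

open Classical in
-- As 0 < θ < π, at most one multiple of π is passed between (k+1)θ and (k+2)θ, and the sine changes
-- sign exactly when one is passed.
theorem indicator_chebQuot_cos {θ : ℝ} (hθ : 0 < θ) (hθ' : θ < π) {n : ℕ}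
    (h : ∀ k, 1 ≤ k → k ≤ n → sin (k * θ) ≠ 0) {k : ℕ} (hk : k + 2 ≤ n) :
    (if chebQuot (cos θ) k < 0 then (1 : ℝ) else 0) =
      ⌊((k + 2 : ℕ) : ℝ) * θ / π⌋ - ⌊((k + 1 : ℕ) : ℝ) * θ / π⌋ := by
  rw [chebQuot_cos h k (by omega)]
  have h1 := h (k + 1) (by omega) (by omega)
  have h2 := h (k + 2) (by omega) hk
  have p1 := sin_sub_floor_pos h1
  have p2 := sin_sub_floor_pos h2
  have hfl := floor_add_sub_floor (z := ((k + 1 : ℕ) : ℝ) * θ / π) (div_pos hθ pi_pos)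
    ((div_lt_one pi_pos).2 hθ')
  rw [show ((k + 1 : ℕ) : ℝ) * θ / π + θ / π = ((k + 2 : ℕ) : ℝ) * θ / π by push_cast; ring] at hfl
  rw [sin_eq_sign_mul ⌊((k + 2 : ℕ) : ℝ) * θ / π⌋ (((k + 2 : ℕ) : ℝ) * θ),
    sin_eq_sign_mul ⌊((k + 1 : ℕ) : ℝ) * θ / π⌋ (((k + 1 : ℕ) : ℝ) * θ)]
  have hs : ∀ m : ℤ, ((-1 : ℝ) ^ m) ≠ 0 := fun m => zpow_ne_zero _ (by norm_num)
  rcases hfl with hfl | hfl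
  · rw [hfl] at p2 ⊢
    rw [mul_div_mul_left _ _ (hs _), if_neg (not_lt.2 (div_pos p2 p1).le), sub_self]
  · rw [hfl] at p2 ⊢
    rw [zpow_add₀ (by norm_num), zpow_one, mul_assoc, mul_div_mul_left _ _ (hs _), if_pos]
    · push_cast; ring
    · have := div_pos p2 p1
      rw [neg_one_mul, neg_div]
      linarith

open Classical in
-- The sign changes in sin θ, sin 2θ, …, sin((d+1)θ) telescope to the number of multiples of π
-- passed, as in Sturm's theorem; the product of the quotients telescopes as well.
theorem binOf_cos {d : ℕ} {θ : ℝ} (hθ : 0 < θ) (hθ' : θ < π)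
    (h : ∀ k, 1 ≤ k → k ≤ d + 1 → sin (k * θ) ≠ 0) :
    binOf d (cos θ) = if sin (((d + 1 : ℕ) : ℝ) * θ) ^ 2 < 999999 / 1000000 then -1
      else (⌊((d + 1 : ℕ) : ℝ) * θ / π⌋ : ℝ) := by
  have hcount : ∑ k ∈ range d, (if chebQuot (cos θ) k < 0 then (1 : ℝ) else 0) =
      (⌊((d + 1 : ℕ) : ℝ) * θ / π⌋ : ℝ) := by
    rw [sum_congr rfl fun k hk => indicator_chebQuot_cos hθ hθ' h
      (by have := mem_range.1 hk; omega)]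
    rw [sum_range_sub (fun k : ℕ => (⌊((k + 1 : ℕ) : ℝ) * θ / π⌋ : ℝ))]
    have : ⌊((0 + 1 : ℕ) : ℝ) * θ / π⌋ = 0 := by
      rw [Int.floor_eq_zero_iff]
      simp only [zero_add, Nat.cast_one, one_mul]
      exact ⟨(div_pos hθ pi_pos).le, (div_lt_one pi_pos).2 hθ'⟩
    rw [this]; simp
  have hsin : (1 - cos θ * cos θ) * ((∏ k ∈ range d, chebQuot (cos θ) k) *
      ∏ k ∈ range d, chebQuot (cos θ) k) = sin (((d + 1 : ℕ) : ℝ) * θ) ^ 2 := by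
    rw [← prod_chebQuot_cos h (m := d) (by omega), mul_pow,
      show 1 - cos θ * cos θ = sin θ ^ 2 by rw [sin_sq]; ring]
    ring
  rw [binOf, hsin, hcount]
  norm_num

theorem abs_sub_zeroAngle (n j : ℕ) (hn : n ≠ 0) (θ : ℝ) :
    θ - ChebyshevSum.zeroAngle n j = (n * θ - (j + 1 / 2) * π) / n := by
  have : (n : ℝ) ≠ 0 := by exact_mod_cast hn
  rw [ChebyshevSum.zeroAngle]
  field_simp

theorem cos_eq_sin_sub (ψ : ℝ) (j : ℕ) : cos ψ ^ 2 = sin (ψ - (j + 1 / 2) * π) ^ 2 := by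
  have h : ψ - (j + 1 / 2) * π = ψ - π / 2 - j * π := by ring
  rw [h, sin_sub_nat_mul_pi, sin_sub_pi_div_two, mul_pow, ← pow_mul, mul_comm j 2, pow_mul]
  simp

/-- The points of bin `j` are close to the `j`-th zero of the Chebyshev polynomial. -/
theorem angle_of_binOf_eq {d : ℕ} {θ : ℝ} (hθ : 0 < θ) (hθ' : θ < π)
    (h : ∀ k, 1 ≤ k → k ≤ d + 1 → sin (k * θ) ≠ 0) {j : ℕ} (hj : binOf d (cos θ) = j) :
    θ ∈ Set.Icc (j * π / (d + 1)) ((j + 1) * π / (d + 1)) ∧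
      |θ - ChebyshevSum.zeroAngle (d + 1) j| ≤ π / 2000 / (d + 1) := by
  have hd : (0 : ℝ) < d + 1 := by positivity
  have hπ := pi_pos
  rw [binOf_cos hθ hθ' h] at hj
  split_ifs at hj with hs
  -- A rejected point has bin number -1, which is not a natural number.
  · have : (0 : ℝ) ≤ j := by positivity
    linarith
  · have hfl : ⌊((d + 1 : ℕ) : ℝ) * θ / π⌋ = j := by exact_mod_cast hj
    rw [Int.floor_eq_iff, le_div_iff₀ pi_pos, div_lt_iff₀ pi_pos] at hfl
    push_cast at hfl hs
    obtain ⟨h1, h2⟩ := hfl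
    refine ⟨⟨?_, ?_⟩, ?_⟩
    · rw [div_le_iff₀ hd]; linarith
    · rw [le_div_iff₀ hd]; linarith
    · rw [abs_sub_zeroAngle _ _ (by omega)]
      push_cast
      rw [abs_div, abs_of_pos hd]
      gcongr
      set ψ := ((d : ℝ) + 1) * θ - (j + 1 / 2) * π with hψ
      have hψ1 : |ψ| ≤ π / 2 := abs_le.2 ⟨by linarith, by linarith⟩
      -- The threshold 999999/1000000 is 1 - (1/1000)².
      have hc : sin ψ ^ 2 ≤ (1 / 1000) ^ 2 := by
        rw [hψ, ← cos_eq_sin_sub, cos_sq']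
        linarith
      have hc2 : |sin ψ| ≤ 1 / 1000 := abs_le_of_sq_le_sq hc (by norm_num)
      -- Jordan's inequality turns |sin ψ| ≤ 1/1000 into |ψ| ≤ π/2000.
      have := mul_abs_le_abs_sin hψ1
      have h3 : 2 / π * |ψ| ≤ 1 / 1000 := this.trans hc2
      rw [div_mul_eq_mul_div, div_le_iff₀ pi_pos] at h3
      linarith

/-- Points close to the `j`-th zero of the Chebyshev polynomial are in bin `j`. -/
theorem binOf_eq_of_angle {d : ℕ} {θ : ℝ} (hθ : 0 < θ) (hθ' : θ < π)
    (h : ∀ k, 1 ≤ k → k ≤ d + 1 → sin (k * θ) ≠ 0) {j : ℕ}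
    (hj : |θ - ChebyshevSum.zeroAngle (d + 1) j| ≤ 1 / 1000 / (d + 1)) :
    binOf d (cos θ) = j := by
  have hd : (0 : ℝ) < d + 1 := by positivity
  have hπ := pi_gt_three
  rw [abs_sub_zeroAngle _ _ (by omega)] at hj
  push_cast at hj
  rw [abs_div, abs_of_pos hd, div_le_div_iff_of_pos_right hd] at hj
  rw [binOf_cos hθ hθ' h]
  have hs : ¬ sin (((d + 1 : ℕ) : ℝ) * θ) ^ 2 < 999999 / 1000000 := by
    have h1 := cos_eq_sin_sub (((d + 1 : ℕ) : ℝ) * θ) j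
    have h2 := (abs_sin_le_abs (x := ((d + 1 : ℕ) : ℝ) * θ - (j + 1 / 2) * π)).trans
      (by push_cast; exact hj)
    have h3 : sin (((d + 1 : ℕ) : ℝ) * θ - (j + 1 / 2) * π) ^ 2 ≤ (1 / 1000) ^ 2 := by
      rw [← sq_abs]; gcongr
    rw [← h1, cos_sq'] at h3
    rw [not_lt]
    linarith
  rw [if_neg hs]
  have hfl : ⌊((d + 1 : ℕ) : ℝ) * θ / π⌋ = j := by
    rw [Int.floor_eq_iff, le_div_iff₀ pi_pos, div_lt_iff₀ pi_pos]
    have := abs_le.1 hj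
    push_cast
    constructor <;> linarith
  rw [hfl]; simp

end Bins

/-! ### Convergence -/

section Convergence

open Finset

/-- The Euclidean norm of the first `n` entries. -/
noncomputable def l2 (n : ℕ) (v : ℕ → ℝ) : ℝ := √(∑ j ∈ range n, v j ^ 2)

theorem l2_nonneg (n : ℕ) (v : ℕ → ℝ) : 0 ≤ l2 n v := Real.sqrt_nonneg _

theorem l2_sq (n : ℕ) (v : ℕ → ℝ) : l2 n v ^ 2 = ∑ j ∈ range n, v j ^ 2 :=
  Real.sq_sqrt (sum_nonneg fun _ _ => sq_nonneg _)

theorem l2_add_le (n : ℕ) (u v : ℕ → ℝ) : l2 n (fun j => u j + v j) ≤ l2 n u + l2 n v := by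
  refine Real.sqrt_le_iff.2 ⟨add_nonneg (l2_nonneg _ _) (l2_nonneg _ _), ?_⟩
  have h := Real.sum_mul_le_sqrt_mul_sqrt (range n) u v
  have h1 := l2_sq n u
  have h2 := l2_sq n v
  calc ∑ j ∈ range n, (u j + v j) ^ 2
      = ∑ j ∈ range n, u j ^ 2 + 2 * ∑ j ∈ range n, u j * v j + ∑ j ∈ range n, v j ^ 2 := by
        rw [mul_sum, ← sum_add_distrib, ← sum_add_distrib]
        exact sum_congr rfl fun _ _ => by ring
    _ ≤ l2 n u ^ 2 + 2 * (l2 n u * l2 n v) + l2 n v ^ 2 := by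
        rw [h1, h2]; unfold l2; linarith
    _ = _ := by ring

theorem l2_mono {n : ℕ} {u v : ℕ → ℝ} (h : ∀ j < n, |u j| ≤ |v j|) : l2 n u ≤ l2 n v :=
  Real.sqrt_le_sqrt (sum_le_sum fun j hj => sq_le_sq.2 (h j (mem_range.1 hj)))

theorem l2_const (n : ℕ) {c : ℝ} (hc : 0 ≤ c) : l2 n (fun _ => c) = √n * c := by
  rw [l2, sum_const, card_range, nsmul_eq_mul, Real.sqrt_mul (by positivity), Real.sqrt_sq hc]

theorem abs_le_l2 {n : ℕ} (v : ℕ → ℝ) {j : ℕ} (hj : j < n) : |v j| ≤ l2 n v := by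
  refine Real.abs_le_sqrt ?_
  exact single_le_sum (f := fun j => v j ^ 2) (fun _ _ => sq_nonneg _) (mem_range.2 hj)

/-! ### Data-independent number of steps -/

/-- A sequence of selections from `N` values whose norms contract down to the level `D` reaches
this level after a number of steps that does not depend on the values. -/
theorem l2_le_of_contraction {n N : ℕ} (hn : 1 ≤ n) (hnN : n ≤ N) (e : ℕ → ℝ) (s : ℕ → ℕ → ℕ)
    {D : ℝ} (hD : 0 ≤ D) (hs : ∀ t ≤ N * N, ∀ j < n, s t j < N)
    (hstep : ∀ t < N * N, l2 n (fun j => e (s (t + 1) j)) ≤ D + l2 n (fun j => e (s t j)) / 9) :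
    l2 n (fun j => e (s (N * N) j)) ≤ 3 * D := by
  by_contra hcon
  rw [not_le] at hcon
  set E : ℕ → ℝ := fun t => l2 n (fun j => e (s t j)) with hE
  have hE0 : ∀ t, 0 ≤ E t := fun t => l2_nonneg _ _
  -- Once at most 3D, the norm stays there, since D + 3D/9 ≤ 3D. So a final norm above 3D forces all
  -- earlier norms above 3D.
  have hbig : ∀ k ≤ N * N, 3 * D < E (N * N - k) := by
    intro k
    induction k with
    | zero => intro _; exact hcon
    | succ k ih =>
      intro hk
      by_contra h
      rw [not_lt] at h
      have h1 := hstep (N * N - (k + 1)) (by omega)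
      rw [show N * N - (k + 1) + 1 = N * N - k by omega] at h1
      have h2 := ih (by omega)
      change E (N * N - k) ≤ D + E (N * N - (k + 1)) / 9 at h1
      have := hE0 (N * N - (k + 1))
      linarith
  -- Above the level 3D, the term D is less than a third of the norm, and 1/3 + 1/9 < 1/2.
  have hhalf : ∀ t < N * N, E (t + 1) ≤ E t / 2 := fun t ht => by
    have h1 : E (t + 1) ≤ D + E t / 9 := hstep t ht
    have h2 := hbig (N * N - t) (by omega)
    rw [show N * N - (N * N - t) = t by omega] at h2
    have := hE0 t
    linarith
  have hpow : ∀ k t, t + k ≤ N * N → E (t + k) ≤ E t / 2 ^ k := fun k t => by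
    induction k with
    | zero => intro _; simp
    | succ k ih =>
      intro hk
      have h1 := hhalf (t + k) (by omega)
      have h2 := ih (by omega)
      rw [pow_succ, ← div_div]
      calc E (t + (k + 1)) ≤ E (t + k) / 2 := h1
        _ ≤ _ := by gcongr
  have hpos : ∀ t ≤ N * N, 0 < E t := fun t ht => by
    have h2 := hbig (N * N - t) (by omega)
    rw [show N * N - (N * N - t) = t by omega] at h2
    linarith
  choose! p hp using fun t => (range n).exists_max_image (fun j => |e (s t j)|)
    ⟨0, mem_range.2 (by omega)⟩
  set M : ℕ → ℝ := fun t => |e (s t (p t))| with hM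
  have hME : ∀ t, M t ≤ E t := fun t => abs_le_l2 (fun j => e (s t j)) (mem_range.1 (hp t).1)
  have hEM : ∀ t, E t ≤ √n * M t := fun t => by
    rw [← l2_const n (abs_nonneg _)]
    refine l2_mono fun j hj => ?_
    rw [abs_abs]
    exact (hp t).2 j (mem_range.2 hj)
  -- N halvings outweigh the factor √n < 2^N lost between the maximum and the Euclidean norm.
  have hlt : ∀ t, t + N ≤ N * N → M (t + N) < M t := fun t ht => by
    have h1 := hpow N t ht
    have h2 := hEM t
    have h3 := hpos t (by omega)
    have hM0 : 0 < M t := by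
      by_contra h
      have : M t = 0 := le_antisymm (not_lt.1 h) (abs_nonneg _)
      rw [this, mul_zero] at h2
      linarith
    have h4 : √(n : ℝ) < 2 ^ N := by
      have h5 : √(n : ℝ) ≤ n := by
        rw [Real.sqrt_le_left (by positivity)]
        have : (1 : ℝ) ≤ n := by exact_mod_cast hn
        nlinarith
      have h6 : (n : ℝ) ≤ N := by exact_mod_cast hnN
      have h7 : (N : ℝ) < 2 ^ N := by exact_mod_cast Nat.lt_two_pow_self
      linarith
    calc M (t + N) ≤ E (t + N) := hME _
      _ ≤ E t / 2 ^ N := h1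
      _ ≤ √n * M t / 2 ^ N := by gcongr
      _ < M t := by
        rw [div_lt_iff₀ (by positivity), mul_comm]
        gcongr
  have hanti : ∀ k l, k < l → l ≤ N → M (l * N) < M (k * N) := by
    intro k l hkl
    induction l, hkl using Nat.le_induction with
    | base =>
      intro hl
      rw [Nat.succ_mul]
      exact hlt _ (by rw [← Nat.succ_mul]; exact Nat.mul_le_mul_right _ hl)
    | succ l hl ih =>
      intro hl'
      refine lt_trans ?_ (ih (by omega))
      rw [Nat.succ_mul]
      exact hlt _ (by rw [← Nat.succ_mul]; exact Nat.mul_le_mul_right _ hl')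
  -- The maxima at the N + 1 times 0, N, …, N² are strictly decreasing, but each is attained at one
  -- of N indices.
  obtain ⟨k, hk, l, hl, hkl, heq⟩ := exists_ne_map_eq_of_card_lt_of_maps_to
    (s := range (N + 1)) (t := range N) (by simp) (f := fun k => s (k * N) (p (k * N)))
    (fun k hk => mem_range.2 (hs _ (Nat.mul_le_mul_right _ (Nat.lt_succ_iff.1 (mem_range.1 hk))) _
      (mem_range.1 (hp _).1)))
  have hMeq : M (k * N) = M (l * N) := by
    simp only [hM]
    rw [show s (k * N) (p (k * N)) = s (l * N) (p (l * N)) from heq]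
  rcases lt_or_gt_of_ne hkl with h | h
  · exact absurd hMeq (hanti k l h (Nat.lt_succ_iff.1 (mem_range.1 hl))).ne'
  · exact absurd hMeq (hanti l k h (Nat.lt_succ_iff.1 (mem_range.1 hk))).ne

/-- The test for a positive squared difference of nodes stands in for i ≠ j, which is equivalent for
distinct nodes. -/
theorem lagrangeEval_eq {n : ℕ} {X : ℕ → ℝ} (hX : Set.InjOn X (range n)) (Y : ℕ → ℝ) (z : ℝ) :
    lagrangeEval n X Y z = (Lagrange.interpolate (range n) X Y).eval z := by
  classical
  rw [Lagrange.interpolate_apply, Polynomial.eval_finsetSum, lagrangeEval]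
  refine sum_congr rfl fun j hj => ?_
  rw [Polynomial.eval_mul, Polynomial.eval_C, Lagrange.basis, Polynomial.eval_prod,
    ← mul_prod_erase _ _ hj]
  congr 1
  rw [if_neg (by simp), one_mul]
  refine prod_congr rfl fun i hi => ?_
  have hne : X i - X j ≠ 0 := fun h => (ne_of_mem_erase hi)
    (hX (mem_of_mem_erase hi) hj (sub_eq_zero.1 h))
  rw [if_pos (mul_self_pos.2 hne), Lagrange.basisDivisor]
  simp [div_eq_inv_mul]

/-! ### Contraction of the median step on good data -/

variable {d N : ℕ} {x y bin θ : ℕ → ℝ} {P : ℝ[X]} {Δ δ : ℝ}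

/-- Data for which each bin contains a majority of points that are not outliers. -/
structure IsGoodData (d N : ℕ) (x y bin θ : ℕ → ℝ) (P : ℝ[X]) (Δ δ : ℝ) : Prop where
  bin_eq : ∀ i < N, bin i = binOf d (2 * x i / Δ - 1)
  x_eq : ∀ i < N, x i = Δ / 2 * (Real.cos (θ i) + 1)
  angle : ∀ i < N, ∀ j < d + 1, bin i = (j : ℕ) →
    θ i ∈ Set.Icc (j * Real.pi / (d + 1)) ((j + 1) * Real.pi / (d + 1)) ∧
      |θ i - ChebyshevSum.zeroAngle (d + 1) j| ≤ Real.pi / 2000 / (d + 1)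
  majority : open Classical in ∀ j < d + 1,
    2 * {i ∈ range N | bin i = (j : ℕ) ∧ δ ≤ |y i - P.eval (x i)|}.card <
      {i ∈ range N | bin i = (j : ℕ)}.card

/-- The nodes `X j` and values `Y j` are those of the data points `s j` in the bins `j`. -/
def IsSelection (d N : ℕ) (x y bin X Y : ℕ → ℝ) (s : ℕ → ℕ) : Prop :=
  ∀ j < d + 1, s j < N ∧ bin (s j) = j ∧ X j = x (s j) ∧ Y j = y (s j)

/-- Nothing is required of `X` and `Y`: after one step, any initial contents of the arrays have been
replaced by data points. -/
theorem IsMedianStep.exists_selection {X Y X' Y' : ℕ → ℝ}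
    (h : IsMedianStep (d + 1) N x y bin X Y X' Y') :
    ∃ s, IsSelection d N x y bin X' Y' s := by
  choose! s hs using h
  exact ⟨s, fun j hj => ⟨(hs j hj).1, (hs j hj).2.1, (hs j hj).2.2.1, (hs j hj).2.2.2.1⟩⟩

theorem zeroAngle_mem (d j : ℕ) : ChebyshevSum.zeroAngle (d + 1) j ∈
    Set.Icc (j * Real.pi / (d + 1)) ((j + 1) * Real.pi / (d + 1)) := by
  have hd : (0 : ℝ) < d + 1 := by positivity
  have hπ := Real.pi_pos
  rw [ChebyshevSum.zeroAngle]
  push_cast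
  constructor
  · rw [div_le_iff₀ hd]; field_simp; linarith
  · rw [le_div_iff₀ hd]; field_simp; linarith

/-- The norm of the values at the zeros of the Chebyshev polynomial. -/
noncomputable def nodeNorm (d : ℕ) (a : ℕ → ℝ) : ℝ :=
  l2 (d + 1) fun j => ChebyshevSum.trig d a (ChebyshevSum.zeroAngle (d + 1) j)

theorem nodeNorm_sq (d : ℕ) (a : ℕ → ℝ) :
    nodeNorm d a ^ 2 = (d + 1) * ChebyshevSum.normSq d a := by
  rw [nodeNorm, l2_sq, ChebyshevSum.sum_trig_zeroAngle_sq]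

/-- Two points of a bin differ by at most π/(1000(d+1)), so the squared norm is at most
(π²/1000)(d²/(d+1)) `normSq d a`. With π² ≤ 10 this is at most a hundredth of (d+1) `normSq d a`;
the width of the bins is chosen for this. -/
theorem l2_osc_le (a : ℕ → ℝ) {u v : ℕ → ℝ}
    (hu : ∀ j < d + 1, u j ∈ Set.Icc (j * Real.pi / (d + 1)) ((j + 1) * Real.pi / (d + 1)) ∧
      |u j - ChebyshevSum.zeroAngle (d + 1) j| ≤ Real.pi / 2000 / (d + 1))
    (hv : ∀ j < d + 1, v j ∈ Set.Icc (j * Real.pi / (d + 1)) ((j + 1) * Real.pi / (d + 1)) ∧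
      |v j - ChebyshevSum.zeroAngle (d + 1) j| ≤ Real.pi / 2000 / (d + 1)) :
    l2 (d + 1) (fun j => ChebyshevSum.trig d a (u j) - ChebyshevSum.trig d a (v j)) ≤
      nodeNorm d a / 10 := by
  have hd : (0 : ℝ) < d + 1 := by positivity
  have hN : 0 ≤ nodeNorm d a := l2_nonneg _ _
  refine Real.sqrt_le_iff.2 ⟨by positivity, ?_⟩
  have h := ChebyshevSum.sum_sq_sub_le a (δ := Real.pi / 1000 / (d + 1)) (by positivity)
    (fun j hj => (hu j hj).1) (fun j hj => (hv j hj).1) fun j hj => by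
      have h1 := abs_sub_le (u j) (ChebyshevSum.zeroAngle (d + 1) j) (v j)
      have h2 := (hu j hj).2
      have h3 := (hv j hj).2
      rw [abs_sub_comm] at h3
      have : Real.pi / 1000 / ((d : ℝ) + 1) =
        Real.pi / 2000 / (d + 1) + Real.pi / 2000 / (d + 1) := by ring
      linarith
  refine h.trans ?_
  rw [div_pow, nodeNorm_sq]
  have hn := ChebyshevSum.normSq_nonneg d a
  have hπ : Real.pi * Real.pi ≤ 10 := by
    have h1 := Real.pi_lt_d2
    have h2 := Real.pi_pos
    nlinarith
  calc Real.pi / 1000 / (d + 1) * (Real.pi * d ^ 2 * ChebyshevSum.normSq d a)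
      = (Real.pi * Real.pi) / 1000 * (d ^ 2 / (d + 1)) * ChebyshevSum.normSq d a := by ring
    _ ≤ 10 / 1000 * (d + 1) * ChebyshevSum.normSq d a := by
        have : (d : ℝ) ^ 2 / (d + 1) ≤ d + 1 := by
          rw [div_le_iff₀ hd]; nlinarith
        gcongr
    _ = _ := by ring

theorem IsGoodData.zeroAngle_close (j : ℕ) :
    ChebyshevSum.zeroAngle (d + 1) j ∈
        Set.Icc (j * Real.pi / (d + 1)) ((j + 1) * Real.pi / (d + 1)) ∧
      |ChebyshevSum.zeroAngle (d + 1) j - ChebyshevSum.zeroAngle (d + 1) j| ≤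
        Real.pi / 2000 / (d + 1) :=
  ⟨zeroAngle_mem d j, by rw [sub_self, abs_zero]; positivity⟩

/-- The difference between `P` and the interpolation polynomial of a selection of data points. -/
theorem IsGoodData.exists_expansion (hg : IsGoodData d N x y bin θ P Δ δ) (hP : P.natDegree ≤ d)
    {X Y : ℕ → ℝ} {s : ℕ → ℕ} (hs : IsSelection d N x y bin X Y s) :
    ∃ a : ℕ → ℝ,
      (∀ t, P.eval (Δ / 2 * (t + 1)) - lagrangeEval (d + 1) X Y (Δ / 2 * (t + 1)) =
        (∑ k ∈ range (d + 1), a k • Polynomial.Chebyshev.T ℝ (k : ℤ)).eval t) ∧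
      nodeNorm d a ≤ 10 / 9 * l2 (d + 1) (fun j => y (s j) - P.eval (x (s j))) := by
  -- The nodes are distinct because they lie in different bins.
  have hinj : Set.InjOn X (range (d + 1)) := by
    intro j hj k hk hjk
    have hj := mem_range.1 hj
    have hk := mem_range.1 hk
    rw [(hs j hj).2.2.1, (hs k hk).2.2.1] at hjk
    have h1 := hg.bin_eq _ (hs j hj).1
    have h2 := hg.bin_eq _ (hs k hk).1
    rw [hjk, ← h2, (hs j hj).2.1, (hs k hk).2.1] at h1
    exact_mod_cast h1
  set Q := Lagrange.interpolate (range (d + 1)) X Y with hQ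
  have hQdeg : Q.natDegree ≤ d := by
    have := Lagrange.degree_interpolate_lt Y hinj
    rw [card_range] at this
    exact Polynomial.natDegree_le_of_degree_le (Order.le_of_lt_succ (by exact_mod_cast this))
  set L : ℝ[X] := Polynomial.C (Δ / 2) * (Polynomial.X + 1) with hL
  have hLdeg : L.natDegree ≤ 1 := by
    rw [hL]
    refine (Polynomial.natDegree_C_mul_le _ _).trans ?_
    exact (Polynomial.natDegree_add_le _ _).trans (by simp)
  have hFdeg : ((P - Q).comp L).natDegree ≤ d := by
    refine Polynomial.natDegree_comp_le.trans ?_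
    have h1 : (P - Q).natDegree ≤ d :=
      (Polynomial.natDegree_sub_le _ _).trans (max_le hP hQdeg)
    calc _ ≤ d * 1 := Nat.mul_le_mul h1 hLdeg
      _ = d := mul_one d
  obtain ⟨a, ha⟩ := ChebyshevSum.exists_expansion hFdeg
  have hval : ∀ t, P.eval (Δ / 2 * (t + 1)) - lagrangeEval (d + 1) X Y (Δ / 2 * (t + 1)) =
      (∑ k ∈ range (d + 1), a k • Polynomial.Chebyshev.T ℝ (k : ℤ)).eval t := fun t => by
    rw [← ha, lagrangeEval_eq hinj, ← hQ]
    simp only [Polynomial.eval_comp, Polynomial.eval_sub, hL, Polynomial.eval_mul,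
      Polynomial.eval_C, Polynomial.eval_add, Polynomial.eval_X, Polynomial.eval_one]
  refine ⟨a, hval, ?_⟩
  -- At a node the interpolation polynomial equals the data value, so P - Q is the error of the data
  -- point up to sign.
  have hsel : ∀ j < d + 1, |ChebyshevSum.trig d a (θ (s j))| = |y (s j) - P.eval (x (s j))| :=
    fun j hj => by
      obtain ⟨h1, h2, h3, h4⟩ := hs j hj
      rw [← ChebyshevSum.eval_cos, ← hval, ← hg.x_eq _ h1, lagrangeEval_eq hinj, ← h3,
        Lagrange.eval_interpolate_at_node _ hinj (mem_range.2 hj), h4, abs_sub_comm]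
  have hosc := l2_osc_le a (d := d) (u := ChebyshevSum.zeroAngle (d + 1)) (v := fun j => θ (s j))
    (fun j _ => IsGoodData.zeroAngle_close j)
    (fun j hj => hg.angle _ (hs j hj).1 j hj (hs j hj).2.1)
  -- Moving from the selected points to the zeros costs a tenth of `nodeNorm d a`, which is absorbed
  -- on the left: this is the factor 10/9.
  have htri := l2_add_le (d + 1) (fun j => ChebyshevSum.trig d a (θ (s j))) (fun j =>
    ChebyshevSum.trig d a (ChebyshevSum.zeroAngle (d + 1) j) - ChebyshevSum.trig d a (θ (s j)))
  simp only [add_sub_cancel] at htri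
  have he : l2 (d + 1) (fun j => ChebyshevSum.trig d a (θ (s j))) ≤
      l2 (d + 1) (fun j => y (s j) - P.eval (x (s j))) := l2_mono fun j hj => (hsel j hj).le
  change nodeNorm d a ≤ _ at htri
  linarith

/-- In each bin, a set of more than half of the points contains a point that is not an outlier. -/
theorem IsGoodData.exists_inlier (hg : IsGoodData d N x y bin θ P Δ δ) {j : ℕ} (hj : j < d + 1)
    (p : ℕ → Prop) [DecidablePred p]
    (hp : 2 * {k ∈ range N | p k ∧ bin k = j}.card ≤ {k ∈ range N | bin k = j}.card) :
    ∃ w < N, bin w = j ∧ ¬ p w ∧ |y w - P.eval (x w)| ≤ δ := by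
  classical
  by_contra! hcon
  have hm := hg.majority j hj
  -- Otherwise the points satisfying `p`, at most half of the bin, and the outliers, fewer than
  -- half, would cover the bin.
  have hsub : ({k ∈ range N | bin k = j} : Finset ℕ) ⊆
      {k ∈ range N | p k ∧ bin k = j} ∪
        {i ∈ range N | bin i = j ∧ δ ≤ |y i - P.eval (x i)|} := fun w hw => by
    rw [mem_filter, mem_range] at hw
    rw [mem_union, mem_filter, mem_filter, mem_range]
    by_cases h : p w
    · exact Or.inl ⟨hw.1, h, hw.2⟩
    · exact Or.inr ⟨hw.1, hw.2, (hcon w hw.1 hw.2 h).le⟩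
  have h1 := (card_le_card hsub).trans (card_union_le _ _)
  have hp' : 2 * ({k ∈ range N | p k ∧ bin k = j} : Finset ℕ).card ≤
    ({k ∈ range N | bin k = j} : Finset ℕ).card := by convert hp
  have hm' : 2 * ({i ∈ range N | bin i = j ∧ δ ≤ |y i - P.eval (x i)|} : Finset ℕ).card <
    ({k ∈ range N | bin k = j} : Finset ℕ).card := by convert hm
  omega

/-- With g = P - Q, the residual is (y - P(x)) + g. At most half of the residuals of a bin lie below
the median, so some inlier w has a residual at least as large, and y - P(x) at the median point is
at most δ + g(w) - g there; the lower bound is symmetric. The oscillations of g amount to a tenth of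
`nodeNorm d a`, hence to a ninth of the old error. -/
theorem IsGoodData.step (hg : IsGoodData d N x y bin θ P Δ δ) (hP : P.natDegree ≤ d) (hδ : 0 ≤ δ)
    {X Y X' Y' : ℕ → ℝ} {s s' : ℕ → ℕ} (hs : IsSelection d N x y bin X Y s)
    (hstep : IsMedianStep (d + 1) N x y bin X Y X' Y') (hs' : IsSelection d N x y bin X' Y' s') :
    l2 (d + 1) (fun j => y (s' j) - P.eval (x (s' j))) ≤
      √(d + 1) * δ + l2 (d + 1) (fun j => y (s j) - P.eval (x (s j))) / 9 := by
  classical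
  obtain ⟨a, ha, hnode⟩ := hg.exists_expansion hP hs
  have hr : ∀ k < N, y k - lagrangeEval (d + 1) X Y (x k) =
      y k - P.eval (x k) + ChebyshevSum.trig d a (θ k) := fun k hk => by
    rw [← ChebyshevSum.eval_cos, ← ha, ← hg.x_eq k hk]
    ring
  have key : ∀ j < d + 1, ∃ i < N, ∃ w < N, bin i = j ∧ bin w = j ∧
      |y (s' j) - P.eval (x (s' j))| ≤
        δ + |ChebyshevSum.trig d a (θ w) - ChebyshevSum.trig d a (θ i)| := fun j hj => by
    obtain ⟨i, hi, hbi, hX, hY, hlo, hhi⟩ := hstep j hj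
    obtain ⟨w, hw, hbw, hrw, hew⟩ := hg.exists_inlier hj _ hlo
    obtain ⟨v, hv, hbv, hrv, hev⟩ := hg.exists_inlier hj _ hhi
    rw [← (hs' j hj).2.2.1, ← (hs' j hj).2.2.2, hX, hY]
    rw [not_lt, hr i hi, hr _ hw] at hrw
    rw [not_lt, hr i hi, hr _ hv] at hrv
    have h1 := abs_le.1 hew
    have h2 := abs_le.1 hev
    rcases le_total 0 (y i - P.eval (x i)) with h | h
    · refine ⟨i, hi, w, hw, hbi, hbw, ?_⟩
      have := le_abs_self (ChebyshevSum.trig d a (θ w) - ChebyshevSum.trig d a (θ i))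
      rw [abs_of_nonneg h]
      linarith
    · refine ⟨i, hi, v, hv, hbi, hbv, ?_⟩
      have := neg_abs_le (ChebyshevSum.trig d a (θ v) - ChebyshevSum.trig d a (θ i))
      rw [abs_of_nonpos h]
      linarith
  choose! i hi w hw hbi hbw hle using key
  have hosc := l2_osc_le a (d := d) (u := fun j => θ (w j)) (v := fun j => θ (i j))
    (fun j hj => hg.angle _ (hw j hj) j hj (hbw j hj))
    (fun j hj => hg.angle _ (hi j hj) j hj (hbi j hj))
  have hmono : l2 (d + 1) (fun j => y (s' j) - P.eval (x (s' j))) ≤ l2 (d + 1) (fun j => δ +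
      |ChebyshevSum.trig d a (θ (w j)) - ChebyshevSum.trig d a (θ (i j))|) :=
    l2_mono fun j hj => (hle j hj).trans (le_abs_self _)
  have hadd := l2_add_le (d + 1) (fun _ => δ)
    (fun j => |ChebyshevSum.trig d a (θ (w j)) - ChebyshevSum.trig d a (θ (i j))|)
  have habs : l2 (d + 1)
      (fun j => |ChebyshevSum.trig d a (θ (w j)) - ChebyshevSum.trig d a (θ (i j))|) ≤
      l2 (d + 1) (fun j => ChebyshevSum.trig d a (θ (w j)) - ChebyshevSum.trig d a (θ (i j))) :=
    l2_mono fun j _ => (abs_abs _).le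
  rw [l2_const _ hδ] at hadd
  push_cast at hadd
  have hE := l2_nonneg (d + 1) (fun j => y (s j) - P.eval (x (s j)))
  linarith

/-- Iterated median selection and interpolation recovers a polynomial from good data. -/
theorem IsGoodData.abs_sub_le (hg : IsGoodData d N x y bin θ P Δ δ) (hP : P.natDegree ≤ d)
    (hδ : 0 ≤ δ) (hΔ : 0 < Δ) (hΔ1 : Δ < 1) {m : ℝ} (hm : 1 ≤ m) (hN : d + 1 ≤ N)
    {X Y : ℕ → ℕ → ℝ}
    (hstep : ∀ t < N * N + 2, IsMedianStep (d + 1) N x y bin (X t) (Y t) (X (t + 1)) (Y (t + 1))) :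
    |lagrangeEval (d + 1) (X (N * N + 2)) (Y (N * N + 2)) m - P.eval m| ≤
      9 * δ / 4 * ((8 * m) ^ d / Δ ^ d) := by
  -- The selection `s t` belongs to the arrays with index t + 1, as the initial arrays need not
  -- contain data points.
  choose! s hs using fun t ht => (hstep t ht).exists_selection
  set e : ℕ → ℝ := fun i => y i - P.eval (x i) with he
  have hcontr : ∀ t < N * N + 1, l2 (d + 1) (fun j => e (s (t + 1) j)) ≤
      √(d + 1) * δ + l2 (d + 1) (fun j => e (s t j)) / 9 := fun t ht =>
    hg.step hP hδ (hs t (by omega)) (hstep (t + 1) (by omega)) (hs (t + 1) (by omega))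
  have h3 := l2_le_of_contraction (n := d + 1) (N := N) (by omega) hN e s
    (D := √(d + 1) * δ) (by positivity) (fun t ht j hj => (hs t (by omega) j hj).1)
    (fun t ht => hcontr t (by omega))
  -- With D = √(d+1) δ, one more step improves 3D to D + 3D/9 = 4D/3, and 10/9 · 4/3 = 40/27. The
  -- bound 3D alone would give 10/3, more than the required 9/4.
  have h4 := hcontr (N * N) (by omega)
  obtain ⟨a, ha, hnode⟩ := hg.exists_expansion hP (hs (N * N + 1) (by omega))
  change nodeNorm d a ≤ 10 / 9 * l2 (d + 1) (fun j => e (s (N * N + 1) j)) at hnode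
  have hnode' : nodeNorm d a ≤ √(d + 1) * (40 / 27 * δ) := by linarith
  have hn0 : 0 ≤ nodeNorm d a := l2_nonneg _ _
  have hnorm : ChebyshevSum.normSq d a ≤ (40 / 27 * δ) ^ 2 := by
    have h5 : nodeNorm d a ^ 2 ≤ (√(d + 1) * (40 / 27 * δ)) ^ 2 := by gcongr
    rw [nodeNorm_sq, mul_pow, Real.sq_sqrt (by positivity)] at h5
    exact le_of_mul_le_mul_left h5 (by positivity)
  have ht1 : 1 ≤ 2 * m / Δ - 1 := by
    have : 2 ≤ 2 * m / Δ := by rw [le_div_iff₀ hΔ]; linarith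
    linarith
  have hval := ha (2 * m / Δ - 1)
  rw [show Δ / 2 * (2 * m / Δ - 1 + 1) = m by field_simp; ring] at hval
  have hsq := ChebyshevSum.sq_eval_le (d := d) a ht1
  rw [← hval] at hsq
  -- The factor √(2d + 1) is absorbed into 2^d, which turns 4m/Δ into 8m/Δ.
  have h4d : (2 * d + 1 : ℝ) ≤ 4 ^ d := by
    have := one_add_mul_le_pow (a := (3 : ℝ)) (by norm_num) d
    norm_num at this
    have hd : (0 : ℝ) ≤ d := by positivity
    linarith
  have hbase : (2 * (2 * m / Δ - 1)) ^ d ≤ (4 * m / Δ) ^ d := by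
    gcongr
    have : 4 * m / Δ = 2 * (2 * m / Δ) := by ring
    linarith
  have hpos : (0 : ℝ) ≤ (2 * (2 * m / Δ - 1)) ^ d := by
    have : 0 ≤ 2 * m / Δ - 1 := by linarith
    positivity
  rw [abs_sub_comm]
  have hfin : (P.eval m - lagrangeEval (d + 1) (X (N * N + 1 + 1)) (Y (N * N + 1 + 1)) m) ^ 2 ≤
      (40 / 27 * δ * (2 ^ d * (4 * m / Δ) ^ d)) ^ 2 := by
    refine hsq.trans ?_
    calc _ ≤ (4 ^ d : ℝ) * (40 / 27 * δ) ^ 2 * ((4 * m / Δ) ^ d) ^ 2 := by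
          have := ChebyshevSum.normSq_nonneg d a
          gcongr
      _ = _ := by
        rw [show (4 : ℝ) = 2 ^ 2 by norm_num, ← pow_mul, mul_comm 2 d, pow_mul]
        ring
  have hm0 : 0 < m := by linarith
  refine (abs_le_of_sq_le_sq hfin (by positivity)).trans ?_
  have hpow : (2 : ℝ) ^ d * (4 * m / Δ) ^ d = (8 * m) ^ d / Δ ^ d := by
    rw [← mul_pow, ← div_pow]
    congr 1
    ring
  rw [hpow]
  have : 40 / 27 * δ ≤ 9 * δ / 4 := by linarith
  gcongr

end Convergence

/-! ### Random data -/

section RandomData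

open Finset Real

theorem measurable_chebQuot (k : ℕ) : Measurable fun t => chebQuot t k := by
  induction k with
  | zero => exact measurable_id.const_mul 2
  | succ k ih => exact (measurable_id.const_mul 2).sub (ih.const_div 1)

theorem measurable_binOf (d : ℕ) : Measurable (binOf d) := by
  classical
  have h1 : Measurable fun t => ∏ k ∈ range d, chebQuot t k :=
    Finset.measurable_fun_prod _ fun k _ => measurable_chebQuot k
  have h2 : Measurable fun t => ∑ k ∈ range d, if chebQuot t k < 0 then (1 : ℝ) else 0 :=
    Finset.measurable_fun_sum _ fun k _ => Measurable.ite
      (measurableSet_lt (measurable_chebQuot k) measurable_const) measurable_const measurable_const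
  refine Measurable.ite (measurableSet_lt ?_ measurable_const) measurable_const h2
  exact (measurable_const.sub (measurable_id.mul measurable_id)).mul (h1.mul h1)

/-- The angles at which some `sin (k θ)` vanishes. -/
def sinZeros : Set ℝ := Set.range fun p : ℕ × ℤ => p.2 * π / p.1

theorem countable_sinZeros : sinZeros.Countable := Set.countable_range _

theorem sin_ne_zero_of_notMem {θ : ℝ} (h : θ ∉ sinZeros) {k : ℕ} (hk : 1 ≤ k) :
    sin (k * θ) ≠ 0 := fun h0 => h <| by
  obtain ⟨j, hj⟩ := sin_eq_zero_iff.1 h0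
  have : (k : ℝ) ≠ 0 := by positivity
  exact ⟨(k, j), by simp only [hj]; field_simp⟩

/-- The law is absolutely continuous and the exceptional angles are countable. Off this null set, no
division by zero occurs in computing the bin. -/
theorem ae_chebyshevDistribution : ∀ᵐ t ∂chebyshevDistribution,
    t ∈ Set.Ioo (-1) 1 ∧ arccos t ∉ sinZeros := by
  have hac : chebyshevDistribution ≪ volume.restrict (Set.Ioc (-1) 1) := by
    refine Measure.AbsolutelyContinuous.smul_left ?_ _
    exact (withDensity_absolutelyContinuous _ _).restrict _
  refine hac.ae_le ((ae_restrict_iff' measurableSet_Ioc).2 ?_)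
  have hc : (cos '' sinZeros).Countable := countable_sinZeros.image _
  filter_upwards [hc.ae_notMem volume, Measure.ae_ne volume 1] with t h1 h2 h3
  refine ⟨⟨h3.1, lt_of_le_of_ne h3.2 h2⟩, fun h4 => h1 ⟨_, h4, cos_arccos h3.1.le h3.2⟩⟩

/-- The Chebyshev distribution is the law of cos θ for θ uniform on [0, π]. -/
theorem measureReal_chebyshevDistribution {B : Set ℝ} (hB : MeasurableSet B) :
    chebyshevDistribution.real B = π⁻¹ * volume.real (cos ⁻¹' B ∩ Set.Ioc 0 π) := by
  have h1 : Polynomial.Chebyshev.measureT.real B = volume.real (cos ⁻¹' B ∩ Set.Ioc 0 π) := by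
    rw [← integral_indicator_one hB, Polynomial.Chebyshev.integral_measureT_eq_integral_cos,
      intervalIntegral.integral_of_le pi_pos.le]
    have : (fun θ => B.indicator (1 : ℝ → ℝ) (cos θ)) = (cos ⁻¹' B).indicator 1 := rfl
    rw [this, integral_indicator_one (measurable_cos hB), measureReal_restrict_apply
      (measurable_cos hB)]
  rw [chebyshevDistribution, measureReal_ennreal_smul_apply, h1, ENNReal.toReal_inv,
    ENNReal.toReal_ofReal pi_pos.le]

theorem zeroAngle_sub_pos {d j : ℕ} : 0 < ChebyshevSum.zeroAngle (d + 1) j - 1 / 1000 / (d + 1) := by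
  have hd : (0 : ℝ) < d + 1 := by positivity
  have hj : (0 : ℝ) ≤ j := by positivity
  have h3 := pi_gt_three
  rw [ChebyshevSum.zeroAngle, sub_pos, div_lt_iff₀ hd]
  push_cast
  rw [div_mul_eq_mul_div, div_mul_eq_mul_div, lt_div_iff₀ (by positivity)]
  nlinarith [mul_nonneg hj hd.le, mul_nonneg (mul_nonneg hj hd.le) pi_pos.le]

theorem zeroAngle_add_lt {d j : ℕ} (hj : j < d + 1) :
    ChebyshevSum.zeroAngle (d + 1) j + 1 / 1000 / (d + 1) < π := by
  have hd : (0 : ℝ) < d + 1 := by positivity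
  have hj : (j : ℝ) ≤ d := by exact_mod_cast Nat.lt_succ_iff.1 hj
  have h3 := pi_gt_three
  rw [ChebyshevSum.zeroAngle]
  push_cast
  rw [show (2 * (j : ℝ) + 1) / (2 * (d + 1)) * π + 1 / 1000 / (d + 1) =
    ((2 * j + 1) * π + 1 / 500) / (2 * (d + 1)) by field_simp; ring, div_lt_iff₀ (by positivity)]
  nlinarith

/-- Each bin has probability at least a constant times `1 / (d + 1)`. -/
theorem le_measureReal_binOf {d j : ℕ} (hj : j < d + 1) :
    1 / 2000 / (d + 1) ≤ chebyshevDistribution.real (binOf d ⁻¹' {(j : ℝ)}) := by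
  have hd : (0 : ℝ) < d + 1 := by positivity
  rw [measureReal_chebyshevDistribution (measurable_binOf d (measurableSet_singleton _))]
  set z := ChebyshevSum.zeroAngle (d + 1) j with hz
  set r : ℝ := 1 / 1000 / (d + 1) with hr
  have hr0 : 0 < r := by positivity
  -- Up to a null set, the bin contains an interval of length 2r around the zero.
  have hsub : Set.Icc (z - r) (z + r) \ sinZeros ⊆
      cos ⁻¹' (binOf d ⁻¹' {(j : ℝ)}) ∩ Set.Ioc 0 π := by
    rintro θ ⟨⟨h1, h2⟩, h3⟩
    have h4 := zeroAngle_sub_pos (d := d) (j := j)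
    have h5 := zeroAngle_add_lt hj
    have h6 : 0 < θ := by linarith
    have h7 : θ < π := by linarith
    exact ⟨binOf_eq_of_angle h6 h7 (fun k hk _ => sin_ne_zero_of_notMem h3 hk)
      (abs_le.2 ⟨by linarith, by linarith⟩), h6, h7.le⟩
  have hvol : volume.real (Set.Icc (z - r) (z + r) \ sinZeros) = 2 * r := by
    rw [measureReal_def, measure_sdiff_null (countable_sinZeros.measure_zero _), Real.volume_Icc,
      ENNReal.toReal_ofReal (by linarith)]
    ring
  have hle := measureReal_mono hsub (measure_ne_top_of_subset Set.inter_subset_right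
    (by rw [Real.volume_Ioc]; exact ENNReal.ofReal_ne_top))
  rw [hvol] at hle
  -- The bound 1/π ≥ 1/4 suffices.
  have h4 := pi_le_four
  calc 1 / 2000 / ((d : ℝ) + 1) = 4⁻¹ * (2 * r) := by rw [hr]; ring
    _ ≤ π⁻¹ * _ := by gcongr

variable {Ω : Type*} [MeasurableSpace Ω] {μ : Measure Ω} {N : ℕ}
  {x y : Fin N → Ω → ℝ} {P : ℝ[X]} {Δ δ η : ℝ}

theorem IsNoisySample.measurableSet_outlier (h : IsNoisySample μ x y P Δ δ η) (i : Fin N) :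
    MeasurableSet {ω | δ ≤ |y i ω - P.eval (x i ω)|} :=
  measurableSet_le measurable_const
    ((h.measurable_y i).sub (P.continuous.measurable.comp (h.measurable_x i))).abs

theorem measurable_rescale (Δ : ℝ) : Measurable fun t : ℝ => 2 * t / Δ - 1 :=
  ((measurable_id.const_mul 2).div_const Δ).sub_const 1

/-- The outliers are at most a fraction `η` of the points of a bin. -/
theorem IsNoisySample.measureReal_outlier_le [IsProbabilityMeasure μ]
    (h : IsNoisySample μ x y P Δ δ η) (i : Fin N) {B : Set ℝ} (hB : MeasurableSet B) :
    μ.real (x i ⁻¹' B ∩ {ω | δ ≤ |y i ω - P.eval (x i ω)|}) ≤ η * μ.real (x i ⁻¹' B) := by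
  set A := {ω | δ ≤ |y i ω - P.eval (x i ω)|} with hA
  have hAm : MeasurableSet A := h.measurableSet_outlier i
  have hm : MeasurableSpace.comap (x i) inferInstance ≤ (inferInstance : MeasurableSpace Ω) :=
    (h.measurable_x i).comap_le
  have hBm : MeasurableSet (x i ⁻¹' B) := h.measurable_x i hB
  have hint : Integrable (A.indicator fun _ => (1 : ℝ)) μ := (integrable_const 1).indicator hAm
  have h1 := setIntegral_condExp (μ := μ) hm hint (s := x i ⁻¹' B) ⟨B, hB, rfl⟩
  have h2 : ∫ ω in x i ⁻¹' B, A.indicator (fun _ => (1 : ℝ)) ω ∂μ = μ.real (x i ⁻¹' B ∩ A) := by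
    rw [setIntegral_indicator hAm, setIntegral_const, smul_eq_mul, mul_one]
  rw [← h2, ← h1]
  calc _ ≤ ∫ ω in x i ⁻¹' B, η ∂μ := by
        refine integral_mono_ae integrable_condExp.integrableOn
          (integrable_const η).integrableOn (ae_restrict_of_ae ?_)
        exact h.outlier i
    _ = _ := by rw [setIntegral_const, smul_eq_mul, mul_comm]

open Classical in
/-- The factor of a data point in the Chernoff bound for a bin. -/
noncomputable def chernoffFactor (d j : ℕ) (Δ : ℝ) (p : ℝ × Prop) : ℝ :=
  if binOf d (2 * p.1 / Δ - 1) = j then if p.2 then 2 else 1 / 2 else 1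

theorem measurable_chernoffFactor (d j : ℕ) (Δ : ℝ) : Measurable (chernoffFactor d j Δ) := by
  classical
  refine Measurable.ite ?_ (Measurable.ite ?_ measurable_const measurable_const) measurable_const
  · exact (measurable_binOf d).comp ((measurable_rescale Δ).comp measurable_fst)
      (measurableSet_singleton (j : ℝ))
  · exact measurable_snd (MeasurableSet.of_discrete (s := {q : Prop | q}))

theorem chernoffFactor_pos (d j : ℕ) (Δ : ℝ) (p : ℝ × Prop) : 0 < chernoffFactor d j Δ p := by
  unfold chernoffFactor
  split_ifs <;> norm_num

/-- If the bin has mass p and its outliers have mass q ≤ ηp, the mean is 1 - p/2 + 3q/2 ≤ 1 - p/8,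
and p ≥ 1/(2000(d+1)). The bound is the same for all η < 1/4, so the sample size does not depend on
η. -/
theorem IsNoisySample.integral_chernoffFactor_le [IsProbabilityMeasure μ]
    (h : IsNoisySample μ x y P Δ δ η) (hη : η < 1 / 4) {d j : ℕ} (hj : j < d + 1) (i : Fin N) :
    ∫ ω, chernoffFactor d j Δ (x i ω, δ ≤ |y i ω - P.eval (x i ω)|) ∂μ ≤
      1 - 1 / 16000 / (d + 1) := by
  classical
  set A := {ω | δ ≤ |y i ω - P.eval (x i ω)|} with hA
  have hAm : MeasurableSet A := h.measurableSet_outlier i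
  set B : Set ℝ := (fun t => binOf d (2 * t / Δ - 1)) ⁻¹' {(j : ℝ)} with hB
  have hBm : MeasurableSet B :=
    ((measurable_binOf d).comp (measurable_rescale Δ)) (measurableSet_singleton _)
  have hCm : MeasurableSet (x i ⁻¹' B) := h.measurable_x i hBm
  have hdec : ∀ ω, chernoffFactor d j Δ (x i ω, δ ≤ |y i ω - P.eval (x i ω)|) =
      1 - (x i ⁻¹' B).indicator (fun _ => (1 / 2 : ℝ)) ω +
        (x i ⁻¹' B ∩ A).indicator (fun _ => (3 / 2 : ℝ)) ω := fun ω => by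
    by_cases h1 : binOf d (2 * x i ω / Δ - 1) = j <;>
      by_cases h2 : δ ≤ |y i ω - P.eval (x i ω)| <;>
      simp only [chernoffFactor, Set.indicator, Set.mem_inter_iff, Set.mem_preimage, hB, hA,
        Set.mem_singleton_iff, Set.mem_ofPred_eq, h1, h2, if_true, if_false, and_true, and_false] <;>
      norm_num
  have hsub : Integrable (fun ω => 1 - (x i ⁻¹' B).indicator (fun _ => (1 / 2 : ℝ)) ω) μ :=
    (integrable_const _).sub ((integrable_const _).indicator hCm)
  simp_rw [hdec]
  rw [integral_add hsub ((integrable_const _).indicator (hCm.inter hAm)),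
    integral_sub (integrable_const _) ((integrable_const _).indicator hCm),
    integral_indicator_const _ hCm, integral_indicator_const _ (hCm.inter hAm), integral_const]
  have hp : 1 / 2000 / ((d : ℝ) + 1) ≤ μ.real (x i ⁻¹' B) := by
    refine (le_measureReal_binOf hj).trans_eq ?_
    have hm : Measurable fun ω => 2 * x i ω / Δ - 1 :=
      (measurable_rescale Δ).comp (h.measurable_x i)
    rw [← h.law i, map_measureReal_apply hm (measurable_binOf d (measurableSet_singleton _))]
    rfl
  have hq := h.measureReal_outlier_le i hBm
  have hp0 : 0 ≤ μ.real (x i ⁻¹' B) := measureReal_nonneg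
  have hr : 1 / 16000 / ((d : ℝ) + 1) = 1 / 2000 / (d + 1) / 8 := by ring
  simp only [smul_eq_mul, probReal_univ]
  rw [hr]
  nlinarith

open Classical in
/-- The outliers in a bin outnumber the other points with exponentially small probability. -/
theorem IsNoisySample.measureReal_majority_le [IsProbabilityMeasure μ]
    (h : IsNoisySample μ x y P Δ δ η) (hη : η < 1 / 4) {d j : ℕ} (hj : j < d + 1) :
    μ.real {ω | ({i | binOf d (2 * x i ω / Δ - 1) = j} : Finset (Fin N)).card ≤
      2 * ({i | binOf d (2 * x i ω / Δ - 1) = j ∧ δ ≤ |y i ω - P.eval (x i ω)|} :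
        Finset (Fin N)).card} ≤ exp (-(1 / 16000 / (d + 1)) * N) := by
  set g : Fin N → Ω → ℝ := fun i ω =>
    chernoffFactor d j Δ (x i ω, δ ≤ |y i ω - P.eval (x i ω)|) with hg
  have hmX : ∀ i, Measurable fun ω => (x i ω, δ ≤ |y i ω - P.eval (x i ω)|) := fun i =>
    (h.measurable_x i).prodMk (measurable_to_prop (by
      convert h.measurableSet_outlier i using 1
      ext ω
      simp))
  have hgm : ∀ i, Measurable (g i) := fun i => (measurable_chernoffFactor d j Δ).comp (hmX i)
  have hprod : ∫ ω, ∏ i, g i ω ∂μ = ∏ i, ∫ ω, g i ω ∂μ :=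
    h.indep.integral_fun_prod_comp (fun i => (hmX i).aemeasurable)
      (f := fun _ => chernoffFactor d j Δ)
      (fun i => (measurable_chernoffFactor d j Δ).aestronglyMeasurable)
  have hle : ∫ ω, ∏ i, g i ω ∂μ ≤ exp (-(1 / 16000 / (d + 1)) * N) := by
    rw [hprod]
    calc ∏ i, ∫ ω, g i ω ∂μ ≤ ∏ _i : Fin N, exp (-(1 / 16000 / (d + 1))) := by
          refine prod_le_prod (fun i _ => integral_nonneg fun ω => (chernoffFactor_pos _ _ _ _).le)
            fun i _ => (h.integral_chernoffFactor_le hη hj i).trans ?_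
          have := add_one_le_exp (-(1 / 16000 / ((d : ℝ) + 1)))
          linarith
      _ = _ := by rw [prod_const, card_univ, Fintype.card_fin, ← exp_nat_mul, mul_comm]
  refine le_trans ?_ hle
  have hbound : ∀ i ω, g i ω ≤ 2 := fun i ω => by
    simp only [hg, chernoffFactor]
    split_ifs <;> norm_num
  have hint : Integrable (fun ω => ∏ i, g i ω) μ := by
    refine Integrable.of_bound (Finset.measurable_fun_prod _ fun i _ => hgm i).aestronglyMeasurable
      (2 ^ N) (ae_of_all _ fun ω => ?_)
    rw [norm_of_nonneg (prod_nonneg fun i _ => (chernoffFactor_pos _ _ _ _).le)]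
    calc _ ≤ ∏ _i : Fin N, (2 : ℝ) :=
          prod_le_prod (fun i _ => (chernoffFactor_pos _ _ _ _).le) fun i _ => hbound i ω
      _ = _ := by rw [prod_const, card_univ, Fintype.card_fin]
  have hmarkov := mul_meas_ge_le_integral_of_nonneg (μ := μ) (f := fun ω => ∏ i, g i ω)
    (ae_of_all _ fun ω => prod_nonneg fun i _ => (chernoffFactor_pos _ _ _ _).le) hint 1
  rw [one_mul] at hmarkov
  refine le_trans (measureReal_mono fun ω hω => ?_) hmarkov
  rw [Set.mem_ofPred_eq] at hω ⊢
  -- The product of the factors is 4^(outliers)/2^(points), which is at least 1 exactly when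
  -- outliers make up at least half of the bin; an empty bin is included.
  have hsplit : ∀ i, g i ω = (if binOf d (2 * x i ω / Δ - 1) = j then (1 / 2 : ℝ) else 1) *
      if binOf d (2 * x i ω / Δ - 1) = j ∧ δ ≤ |y i ω - P.eval (x i ω)| then 4 else 1 :=
    fun i => by
      by_cases h1 : binOf d (2 * x i ω / Δ - 1) = j <;>
        by_cases h2 : δ ≤ |y i ω - P.eval (x i ω)| <;>
        simp only [hg, chernoffFactor, h1, h2, if_true, if_false, and_true, and_false] <;>
        norm_num
  simp_rw [hsplit]
  rw [prod_mul_distrib, prod_ite, prod_ite, prod_const_one, prod_const_one, mul_one, mul_one,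
    prod_const, prod_const, show (4 : ℝ) = 2 ^ 2 by norm_num, ← pow_mul, one_div, inv_pow,
    inv_mul_eq_div, one_le_div (by positivity)]
  exact pow_le_pow_right₀ (by norm_num) hω

end RandomData

/-! ### The main theorem -/

section Main

open Finset

instance : IsProbabilityMeasure RealRAM.coinMeasure := by
  unfold RealRAM.coinMeasure
  have : IsProbabilityMeasure (PMF.uniformOfFintype Bool).toMeasure :=
    PMF.toMeasure.isProbabilityMeasure _
  infer_instance

/-- The number of data points that suffices for polynomials of degree `d`. -/
noncomputable def sampleSize (d : ℕ) : ℕ := ⌈16000 * ((d : ℝ) + 1) * Real.log (3 * (d + 1))⌉₊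

theorem isBigO_sampleSize :
    (fun d : ℕ => (sampleSize d : ℝ)) =O[atTop] (fun d : ℕ => (d : ℝ) * Real.log d) := by
  -- The constant is 16000 · 2 · 3 + 1. For d ≥ 3, log d ≥ 1 and 3(d + 1) ≤ d³.
  refine IsBigO.of_bound 96001 (eventually_atTop.2 ⟨3, fun d hd => ?_⟩)
  have hd3 : (3 : ℝ) ≤ d := by exact_mod_cast hd
  have hlog : 1 ≤ Real.log d := by
    rw [Real.le_log_iff_exp_le (by linarith)]
    exact Real.exp_one_lt_d9.le.trans (by linarith)
  have hlog3 : Real.log (3 * (d + 1)) ≤ 3 * Real.log d := by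
    rw [show (3 : ℝ) * Real.log d = Real.log ((d : ℝ) ^ 3) by rw [Real.log_pow]; norm_num]
    exact Real.log_le_log (by positivity) (by
      have : (3 : ℝ) * 3 * d ≤ d * d * d := by gcongr
      rw [pow_succ, sq]
      linarith)
  have hpos : 0 ≤ Real.log (3 * (d + 1)) := Real.log_nonneg (by linarith)
  have hceil := (Nat.ceil_lt_add_one (a := 16000 * ((d : ℝ) + 1) * Real.log (3 * (d + 1)))
    (by positivity)).le
  rw [Real.norm_of_nonneg (by positivity), Real.norm_of_nonneg (by positivity)]
  refine hceil.trans ?_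
  calc 16000 * ((d : ℝ) + 1) * Real.log (3 * (d + 1)) + 1
      ≤ 16000 * (2 * d) * (3 * Real.log d) + d * Real.log d := by
        have : (1 : ℝ) ≤ d * Real.log d := by nlinarith
        have : (d : ℝ) + 1 ≤ 2 * d := by linarith
        gcongr
    _ = _ := by ring

theorem one_le_log_three_mul (d : ℕ) : 1 ≤ Real.log (3 * ((d : ℝ) + 1)) := by
  rw [Real.le_log_iff_exp_le (by positivity)]
  have : (0 : ℝ) ≤ d := by positivity
  exact Real.exp_one_lt_d9.le.trans (by linarith)

theorem succ_le_of_sampleSize_le {d N : ℕ} (h : sampleSize d ≤ N) : d + 1 ≤ N := by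
  have h1 := Nat.ceil_le.1 h
  have h2 := one_le_log_three_mul d
  have h3 : ((d : ℝ) + 1) ≤ N := by
    have hd : (0 : ℝ) ≤ d := by positivity
    nlinarith
  exact_mod_cast h3

theorem mul_exp_le_of_sampleSize_le {d N : ℕ} (h : sampleSize d ≤ N) :
    ((d : ℝ) + 1) * Real.exp (-(1 / 16000 / (d + 1)) * N) ≤ 1 / 3 := by
  have hd : (0 : ℝ) < d + 1 := by positivity
  have h1 := Nat.ceil_le.1 h
  have h2 : -(1 / 16000 / ((d : ℝ) + 1)) * N ≤ -Real.log (3 * (d + 1)) := by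
    rw [neg_mul, neg_le_neg_iff, div_div, one_div_mul_eq_div, le_div_iff₀ (by positivity)]
    linarith
  calc ((d : ℝ) + 1) * Real.exp (-(1 / 16000 / (d + 1)) * N)
      ≤ (d + 1) * Real.exp (-Real.log (3 * (d + 1))) := by gcongr
    _ = 1 / 3 := by
      rw [Real.exp_neg, Real.exp_log (by positivity)]
      field_simp

/-- Data indexed by `Fin N`, extended by zero. -/
noncomputable def extendFin {N : ℕ} (f : Fin N → ℝ) (i : ℕ) : ℝ :=
  if h : i < N then f ⟨i, h⟩ else 0

theorem extendFin_val {N : ℕ} (f : Fin N → ℝ) (i : Fin N) : extendFin f i = f i := dif_pos i.2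

theorem card_filter_range {N : ℕ} (p : ℕ → Prop) [DecidablePred p] (q : Fin N → Prop)
    [DecidablePred q] (h : ∀ i : Fin N, p i ↔ q i) :
    ({i ∈ range N | p i}).card = ({i | q i} : Finset (Fin N)).card := by
  refine (card_bij (fun (i : Fin N) _ => (i : ℕ)) (fun i hi => ?_)
    (fun _ _ _ _ hij => Fin.val_injective hij)
    fun k hk => ?_).symm
  · rw [mem_filter, mem_range]
    exact ⟨i.2, (h i).2 (mem_filter.1 hi).2⟩
  · rw [mem_filter, mem_range] at hk
    exact ⟨⟨k, hk.1⟩, mem_filter.2 ⟨mem_univ _, (h ⟨k, hk.1⟩).1 hk.2⟩, rfl⟩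

theorem exp_identity {m Δ : ℝ} (hm : 0 < m) (hΔ : 0 < Δ) (d : ℕ) :
    (8 * m) ^ d / Δ ^ d = Real.exp (-(d : ℝ) * Real.log (Δ / (8 * m))) := by
  rw [neg_mul, ← mul_neg, ← Real.log_inv, inv_div, ← div_pow, Real.exp_nat_mul,
    Real.exp_log (by positivity)]

variable {d N : ℕ} {P : ℝ[X]} {Δ δ η m : ℝ}

open Classical in
/-- The algorithm succeeds on data with a majority of accurate points in each bin. -/
theorem extrapolation_returns_of_majority (hN : d + 1 ≤ N) (hP : P.natDegree ≤ d) (hΔ : 0 < Δ)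
    (hΔ1 : Δ < 1) (hδ : 0 ≤ δ) (hm : 1 ≤ m) (u v : Fin N → ℝ)
    (hu : ∀ i, 2 * u i / Δ - 1 ∈ Set.Ioo (-1) 1 ∧ Real.arccos (2 * u i / Δ - 1) ∉ sinZeros)
    (hmaj : ∀ j < d + 1,
      2 * ({i | binOf d (2 * u i / Δ - 1) = (j : ℕ) ∧ δ ≤ |v i - P.eval (u i)|} :
        Finset (Fin N)).card <
      ({i | binOf d (2 * u i / Δ - 1) = (j : ℕ)} : Finset (Fin N)).card) (coins : ℕ → Bool) :
    ∃ p : ℝ, RealRAM.Returns RealRAM.extrapolation d m Δ (fun i => (u i, v i)) coins p ∧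
      |p - P.eval m| ≤ 9 * δ / 4 * ((8 * m) ^ d / Δ ^ d) := by
  set x := extendFin u with hx
  set y := extendFin v with hy
  set bin : ℕ → ℝ := fun i => binOf d (2 * x i / Δ - 1) with hbin
  set θ : ℕ → ℝ := fun i => Real.arccos (2 * x i / Δ - 1) with hθ
  have hcos : ∀ i < N, Real.cos (θ i) = 2 * x i / Δ - 1 := fun i hi => by
    have := (hu ⟨i, hi⟩).1
    rw [← extendFin_val u] at this
    exact Real.cos_arccos this.1.le this.2.le
  have hg : IsGoodData d N x y bin θ P Δ δ := by
    refine ⟨fun i _ => rfl, fun i hi => ?_, fun i hi j _ hij => ?_, fun j hj => ?_⟩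
    · rw [hcos i hi]; field_simp; ring
    · obtain ⟨⟨h1, h2⟩, h3⟩ := hu ⟨i, hi⟩
      rw [← extendFin_val u] at h1 h2 h3
      refine angle_of_binOf_eq (Real.arccos_pos.2 h2) (Real.arccos_lt_pi.2 h1)
        (fun k hk _ => sin_ne_zero_of_notMem h3 hk) ?_
      rw [hcos i hi]
      exact hij
    · rw [card_filter_range (fun i => bin i = (j : ℕ)) (fun i => binOf d (2 * u i / Δ - 1) = (j : ℕ))
          fun i => by simp only [hbin, hx, extendFin_val],
        card_filter_range (fun i => bin i = (j : ℕ) ∧ δ ≤ |y i - P.eval (x i)|)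
          (fun i => binOf d (2 * u i / Δ - 1) = (j : ℕ) ∧ δ ≤ |v i - P.eval (u i)|)
          fun i => by simp only [hbin, hx, hy, extendFin_val]]
      exact hmaj j hj
  obtain ⟨X, Y, hstep, hret⟩ := RealRAM.returns_extrapolation (d := d) (N := N) (x := x) (y := y)
    -- The strict majority of inliers forces every bin to be nonempty.
    (bin := bin) m Δ (fun i => (u i, v i)) coins (fun i => extendFin_val u i)
    (fun i => extendFin_val v i) (fun i _ => rfl) fun j hj => by
      have := hg.majority j hj
      obtain ⟨i, hi⟩ := card_pos.1 (lt_of_le_of_lt (Nat.zero_le _) this)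
      rw [mem_filter, mem_range] at hi
      exact ⟨i, hi⟩
  exact ⟨_, hret, hg.abs_sub_le hP hδ hΔ hΔ1 hm hN hstep⟩

end Main

theorem mainTheorem3 (η : ℝ) (hη : η < 1 / 4) :
    ∃ (A : RealRAM.Prog) (n : ℕ → ℕ),
      RealRAM.PolyTime A ∧
      (fun d : ℕ => (n d : ℝ)) =O[atTop] (fun d : ℕ => (d : ℝ) * Real.log d) ∧
      ∀ (d N : ℕ), n d ≤ N →
      ∀ (P : ℝ[X]), P.natDegree ≤ d →
      ∀ (Δ δ m : ℝ), 0 < Δ → Δ < 1 → 0 < δ → 1 ≤ m →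
      ∀ (Ω : Type*) [MeasurableSpace Ω] (μ : Measure Ω) [IsProbabilityMeasure μ]
        (x y : Fin N → Ω → ℝ), IsNoisySample μ x y P Δ δ η →
        2 / 3 ≤ (μ.prod RealRAM.coinMeasure)
          {z : Ω × (ℕ → Bool) | ∃ p : ℝ,
            RealRAM.Returns A d m Δ (fun i => (x i z.1, y i z.1)) z.2 p ∧
            |p - P.eval m| ≤ 9 * δ / 4 * ((8 * m) ^ d / Δ ^ d)} ∧
        9 * δ / 4 * ((8 * m) ^ d / Δ ^ d) =
          9 * δ / 4 * Real.exp (-(d : ℝ) * Real.log (Δ / (8 * m)))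
 := by
  classical
  refine ⟨RealRAM.extrapolation, sampleSize, RealRAM.polyTime_extrapolation, isBigO_sampleSize, ?_⟩
  intro d N hN P hP Δ δ m hΔ hΔ1 hδ hm Ω _ μ _ x y h
  refine ⟨?_, by rw [exp_identity (by linarith) hΔ]⟩
  set S := {z : Ω × (ℕ → Bool) | ∃ p : ℝ,
    RealRAM.Returns RealRAM.extrapolation d m Δ (fun i => (x i z.1, y i z.1)) z.2 p ∧
    |p - P.eval m| ≤ 9 * δ / 4 * ((8 * m) ^ d / Δ ^ d)} with hS
  set good : Ω → Prop := fun ω => ∀ i, 2 * x i ω / Δ - 1 ∈ Set.Ioo (-1) 1 ∧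
    Real.arccos (2 * x i ω / Δ - 1) ∉ sinZeros with hgood
  set bad : ℕ → Set Ω := fun j =>
    {ω | ({i | binOf d (2 * x i ω / Δ - 1) = j} : Finset (Fin N)).card ≤
      2 * ({i | binOf d (2 * x i ω / Δ - 1) = j ∧ δ ≤ |y i ω - P.eval (x i ω)|} :
        Finset (Fin N)).card} with hbad
  have hgood_ae : ∀ᵐ ω ∂μ, good ω := by
    refine ae_all_iff.2 fun i => ?_
    have := ae_chebyshevDistribution
    rw [← h.law i] at this
    exact ae_of_ae_map ((measurable_rescale Δ).comp (h.measurable_x i)).aemeasurable this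
  set B : Set Ω := {ω | ¬ good ω} ∪ ⋃ j ∈ Finset.range (d + 1), bad j with hB
  have hBm : μ B ≤ 1 / 3 := by
    have h0 : μ {ω | ¬ good ω} = 0 := ae_iff.1 hgood_ae
    calc μ B ≤ 0 + ∑ j ∈ Finset.range (d + 1), μ (bad j) := by
          refine (measure_union_le _ _).trans ?_
          rw [h0]
          gcongr
          exact measure_biUnion_finset_le _ _
      _ ≤ ∑ _j ∈ Finset.range (d + 1),
            ENNReal.ofReal (Real.exp (-(1 / 16000 / ((d : ℝ) + 1)) * N)) := by
          rw [zero_add]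
          refine Finset.sum_le_sum fun j hj => ?_
          rw [← ofReal_measureReal]
          refine ENNReal.ofReal_le_ofReal ?_
          convert h.measureReal_majority_le hη (Finset.mem_range.1 hj)
      _ = ENNReal.ofReal (((d : ℝ) + 1) * Real.exp (-(1 / 16000 / ((d : ℝ) + 1)) * N)) := by
          rw [Finset.sum_const, Finset.card_range, nsmul_eq_mul,
            ENNReal.ofReal_mul (by positivity), ← Nat.cast_succ, ENNReal.ofReal_natCast]
      _ ≤ ENNReal.ofReal (1 / 3) := ENNReal.ofReal_le_ofReal (mul_exp_le_of_sampleSize_le hN)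
      _ = 1 / 3 := by
          rw [ENNReal.ofReal_div_of_pos (by norm_num)]
          norm_num
  -- The bad event concerns the data alone, as the algorithm succeeds on good data for all coin
  -- flips.
  have hsub : Sᶜ ⊆ B ×ˢ (Set.univ : Set (ℕ → Bool)) := by
    rintro ⟨ω, coins⟩ hz
    refine ⟨?_, Set.mem_univ _⟩
    by_contra hω
    rw [hB, Set.mem_union, not_or] at hω
    refine hz (extrapolation_returns_of_majority (succ_le_of_sampleSize_le hN) hP hΔ hΔ1 hδ.le hm
      (fun i => x i ω) (fun i => y i ω) (not_not.1 hω.1) (fun j hj => ?_) coins)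
    by_contra hcon
    refine hω.2 (Set.mem_biUnion (Finset.mem_coe.2 (Finset.mem_range.2 hj)) ?_)
    have := not_lt.1 hcon
    simp only [hbad, Set.mem_ofPred_eq]
    convert this
  have hSc : (μ.prod RealRAM.coinMeasure) Sᶜ ≤ 1 / 3 := by
    refine (measure_mono hsub).trans ?_
    rw [Measure.prod_prod, measure_univ, mul_one]
    exact hBm
  -- Subadditivity is enough here and does not need measurability of the success event.
  have h1 : 1 ≤ (μ.prod RealRAM.coinMeasure) S + 1 / 3 := by
    calc 1 = (μ.prod RealRAM.coinMeasure) (S ∪ Sᶜ) := by rw [Set.union_compl_self, measure_univ]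
      _ ≤ _ := (measure_union_le _ _).trans (by gcongr)
  have h3 : (2 / 3 : ENNReal) = 1 - 1 / 3 := by
    refine ENNReal.eq_sub_of_add_eq (by norm_num) ?_
    rw [← ENNReal.add_div]
    norm_num
    exact ENNReal.div_self (by norm_num) (by norm_num)
  rw [h3]
  exact tsub_le_iff_right.2 h1
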